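/- Let $(R,\mathfrak m)$ be an excellent Noetherian local ring of dimension $2$ which is unmixed, i.e. $\dim R/\mathfrak p=\dim R$ for every associated prime $\mathfrak p$ of $R$. Let $x,y$ be a system of parameters of $R$ and $Q=(x,y)$. Write $\ell$ for length, $H=H^1_{\mathfrak m}(R)$ for the first local cohomology module, and let $e_0(Q),e_1(Q),e_2(Q)\in\mathbb Z$ be the Hilbert coefficients of $Q$, so that $$\ell(R/Q^{n+1})=e_0(Q)\binom{n+2}{2}-e_1(Q)\binom{n+1}{1}+e_2(Q)\qquad (n\gg 0).$$ Let $$Q^{\lim}=\bigcup_{n\ge 0}\,(x^{n+1},y^{n+1}):_R (xy)^n$$ be the limit closure of $Q$. Then these coefficients exist, all lengths below are finite, and: (1) $\displaystyle e_0(Q)-\ell(R/Q^{\lim})=\ell\bigl(H/QH\bigr).$ (2) If $x$ is superficial for $Q$, i.e. there is an integer $c\ge 0$ such that $(Q^{n+1}:x)\cap Q^c=Q^n$ for all $n\ge c$, then $$e_0(Q)-\ell(R/Q^{\lim})+e_1(Q)=\ell\bigl(H/QH\bigr)-\ell\bigl(H/xH\bigr).$$ (3) For every such $Q$ (whether or not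 $x$ is superficial), $e_0(Q)-\ell(R/Q^{\lim})+e_1(Q)\le 0.$ (4) If $QH=0$, then $x,y$ is a standard system of parameters, i.e. $\ell(R/Q)-e_0(Q)=\ell(R/(x^2,y^2))-e_0((x^2,y^2))$, and $e_0(Q)-\ell(R/Q^{\lim})+e_1(Q)=0.$ -/

import Mathlib

noncomputable section

universe u v

open IsLocalRing

/-- The length of an `R`-module as an integer (meaningful for modules of finite length; the value
is `0` otherwise, so finiteness is always asserted separately). -/
def lengthInt (R : Type u) [CommRing R] (M : Type v) [AddCommGroup M] [Module R M] : ℤ :=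
  ((Module.length R M).toNat : ℤ)

/-! ### Excellent rings -/

/-- A ring is catenary if any two saturated chains of primes with the same end points have
the same length. (Over a Noetherian ring every chain between two primes has bounded length.) -/
def IsCatenaryRing (A : Type u) [CommRing A] : Prop :=
  ∀ s t : RelSeries {pq : PrimeSpectrum A × PrimeSpectrum A | pq.1 ⋖ pq.2},
    s.head = t.head → s.last = t.last → s.length = t.length

/-- A ring homomorphism `A → B` is regular if it is flat with geometrically regular fibres:
for every prime `q` of `A` and every finite extension `L` of `κ(q)`, the ring
`L ⊗ (κ(q) ⊗ B)` is regular. -/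
structure IsRegularAlgebra (A B : Type u) [CommRing A] [CommRing B] [Algebra A B] : Prop where
  flat : Module.Flat A B
  fiber_regular : ∀ (q : Ideal A) [q.IsPrime] (L : Type u) [Field L] [Algebra q.ResidueField L]
    [Module.Finite q.ResidueField L],
    IsRegularRing (TensorProduct q.ResidueField L (q.Fiber B))

/-- Excellent rings: Noetherian, universally catenary, G-ring and J-2. -/
structure IsExcellentRing (R : Type u) [CommRing R] : Prop where
  noetherian : IsNoetherianRing R
  universallyCatenary : ∀ (B : Type u) [CommRing B] [Algebra R B] [Algebra.FiniteType R B],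
    IsCatenaryRing B
  gRing : ∀ (p : Ideal R) [p.IsPrime],
    IsRegularAlgebra (Localization.AtPrime p)
      (AdicCompletion (maximalIdeal (Localization.AtPrime p)) (Localization.AtPrime p))
  jTwo : ∀ (B : Type u) [CommRing B] [Algebra R B] [Algebra.FiniteType R B],
    IsOpen {p : PrimeSpectrum B | IsRegularLocalRing (Localization.AtPrime p.asIdeal)}

/-! ### Unmixed rings, parameters, limit closure, superficial elements -/

/-- `R` is unmixed if `dim R/p = dim R` for every associated prime `p` of `R`. -/
def IsUnmixedRing (R : Type u) [CommRing R] : Prop :=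
  ∀ p ∈ associatedPrimes R R, ringKrullDim (R ⧸ p) = ringKrullDim R

/-- `x₁, …, x_d` is a system of parameters of the local ring `R`: `d = dim R` and the ideal
`(x₁, …, x_d)` is primary to the maximal ideal. -/
def IsSystemOfParameters {R : Type u} [CommRing R] [IsLocalRing R] {d : ℕ} (x : Fin d → R) :
    Prop :=
  ringKrullDim R = d ∧ (Ideal.span (Set.range x)).radical = maximalIdeal R

lemma limitClosure_step {R : Type u} [CommRing R] {d : ℕ} (x : Fin d → R) {a : R} {n : ℕ}
    (h : a * (∏ i, x i) ^ n ∈ Ideal.span (Set.range fun i => x i ^ (n + 1))) :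
    a * (∏ i, x i) ^ (n + 1) ∈ Ideal.span (Set.range fun i => x i ^ (n + 1 + 1)) := by
  rw [pow_succ, ← mul_assoc]
  generalize a * (∏ i, x i) ^ n = b at h ⊢
  induction h using Submodule.span_induction with
  | mem z hz =>
    obtain ⟨i, rfl⟩ := hz
    obtain ⟨c, hc⟩ := Finset.dvd_prod_of_mem x (Finset.mem_univ i)
    rw [hc, ← mul_assoc, ← pow_succ]
    exact Ideal.mul_mem_right _ _ (Ideal.subset_span ⟨i, rfl⟩)
  | zero => simp
  | add z w _ _ hz hw => rw [add_mul]; exact add_mem hz hw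
  | smul r z _ hz => rw [smul_eq_mul, mul_assoc]; exact Ideal.mul_mem_left _ _ hz

lemma limitClosure_mono {R : Type u} [CommRing R] {d : ℕ} (x : Fin d → R) {a : R} {n m : ℕ}
    (hnm : n ≤ m) (h : a * (∏ i, x i) ^ n ∈ Ideal.span (Set.range fun i => x i ^ (n + 1))) :
    a * (∏ i, x i) ^ m ∈ Ideal.span (Set.range fun i => x i ^ (m + 1)) := by
  induction m, hnm using Nat.le_induction with
  | base => exact h
  | succ k _ ih => exact limitClosure_step x ih

/-- The limit closure `⋃ₙ (x₁ⁿ⁺¹, …, x_dⁿ⁺¹) : (x₁ ⋯ x_d)ⁿ`. -/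
def limitClosure {R : Type u} [CommRing R] {d : ℕ} (x : Fin d → R) : Ideal R where
  carrier := {a | ∃ n : ℕ, a * (∏ i, x i) ^ n ∈ Ideal.span (Set.range fun i => x i ^ (n + 1))}
  add_mem' := by
    rintro a b ⟨n, hn⟩ ⟨m, hm⟩
    refine ⟨max n m, ?_⟩
    rw [add_mul]
    exact add_mem (limitClosure_mono x (le_max_left n m) hn)
      (limitClosure_mono x (le_max_right n m) hm)
  zero_mem' := ⟨0, by simp⟩
  smul_mem' := by
    rintro r a ⟨n, hn⟩
    exact ⟨n, by rw [smul_eq_mul, mul_assoc]; exact Ideal.mul_mem_left _ _ hn⟩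

/-- `x ∈ I` is superficial for `I` if for some `c`, `(Iⁿ⁺¹ : x) ∩ I^c = Iⁿ` for all `n ≥ c`. -/
def IsSuperficial {R : Type u} [CommRing R] (I : Ideal R) (x : R) : Prop :=
  x ∈ I ∧ ∃ c : ℕ, ∀ n ≥ c, (I ^ (n + 1)).colon {x} ⊓ I ^ c = I ^ n

/-! ### Hilbert coefficients -/

/-- `e₀, …, e_d` are the coefficients of the Hilbert–Samuel polynomial of `I` in degree `d`:
for all large `n`, `R/Iⁿ⁺¹` has finite length equal to `∑ᵢ (-1)ⁱ eᵢ (n+d-i choose d-i)`. -/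
def HasHilbertCoeffs {R : Type u} [CommRing R] (I : Ideal R) (d : ℕ) (e : ℕ → ℤ) : Prop :=
  ∀ᶠ n : ℕ in Filter.atTop, IsFiniteLength R (R ⧸ I ^ (n + 1)) ∧
    lengthInt R (R ⧸ I ^ (n + 1)) =
      ∑ i ∈ Finset.range (d + 1), (-1) ^ i * e i * ((n + d - i).choose (d - i) : ℤ)

/-- The Krull dimension of `R` as a natural number. -/
def dimNat (R : Type u) [CommRing R] : ℕ := ((ringKrullDim R).unbotD 0).toNat

open Classical in
/-- The `i`-th Hilbert coefficient `eᵢ(I)`, for `i ≤ dim R`. -/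
def hilbertCoeff {R : Type u} [CommRing R] (I : Ideal R) (i : ℕ) : ℤ :=
  if h : ∃ e : ℕ → ℤ, HasHilbertCoeffs I (dimNat R) e then h.choose i else 0

/-- A system of parameters is standard if
`ℓ(R/(x₁, …, x_d)) - e₀(x₁, …, x_d) = ℓ(R/(x₁², …, x_d²)) - e₀(x₁², …, x_d²)`. -/
def IsStandardParameters {R : Type u} [CommRing R] {d : ℕ} (x : Fin d → R) : Prop :=
  lengthInt R (R ⧸ Ideal.span (Set.range x)) - hilbertCoeff (Ideal.span (Set.range x)) 0 =
    lengthInt R (R ⧸ Ideal.span (Set.range fun i => x i ^ 2)) -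
      hilbertCoeff (Ideal.span (Set.range fun i => x i ^ 2)) 0

/-- The first local cohomology module `H¹_𝔪(R)`. -/
abbrev H1m (R : Type u) [CommRing R] [IsLocalRing R] : ModuleCat.{u} R :=
  (localCohomology (maximalIdeal R) 1).obj (ModuleCat.of R R)

/-- The quotient module `H¹_𝔪(R) / I H¹_𝔪(R)`. -/
abbrev H1mQuot (R : Type u) [CommRing R] [IsLocalRing R] (I : Ideal R) : Type u :=
  H1m R ⧸ (I • ⊤ : Submodule R (H1m R))

end

/-
Let `S = ⋃ₙ (R : Qⁿ)` be the ideal transform of `R` at `Q = (x, y)`. Then `S / R ≅ H¹_𝔪(R)` and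
`x, y` is a regular sequence on `S`, so that `ℓ(S / Qⁿ⁺¹S) = ℓ(S / QS) (n+2 choose 2)` exactly,
while `QS ∩ R` is the limit closure of `Q`. Once `S / R` has finite length, the Hilbert polynomial
of `Q` differs from that of `S` by the lengths `ℓ(QⁿS / QⁿR)`, which are eventually linear in `n`.
Their slope is at least `ℓ(S / (R + QS))`, with equality if `QS ⊆ R`, and it is `ℓ(S / (R + xS))` if
`x` is superficial.

That `S / R` has finite length amounts to a bound, uniform in `n`, on the `y`-saturation of `xⁿR`.
Along a filtration of `R` whose quotients embed in domains `R / p` of dimension two, this reduces to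
such a domain `A`. Its ideal transform is integral over `A` because `A` is universally catenary. If
no bound existed, there would be `sₙ` in the transform with `s₀ ∉ A`, `x s₀ ∈ A` and
`x sₙ₊₁ - sₙ ∈ A`; the elements `xⁿ⁺¹ sₙ ∈ A` converge `x`-adically to some `f`, not divisible by
`x`. The completion of `A` is reduced because `R` is a G-ring, so some prime avoids `x f`, and
modulo that prime all `f / xⁿ` are integral, which is impossible in a Noetherian domain.
-/

noncomputable section

universe u v

open IsLocalRing

/-! ### Local cohomology and the ideal transform -/

section Ext

open CategoryTheory Limits

variable {R : Type u} [CommRing R] {X X' : ModuleCat.{u} R}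

/-- The cochain map `Hom(P', Y) → Hom(P, Y)` given by precomposition with a chain map
`P → P'`. -/
def precompCochainMap {P P' : ChainComplex (ModuleCat.{u} R) ℕ} (φ : P ⟶ P') (Y : ModuleCat.{u} R) :
    P'.linearYonedaObj R Y ⟶ P.linearYonedaObj R Y :=
  (HomologicalComplex.unopFunctor _ _).map
    ((((linearYoneda R (ModuleCat.{u} R)).obj Y).rightOp.mapHomologicalComplex _).map φ).op

lemma isoExt_inv_naturality (P : ProjectiveResolution X) (P' : ProjectiveResolution X')
    (w : X ⟶ X') (φ : P.complex ⟶ P'.complex)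
    (comm : φ.f 0 ≫ P'.π.f 0 = P.π.f 0 ≫ w) (n : ℕ) (Y : ModuleCat.{u} R) :
    (P'.isoExt (R := R) n Y).inv ≫ ((Ext R (ModuleCat.{u} R) n).map w.op).app Y =
      HomologicalComplex.homologyMap (precompCochainMap φ Y) n ≫ (P.isoExt (R := R) n Y).inv := by
  have glue : ∀ {A B C A' B' C' : ModuleCat.{u} R} (a : A ⟶ B) (b : B ⟶ C) (m : C ⟶ C')
      (a' : A' ⟶ B') (b' : B' ⟶ C') (k : B ⟶ B') (l : A ⟶ A'),
      b ≫ m = k ≫ b' → a ≫ k = l ≫ a' → (a ≫ b) ≫ m = l ≫ a' ≫ b' := by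
    intro A B C A' B' C' a b m a' b' k l h₁ h₂
    rw [Category.assoc, h₁, ← Category.assoc, h₂, Category.assoc]
  exact glue _ _ _ _ _ _ _
    (congrArg Quiver.Hom.unop (ProjectiveResolution.isoLeftDerivedObj_hom_naturality w P P' φ comm
      ((linearYoneda R (ModuleCat.{u} R)).obj Y).rightOp n))
    (congrArg Quiver.Hom.unop
      (HomologicalComplex.homologyOp_hom_naturality (precompCochainMap φ Y) n))

section Cocycles

variable {K K' : CochainComplex (ModuleCat.{u} R) ℕ} {n : ℕ}

/-- The elements of `ker dⁿ` as cycles in the sense of homological complexes. -/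
def cocycleToCycles (K : CochainComplex (ModuleCat.{u} R) ℕ) (n : ℕ) :
    LinearMap.ker (K.d n (n + 1)).hom →ₗ[R] K.cycles n :=
  (K.liftCycles (ModuleCat.ofHom (LinearMap.ker (K.d n (n + 1)).hom).subtype) (n + 1) (by simp)
    (by ext z; exact z.2)).hom

lemma iCycles_cocycleToCycles (f : LinearMap.ker (K.d n (n + 1)).hom) :
    K.iCycles n (cocycleToCycles K n f) = f.1 := by
  exact ConcreteCategory.congr_hom (K.liftCycles_i
    (ModuleCat.ofHom (LinearMap.ker (K.d n (n + 1)).hom).subtype) (n + 1) (by simp)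
    (by ext z; exact z.2)) f

lemma iCycles_injective : Function.Injective (K.iCycles n) :=
  (ModuleCat.mono_iff_injective (K.iCycles n)).1 inferInstance

lemma cocycleToCycles_surjective : Function.Surjective (cocycleToCycles K n) := fun z =>
  ⟨⟨K.iCycles n z, by rw [LinearMap.mem_ker, ← ModuleCat.comp_apply]; simp⟩,
    iCycles_injective (iCycles_cocycleToCycles _)⟩

/-- The map from degree-`n` cocycles to degree-`n` cohomology classes. -/
def cocycleClass (K : CochainComplex (ModuleCat.{u} R) ℕ) (n : ℕ) :
    LinearMap.ker (K.d n (n + 1)).hom →ₗ[R] K.homology n :=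
  (K.homologyπ n).hom ∘ₗ cocycleToCycles K n

lemma cocycleClass_surjective : Function.Surjective (cocycleClass K n) :=
  ((ModuleCat.epi_iff_surjective (K.homologyπ n)).1 inferInstance).comp cocycleToCycles_surjective

lemma cocycleClass_eq_zero_iff (f : LinearMap.ker (K.d (n + 1) (n + 2)).hom) :
    cocycleClass K (n + 1) f = 0 ↔ ∃ g : K.X n, K.d n (n + 1) g = f.1 := by
  have hexact : (ShortComplex.mk (K.toCycles n (n + 1)) (K.homologyπ (n + 1)) (by simp)).Exact :=
    ShortComplex.exact_of_g_is_cokernel _ (K.homologyIsCokernel n (n + 1) (by simp))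
  have htoCycles : ∀ g : K.X n, K.iCycles (n + 1) (K.toCycles n (n + 1) g) = K.d n (n + 1) g :=
    fun g => by rw [← ModuleCat.comp_apply, HomologicalComplex.toCycles_i]
  refine ((ShortComplex.ShortExact.moduleCat_exact_iff_function_exact _).1 hexact
    (cocycleToCycles K (n + 1) f)).trans (exists_congr fun g => ?_)
  rw [← iCycles_cocycleToCycles f, ← htoCycles]
  exact iCycles_injective.eq_iff.symm

lemma homologyMap_cocycleClass (ψ : K' ⟶ K) (f' : LinearMap.ker (K'.d n (n + 1)).hom)
    (f : LinearMap.ker (K.d n (n + 1)).hom) (hf : f.1 = ψ.f n f'.1) :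
    HomologicalComplex.homologyMap ψ n (cocycleClass K' n f') = cocycleClass K n f := by
  have hcycles : HomologicalComplex.cyclesMap ψ n (cocycleToCycles K' n f') =
      cocycleToCycles K n f := by
    apply iCycles_injective
    rw [iCycles_cocycleToCycles, ← ModuleCat.comp_apply, HomologicalComplex.cyclesMap_i,
      ModuleCat.comp_apply, iCycles_cocycleToCycles, hf]
  change (K'.homologyπ n ≫ HomologicalComplex.homologyMap ψ n) (cocycleToCycles K' n f') = _
  rw [HomologicalComplex.homologyπ_naturality, ModuleCat.comp_apply, hcycles]
  rfl

end Cocycles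

/-- The map sending a cocycle on a projective resolution of `X` to its class in `Extⁿ(X, Y)`. -/
def extClass (P : ProjectiveResolution X) (Y : ModuleCat.{u} R) (n : ℕ) :
    LinearMap.ker ((P.complex.linearYonedaObj R Y).d n (n + 1)).hom →ₗ[R]
      ((Ext R (ModuleCat.{u} R) n).obj (Opposite.op X)).obj Y :=
  (P.isoExt (R := R) n Y).inv.hom ∘ₗ cocycleClass (P.complex.linearYonedaObj R Y) n

variable {Y : ModuleCat.{u} R} {n : ℕ}

lemma extClass_surjective (P : ProjectiveResolution X) : Function.Surjective (extClass P Y n) :=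
  ((ModuleCat.epi_iff_surjective (P.isoExt (R := R) n Y).inv).1 inferInstance).comp
    cocycleClass_surjective

lemma extClass_eq_zero_iff (P : ProjectiveResolution X)
    (f : LinearMap.ker ((P.complex.linearYonedaObj R Y).d (n + 1) (n + 2)).hom) :
    extClass P Y (n + 1) f = 0 ↔
      ∃ g : P.complex.X n ⟶ Y, P.complex.d (n + 1) n ≫ g = f.1 := by
  refine Iff.trans (map_eq_zero_iff (P.isoExt (R := R) (n + 1) Y).inv.hom ?_)
    (cocycleClass_eq_zero_iff f)
  exact (ModuleCat.mono_iff_injective (P.isoExt (R := R) (n + 1) Y).inv).1 inferInstance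

lemma extClass_naturality (P : ProjectiveResolution X) (P' : ProjectiveResolution X')
    (w : X ⟶ X') (φ : P.complex ⟶ P'.complex)
    (comm : φ.f 0 ≫ P'.π.f 0 = P.π.f 0 ≫ w)
    (f' : LinearMap.ker ((P'.complex.linearYonedaObj R Y).d n (n + 1)).hom)
    (f : LinearMap.ker ((P.complex.linearYonedaObj R Y).d n (n + 1)).hom)
    (hf : (f.1 : P.complex.X n ⟶ Y) = φ.f n ≫ (f'.1 : P'.complex.X n ⟶ Y)) :
    ((Ext R (ModuleCat.{u} R) n).map w.op).app Y (extClass P' Y n f') = extClass P Y n f :=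
  (ConcreteCategory.congr_hom (isoExt_inv_naturality P P' w φ comm n Y)
    (cocycleClass _ n f')).trans
    (congrArg (P.isoExt (R := R) n Y).inv.hom (homologyMap_cocycleClass _ f' f hf))

end Ext

section SmulBijective

open CategoryTheory Limits

variable {R P₁ P₀ E : Type*} [CommRing R] [AddCommGroup P₁] [Module R P₁] [AddCommGroup P₀]
  [Module R P₀] [AddCommGroup E] [Module R E] {d : P₁ →ₗ[R] P₀} {a : R}

lemma exists_comp_eq_of_bijective_lsmul (ha : ∀ p, a • p ∈ LinearMap.range d)
    (hE : Function.Bijective (LinearMap.lsmul R E a)) (f : P₁ →ₗ[R] E)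
    (hf : LinearMap.ker d ≤ LinearMap.ker f) : ∃ g : P₀ →ₗ[R] E, g ∘ₗ d = f := by
  let e := LinearEquiv.ofBijective _ hE
  let fbar : LinearMap.range d →ₗ[R] E :=
    (LinearMap.ker d).liftQ f hf ∘ₗ d.quotKerEquivRange.symm.toLinearMap
  have hfbar : ∀ q, fbar ⟨d q, q, rfl⟩ = f q := fun q =>
    congrArg ((LinearMap.ker d).liftQ f hf) (d.quotKerEquivRange_symm_apply_image q ⟨q, rfl⟩)
  refine ⟨e.symm.toLinearMap ∘ₗ fbar ∘ₗ (LinearMap.lsmul R P₀ a).codRestrict _ ha, ?_⟩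
  ext q
  refine e.symm_apply_eq.2 ?_
  have hsmul : (LinearMap.lsmul R P₀ a).codRestrict _ ha (d q) = ⟨d (a • q), a • q, rfl⟩ :=
    Subtype.ext (d.map_smul a q).symm
  rw [LinearMap.comp_apply, hsmul, hfbar, map_smul]
  rfl

lemma eq_of_comp_eq_of_injective_lsmul (ha : ∀ p, a • p ∈ LinearMap.range d)
    (hE : Function.Injective (LinearMap.lsmul R E a)) {g g' : P₀ →ₗ[R] E}
    (h : g ∘ₗ d = g' ∘ₗ d) : g = g' := by
  ext p
  obtain ⟨q, hq⟩ := ha p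
  apply hE
  rw [LinearMap.lsmul_apply, LinearMap.lsmul_apply, ← map_smul, ← map_smul, ← hq]
  exact LinearMap.congr_fun h q

end SmulBijective

section FractionQuotient

open CategoryTheory Limits

variable {R : Type u} [CommRing R]

/-- The module `Q(R)/R`, where `Q(R)` is the total ring of fractions. -/
abbrev FractionQuotient (R : Type u) [CommRing R] : Type u :=
  FractionRing R ⧸ (1 : Submodule R (FractionRing R))

lemma bijective_lsmul_fractionRing {x : R} (hx : x ∈ nonZeroDivisors R) :
    Function.Bijective (LinearMap.lsmul R (FractionRing R) x) := by
  have hunit := IsLocalization.map_units (FractionRing R) (⟨x, hx⟩ : nonZeroDivisors R)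
  have hsmul : ⇑(LinearMap.lsmul R (FractionRing R) x) = (algebraMap R (FractionRing R) x • ·) :=
    funext (Algebra.smul_def x)
  exact hsmul ▸ hunit.smul_bijective

lemma exists_algebraMap_eq_of_mem_one {M : Type*} [AddCommGroup M] [Module R M]
    (g : M →ₗ[R] FractionRing R) (hg : ∀ m, g m ∈ (1 : Submodule R (FractionRing R))) :
    ∃ g' : M →ₗ[R] R, ∀ m, algebraMap R (FractionRing R) (g' m) = g m := by
  have hinj : Function.Injective (Algebra.linearMap R (FractionRing R)) :=
    IsFractionRing.injective R (FractionRing R)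
  refine ⟨(LinearEquiv.ofInjective _ hinj).symm.toLinearMap ∘ₗ g.codRestrict _ fun m =>
    Submodule.one_eq_range (R := R) (A := FractionRing R) ▸ hg m, fun m => ?_⟩
  exact congrArg Subtype.val ((LinearEquiv.ofInjective _ hinj).apply_symm_apply _)

end FractionQuotient

section Connecting

open CategoryTheory Limits

variable {R : Type u} [CommRing R] {J J' : Ideal R}
  (P : ProjectiveResolution (ModuleCat.of R (R ⧸ J)))

lemma exact_d_one_zero_π : Function.Exact (P.complex.d 1 0).hom (P.π.f 0).hom :=
  (ShortComplex.ShortExact.moduleCat_exact_iff_function_exact _).1 P.exact₀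

lemma exact_d_two_one_d_one_zero :
    Function.Exact (P.complex.d 2 1).hom (P.complex.d 1 0).hom :=
  (ShortComplex.ShortExact.moduleCat_exact_iff_function_exact _).1 (P.exact_succ 0)

lemma smul_mem_range_d_one_zero {a : R} (ha : a ∈ J) (p : P.complex.X 0) :
    a • p ∈ LinearMap.range (P.complex.d 1 0).hom := by
  refine (exact_d_one_zero_π P (a • p)).1 ?_
  obtain ⟨r, hr⟩ := Ideal.Quotient.mk_surjective ((P.π.f 0).hom p : R ⧸ J)
  rw [map_smul, ← hr]
  exact Ideal.Quotient.eq_zero_iff_mem.2 (J.mul_mem_right r ha)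

lemma exists_π_eq_one : ∃ p, (P.π.f 0).hom p = (1 : R ⧸ J) :=
  (ModuleCat.epi_iff_surjective (P.π.f 0)).1 inferInstance (1 : R ⧸ J)

/-- A `1`-cocycle `f : P₁ → R` and `z ∈ Q(R)/R` are connected by `g : P₀ → Q(R)` if `g` extends
`f` along `P₁ → P₀` and induces `1 ↦ z` on `R/J → Q(R)/R`. -/
structure IsConnecting (f : P.complex.X 1 →ₗ[R] R) (g : P.complex.X 0 →ₗ[R] FractionRing R)
    (z : FractionQuotient R) : Prop where
  apply_d : ∀ q, g ((P.complex.d 1 0).hom q) = algebraMap R (FractionRing R) (f q)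
  mkQ_apply : ∀ p (r : R), (P.π.f 0).hom p = Ideal.Quotient.mk J r →
    (1 : Submodule R (FractionRing R)).mkQ (g p) = r • z

/-- The graph of the connecting homomorphism `Hom(R/J, Q(R)/R) → Ext¹(R/J, R)` of
`0 → R → Q(R) → Q(R)/R → 0`, read from right to left. -/
def connectingGraph :
    Submodule R ((((Ext R (ModuleCat.{u} R) 1).obj (Opposite.op (ModuleCat.of R (R ⧸ J)))).obj
      (ModuleCat.of R R)) × FractionQuotient R) where
  carrier := {ez | ∃ (f : LinearMap.ker
      ((P.complex.linearYonedaObj R (ModuleCat.of R R)).d 1 2).hom) (g : _),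
    extClass P _ 1 f = ez.1 ∧ IsConnecting P (ModuleCat.Hom.hom f.1) g ez.2}
  add_mem' := by
    rintro ⟨_, z⟩ ⟨_, z'⟩ ⟨f, g, rfl, h⟩ ⟨f', g', rfl, h'⟩
    refine ⟨f + f', g + g', map_add _ _ _, fun q => ?_, fun p r hp => ?_⟩
    · exact (congrArg₂ (· + ·) (h.apply_d q) (h'.apply_d q)).trans (map_add _ _ _).symm
    · rw [LinearMap.add_apply, map_add, h.mkQ_apply p r hp, h'.mkQ_apply p r hp]
      exact (smul_add r z z').symm
  zero_mem' := ⟨0, 0, map_zero _, fun _ => (map_zero (algebraMap R (FractionRing R))).symm,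
    fun _ r _ => (smul_zero r).symm⟩
  smul_mem' := by
    rintro a ⟨_, z⟩ ⟨f, g, rfl, h⟩
    refine ⟨a • f, a • g, map_smul _ _ _, fun q => ?_, fun p r hp => ?_⟩
    · rw [LinearMap.smul_apply, h.apply_d, Algebra.smul_def, ← map_mul]
      rfl
    · rw [LinearMap.smul_apply, map_smul, h.mkQ_apply p r hp]
      exact smul_comm a r z

variable {P} {a : R} {e : ((Ext R (ModuleCat.{u} R) 1).obj
  (Opposite.op (ModuleCat.of R (R ⧸ J)))).obj (ModuleCat.of R R)} {z : FractionQuotient R}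

lemma exists_mem_connectingGraph (ha : a ∈ nonZeroDivisors R) (haJ : a ∈ J) (e) :
    ∃ z, (e, z) ∈ connectingGraph P := by
  obtain ⟨f, rfl⟩ := extClass_surjective P e
  let fQ : P.complex.X 1 →ₗ[R] FractionRing R :=
    Algebra.linearMap R (FractionRing R) ∘ₗ ModuleCat.Hom.hom f.1
  have hker : LinearMap.ker (P.complex.d 1 0).hom ≤ LinearMap.ker fQ := by
    intro q hq
    obtain ⟨w, rfl⟩ := (exact_d_two_one_d_one_zero P q).1 hq
    have hfw : ModuleCat.Hom.hom f.1 ((P.complex.d 2 1).hom w) = 0 :=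
      ConcreteCategory.congr_hom (show P.complex.d 2 1 ≫ f.1 = 0 from f.2) w
    exact (congrArg (algebraMap R (FractionRing R)) hfw).trans (map_zero _)
  obtain ⟨g, hg⟩ := exists_comp_eq_of_bijective_lsmul (smul_mem_range_d_one_zero P haJ)
    (bijective_lsmul_fractionRing ha) fQ hker
  have hgd : ∀ q, g ((P.complex.d 1 0).hom q) = fQ q := LinearMap.congr_fun hg
  obtain ⟨p₁, hp₁⟩ := exists_π_eq_one P
  refine ⟨Submodule.mkQ 1 (g p₁), f, g, rfl, hgd, fun p r hp => ?_⟩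
  have hsub : (P.π.f 0).hom (p - r • p₁) = 0 := by
    rw [map_sub, map_smul, hp, hp₁]
    exact sub_eq_zero.2 (Algebra.algebraMap_eq_smul_one (A := R ⧸ J) r)
  obtain ⟨q, hq⟩ := (exact_d_one_zero_π P _).1 hsub
  rw [← sub_eq_zero, ← map_smul, ← map_sub, ← map_smul, ← map_sub, ← hq, hgd]
  exact (Submodule.Quotient.mk_eq_zero _).2 (Submodule.algebraMap_mem _)

lemma eq_zero_of_zero_mem_connectingGraph (ha : a ∈ nonZeroDivisors R) (haJ : a ∈ J)
    (hz : (0, z) ∈ connectingGraph P) : z = 0 := by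
  obtain ⟨f, g, hf, h⟩ := hz
  obtain ⟨g', hg'⟩ := (extClass_eq_zero_iff P f).1 hf
  have hgg' : g = Algebra.linearMap R (FractionRing R) ∘ₗ g'.hom := by
    refine eq_of_comp_eq_of_injective_lsmul (smul_mem_range_d_one_zero P haJ)
      (bijective_lsmul_fractionRing ha).1 (LinearMap.ext fun q => (h.apply_d q).trans ?_)
    rw [← hg']
    rfl
  obtain ⟨p, hp⟩ := exists_π_eq_one P
  rw [← one_smul R z, ← h.mkQ_apply p 1 (hp.trans (map_one (Ideal.Quotient.mk J)).symm), hgg']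
  exact (Submodule.Quotient.mk_eq_zero _).2 (Submodule.algebraMap_mem _)

lemma eq_zero_of_mem_connectingGraph_zero (he : (e, 0) ∈ connectingGraph P) : e = 0 := by
  obtain ⟨f, g, rfl, h⟩ := he
  obtain ⟨g', hg'⟩ := exists_algebraMap_eq_of_mem_one g fun p => by
    obtain ⟨r, hr⟩ := Ideal.Quotient.mk_surjective ((P.π.f 0).hom p : R ⧸ J)
    exact (Submodule.Quotient.mk_eq_zero _).1 ((h.mkQ_apply p r hr.symm).trans (smul_zero r))
  refine (extClass_eq_zero_iff P f).2 ⟨ModuleCat.ofHom g', ?_⟩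
  refine ModuleCat.hom_ext (LinearMap.ext fun q => IsFractionRing.injective R (FractionRing R) ?_)
  exact (hg' _).trans (h.apply_d q)

lemma smul_eq_zero_of_mem_connectingGraph (he : (e, z) ∈ connectingGraph P) {b : R}
    (hb : b ∈ J) : b • z = 0 := by
  obtain ⟨f, g, rfl, h⟩ := he
  obtain ⟨p, hp⟩ := exists_π_eq_one P
  have hbp : (P.π.f 0).hom (b • p) = Ideal.Quotient.mk J b := by
    rw [map_smul, hp]
    exact (Algebra.algebraMap_eq_smul_one (A := R ⧸ J) b).symm
  have hb0 : Ideal.Quotient.mk J b = Ideal.Quotient.mk J 0 :=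
    (Ideal.Quotient.eq_zero_iff_mem.2 hb).trans (map_zero _).symm
  rw [← h.mkQ_apply _ b hbp, h.mkQ_apply _ 0 (hbp.trans hb0), zero_smul]

lemma exists_mem_connectingGraph_of_smul_eq_zero (hz : ∀ a ∈ J, a • z = 0) :
    ∃ e, (e, z) ∈ connectingGraph P := by
  obtain ⟨s, rfl⟩ := Submodule.mkQ_surjective _ z
  have hproj : Module.Projective R (P.complex.X 0) :=
    (IsProjective.iff_projective (P.complex.X 0)).2 (P.projective 0)
  obtain ⟨ψ, hψ⟩ := Module.projective_lifting_property (Submodule.mkQ J) (P.π.f 0).hom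
    (Submodule.mkQ_surjective J)
  have hψ' : ∀ p, Ideal.Quotient.mk J (ψ p) = (P.π.f 0).hom p := LinearMap.congr_fun hψ
  let g : P.complex.X 0 →ₗ[R] FractionRing R := LinearMap.toSpanSingleton R _ s ∘ₗ ψ
  have hgJ : ∀ p, ψ p ∈ J → g p ∈ (1 : Submodule R (FractionRing R)) := fun p hp =>
    (Submodule.Quotient.mk_eq_zero _).1 (hz _ hp)
  obtain ⟨f, hf⟩ := exists_algebraMap_eq_of_mem_one (g ∘ₗ (P.complex.d 1 0).hom) fun q =>
    hgJ _ (Ideal.Quotient.eq_zero_iff_mem.1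
      ((hψ' _).trans ((exact_d_one_zero_π P).apply_apply_eq_zero q)))
  have hcocycle : P.complex.d 2 1 ≫ ModuleCat.ofHom f = 0 := by
    refine ModuleCat.hom_ext (LinearMap.ext fun q =>
      IsFractionRing.injective R (FractionRing R) ((hf _).trans ?_))
    refine (congrArg g ((exact_d_two_one_d_one_zero P).apply_apply_eq_zero q)).trans ?_
    exact (map_zero g).trans (map_zero _).symm
  refine ⟨extClass P _ 1 ⟨ModuleCat.ofHom f, hcocycle⟩, _, g, rfl, fun q => (hf q).symm,
    fun p r hp => ?_⟩
  rw [← map_smul, ← sub_eq_zero, ← map_sub]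
  refine (Submodule.Quotient.mk_eq_zero _).2 ?_
  have hmem : (ψ p - r) • s ∈ (1 : Submodule R (FractionRing R)) :=
    (Submodule.Quotient.mk_eq_zero _).1 (hz _ (Ideal.Quotient.eq.1 ((hψ' p).trans hp)))
  rwa [sub_smul] at hmem

lemma map_mem_connectingGraph {P' : ProjectiveResolution (ModuleCat.of R (R ⧸ J'))}
    (w : ModuleCat.of R (R ⧸ J) ⟶ ModuleCat.of R (R ⧸ J'))
    (hw : ∀ r : R, w.hom (Ideal.Quotient.mk J r) = Ideal.Quotient.mk J' r) {e'}
    (he : (e', z) ∈ connectingGraph P') :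
    (((Ext R (ModuleCat.{u} R) 1).map w.op).app _ e', z) ∈ connectingGraph P := by
  obtain ⟨f, g, rfl, h⟩ := he
  let φ := ProjectiveResolution.lift w P P'
  have hφπ : φ.f 0 ≫ P'.π.f 0 = P.π.f 0 ≫ w := ProjectiveResolution.lift_commutes_zero w P P'
  have hcocycle : ∀ f₀ : P'.complex.X 1 ⟶ ModuleCat.of R R, P'.complex.d 2 1 ≫ f₀ = 0 →
      P.complex.d 2 1 ≫ φ.f 1 ≫ f₀ = 0 := fun f₀ hf₀ => by
    rw [← φ.comm_assoc, hf₀, comp_zero]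
  refine ⟨⟨φ.f 1 ≫ (f.1 : P'.complex.X 1 ⟶ _), hcocycle _ f.2⟩, g ∘ₗ (φ.f 0).hom,
    (extClass_naturality P P' w φ hφπ f _ rfl).symm, fun q => ?_, fun p r hp => ?_⟩
  · exact (congrArg g (ConcreteCategory.congr_hom (φ.comm 1 0) q).symm).trans (h.apply_d _)
  · refine h.mkQ_apply _ r ?_
    refine (ConcreteCategory.congr_hom hφπ p).trans ?_
    exact (congrArg w.hom hp).trans (hw r)

lemma exists_linearMap_connectingGraph (P : ProjectiveResolution (ModuleCat.of R (R ⧸ J)))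
    (ha : a ∈ nonZeroDivisors R) (haJ : a ∈ J) :
    ∃ Φ : ((Ext R (ModuleCat.{u} R) 1).obj (Opposite.op (ModuleCat.of R (R ⧸ J)))).obj
      (ModuleCat.of R R) →ₗ[R] FractionQuotient R,
      ∀ e z, (e, z) ∈ connectingGraph P ↔ z = Φ e := by
  suffices h : ∃ Φ, connectingGraph P = LinearMap.graph Φ from
    h.imp fun Φ hΦ e z => by rw [hΦ, LinearMap.mem_graph_iff]
  refine Submodule.exists_eq_graph ⟨?_, fun e => ?_⟩
  · rintro ⟨⟨e, z⟩, hz⟩ ⟨⟨e', z'⟩, hz'⟩ (rfl : e = e')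
    have hsub := sub_mem hz hz'
    rw [Prod.mk_sub_mk, sub_self] at hsub
    simp only [sub_eq_zero.1 (eq_zero_of_zero_mem_connectingGraph ha haJ hsub)]
  · obtain ⟨z, hz⟩ := exists_mem_connectingGraph ha haJ e
    exact ⟨⟨(e, z), hz⟩, rfl⟩

end Connecting

section IdealTransform

open CategoryTheory Limits

variable {R : Type u} [CommRing R] {I : Ideal R} {x y : R}

/-- The ideal transform of `R` at `I`: the submodule `⋃ₙ (R : Iⁿ)` of the total ring of
fractions. -/
def idealTransform (I : Ideal R) : Submodule R (FractionRing R) where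
  carrier := {s | ∃ n : ℕ, ∀ a ∈ I ^ n, a • s ∈ (1 : Submodule R (FractionRing R))}
  add_mem' := by
    rintro s t ⟨n, hn⟩ ⟨m, hm⟩
    refine ⟨max n m, fun a ha => smul_add a s t ▸ add_mem (hn a ?_) (hm a ?_)⟩
    · exact Ideal.pow_le_pow_right (le_max_left n m) ha
    · exact Ideal.pow_le_pow_right (le_max_right n m) ha
  zero_mem' := ⟨0, fun a _ => (smul_zero (A := FractionRing R) a).symm ▸ zero_mem _⟩
  smul_mem' := by
    rintro r s ⟨n, hn⟩
    exact ⟨n, fun a ha => smul_comm r a s ▸ Submodule.smul_mem _ r (hn a ha)⟩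

lemma mem_idealTransform_span_pair {s : FractionRing R} :
    s ∈ idealTransform (Ideal.span {x, y}) ↔ ∃ n : ℕ, x ^ n • s ∈ (1 : Submodule R _) ∧
      y ^ n • s ∈ (1 : Submodule R (FractionRing R)) := by
  have hx : x ∈ Ideal.span {x, y} := Ideal.subset_span (Set.mem_insert x _)
  have hy : y ∈ Ideal.span {x, y} := Ideal.subset_span (Set.mem_insert_of_mem x rfl)
  refine ⟨fun ⟨n, hn⟩ => ⟨n, hn _ (Ideal.pow_mem_pow hx n), hn _ (Ideal.pow_mem_pow hy n)⟩, ?_⟩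
  rintro ⟨n, hxs, hys⟩
  refine ⟨n + n, fun a ha => ?_⟩
  have hle : Ideal.span {x, y} ^ (n + n) ≤ Ideal.span {x ^ n, y ^ n} := by
    rw [Ideal.span_insert, Ideal.span_insert (x ^ n), ← Ideal.span_singleton_pow,
      ← Ideal.span_singleton_pow]
    exact Ideal.sup_pow_add_le_pow_sup_pow
  obtain ⟨b, c, rfl⟩ := Ideal.mem_span_pair.1 (hle ha)
  rw [add_smul, mul_smul, mul_smul]
  exact add_mem (Submodule.smul_mem _ b hxs) (Submodule.smul_mem _ c hys)

/-- The inclusion of `R` into its ideal transform at `I`. -/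
def toTransform (I : Ideal R) : R →ₗ[R] idealTransform I :=
  (Algebra.linearMap R (FractionRing R)).codRestrict _ fun r =>
    ⟨0, fun a _ => Submodule.smul_mem _ a (Submodule.algebraMap_mem r)⟩

lemma toTransform_injective (I : Ideal R) : Function.Injective (toTransform I) := fun _ _ h =>
  IsFractionRing.injective R (FractionRing R) (congrArg Subtype.val h)

lemma mem_range_toTransform {s : idealTransform I} :
    s ∈ LinearMap.range (toTransform I) ↔ s.1 ∈ (1 : Submodule R (FractionRing R)) := by
  rw [Submodule.mem_one]
  exact ⟨fun ⟨r, hr⟩ => ⟨r, congrArg Subtype.val hr⟩, fun ⟨r, hr⟩ => ⟨r, Subtype.ext hr⟩⟩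

lemma preservesColimit_forget_moduleCat (F : ℕᵒᵖᵒᵖ ⥤ ModuleCat.{u} R) :
    PreservesColimit F (forget (ModuleCat.{u} R)) := by
  have hcof : IsCofiltered ℕᵒᵖ := isCofiltered_op_of_isFiltered ℕ
  have hfil : IsFiltered ℕᵒᵖᵒᵖ := isFiltered_op_of_isCofiltered ℕᵒᵖ
  have hpres : PreservesFilteredColimitsOfSize.{0, 0} (forget (ModuleCat.{u} R)) :=
    preservesFilteredColimitsOfSize_shrink.{0, u, 0, u} _
  exact (hpres.preserves_filtered_colimits ℕᵒᵖᵒᵖ).preservesColimit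

-- The maps `Ext¹(R/Iᵗ, R) → Q(R)/R` inverse to the connecting homomorphisms are compatible in `t`.
lemma exists_injective_localCohomology_one {a : R} (ha : a ∈ nonZeroDivisors R) (haI : a ∈ I) :
    ∃ Ψ : (localCohomology I 1).obj (ModuleCat.of R R) →ₗ[R] FractionQuotient R,
      Function.Injective Ψ ∧
      ∀ z, z ∈ LinearMap.range Ψ ↔ ∃ n : ℕ, ∀ b ∈ I ^ n, b • z = 0 := by
  let D := localCohomology.diagram (localCohomology.idealPowersDiagram I) 1
  let ev := (evaluation (ModuleCat.{u} R) (ModuleCat.{u} R)).obj (ModuleCat.of R R)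
  have hD : HasColimit D := localCohomology.hasColimitDiagram.{u, 0} _ 1
  let hc : IsColimit (ev.mapCocone (colimit.cocone D)) :=
    isColimitOfPreserves ev (colimit.isColimit D)
  let P : ∀ t : ℕ, ProjectiveResolution (ModuleCat.of R (R ⧸ I ^ t)) := fun t =>
    ProjectiveResolution.of _
  choose Φ hmem using fun t : ℕ =>
    exists_linearMap_connectingGraph (P t) (pow_mem ha t) (Ideal.pow_mem_pow haI t)
  let c : Cocone (D ⋙ ev) :=
    { pt := ModuleCat.of R (FractionQuotient R)
      ι :=
        { app := fun t => ModuleCat.ofHom (Φ t.unop.unop)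
          naturality := fun t t' w => ModuleCat.hom_ext <| LinearMap.ext fun e =>
            ((hmem t'.unop.unop _ _).1 (map_mem_connectingGraph
              ((localCohomology.ringModIdeals (localCohomology.idealPowersDiagram I)).map w.unop)
              (fun _ => rfl) ((hmem t.unop.unop e _).2 rfl))).symm } }
  have hfac : ∀ (t : ℕ) e, hc.desc c ((ev.mapCocone (colimit.cocone D)).ι.app
      (Opposite.op (Opposite.op t)) e) = Φ t e := fun t e =>
    ConcreteCategory.congr_hom (hc.fac c (Opposite.op (Opposite.op t))) e
  refine ⟨(hc.desc c).hom, (injective_iff_map_eq_zero _).2 fun h hh => ?_, fun z => ⟨?_, ?_⟩⟩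
  · have hpres := preservesColimit_forget_moduleCat (D ⋙ ev)
    obtain ⟨⟨⟨t⟩⟩, e, rfl⟩ := Concrete.isColimit_exists_rep _ hc h
    have he : e = 0 := eq_zero_of_mem_connectingGraph_zero
      ((hmem t e 0).2 ((hfac t e).symm.trans hh).symm)
    exact he ▸ map_zero _
  · rintro ⟨h, rfl⟩
    have hpres := preservesColimit_forget_moduleCat (D ⋙ ev)
    obtain ⟨⟨⟨t⟩⟩, e, rfl⟩ := Concrete.isColimit_exists_rep _ hc h
    exact ⟨t, fun b hb => smul_eq_zero_of_mem_connectingGraph ((hmem t e _).2 (hfac t e)) hb⟩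
  · rintro ⟨t, ht⟩
    obtain ⟨e, he⟩ := exists_mem_connectingGraph_of_smul_eq_zero (P := P t) ht
    exact ⟨_, (hfac t e).trans ((hmem t e z).1 he).symm⟩

theorem nonempty_localCohomology_one_equiv {a : R} (ha : a ∈ nonZeroDivisors R) (haI : a ∈ I) :
    Nonempty ((localCohomology I 1).obj (ModuleCat.of R R) ≃ₗ[R]
      idealTransform I ⧸ LinearMap.range (toTransform I)) := by
  obtain ⟨Ψ, hΨ, hrange⟩ := exists_injective_localCohomology_one ha haI
  let π : idealTransform I →ₗ[R] FractionQuotient R :=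
    (1 : Submodule R (FractionRing R)).mkQ ∘ₗ (idealTransform I).subtype
  have hπker : LinearMap.range (toTransform I) = LinearMap.ker π := by
    ext s
    exact mem_range_toTransform.trans (Submodule.Quotient.mk_eq_zero _).symm
  have hπrange : LinearMap.range Ψ = LinearMap.range π := by
    ext z
    obtain ⟨s, rfl⟩ := Submodule.mkQ_surjective _ z
    rw [hrange]
    constructor
    · rintro ⟨n, hn⟩
      exact ⟨⟨s, n, fun b hb => (Submodule.Quotient.mk_eq_zero _).1 (hn b hb)⟩, rfl⟩
    · rintro ⟨⟨t, n, ht⟩, hts⟩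
      exact ⟨n, fun b hb => hts ▸ (Submodule.Quotient.mk_eq_zero _).2 (ht b hb)⟩
  exact ⟨LinearEquiv.ofInjective Ψ hΨ ≪≫ₗ LinearEquiv.ofEq _ _ hπrange ≪≫ₗ
    π.quotKerEquivRange.symm ≪≫ₗ Submodule.quotEquivOfEq _ _ hπker.symm⟩

end IdealTransform

/-! ### Lengths in a module with a regular pair -/

section RelLength

variable {R M M' : Type*} [CommRing R] [AddCommGroup M] [Module R M] [AddCommGroup M'] [Module R M']

/-- The length of `B / (A ⊓ B)`; for `A ≤ B` this is the length of the subquotient `B / A`. -/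
def relLength (A B : Submodule R M) : ℕ∞ := Module.length R (B ⧸ A.submoduleOf B)

lemma relLength_self (A : Submodule R M) : relLength A A = 0 :=
  Module.length_eq_zero_iff.2 (Submodule.Quotient.subsingleton_iff.2 (Submodule.submoduleOf_self A))

lemma relLength_top (A : Submodule R M) : relLength A ⊤ = Module.length R (M ⧸ A) := by
  refine (Submodule.Quotient.equiv _ _ Submodule.topEquiv ?_).length_eq
  exact Submodule.ext fun m =>
    ⟨by rintro ⟨⟨a, _⟩, ha, rfl⟩; exact ha, fun h => ⟨⟨m, trivial⟩, h, rfl⟩⟩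

lemma relLength_inf_comap (f : M →ₗ[R] M') (A : Submodule R M') (B : Submodule R M) :
    relLength (B ⊓ A.comap f) B = relLength A (B.map f ⊔ A) := by
  let g : B →ₗ[R] ↥(B.map f ⊔ A) ⧸ A.submoduleOf (B.map f ⊔ A) :=
    Submodule.mkQ _ ∘ₗ f.restrict fun b hb => Submodule.mem_sup_left (Submodule.mem_map_of_mem hb)
  have hg : Function.Surjective g := by
    intro z
    obtain ⟨⟨z, hz⟩, rfl⟩ := Submodule.mkQ_surjective _ z
    obtain ⟨_, ⟨b, hb, rfl⟩, a, ha, rfl⟩ := Submodule.mem_sup.1 hz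
    refine ⟨⟨b, hb⟩, (Submodule.Quotient.eq _).2 ?_⟩
    change f b - (f b + a) ∈ A
    rwa [sub_add_cancel_left, neg_mem_iff]
  have hker : LinearMap.ker g = (B ⊓ A.comap f).submoduleOf B := by
    ext ⟨b, hb⟩
    exact (Submodule.Quotient.mk_eq_zero _).trans ⟨fun h => ⟨hb, h⟩, fun h => h.2⟩
  rw [relLength, ← hker]
  exact (LinearMap.quotKerEquivOfSurjective g hg).length_eq

lemma relLength_add {A B C : Submodule R M} (hAB : A ≤ B) (hBC : B ≤ C) :
    relLength A B + relLength B C = relLength A C := by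
  let f : (B ⧸ A.submoduleOf B) →ₗ[R] C ⧸ A.submoduleOf C :=
    Submodule.mapQ _ _ (Submodule.inclusion hBC) fun _ hb => hb
  let g : (C ⧸ A.submoduleOf C) →ₗ[R] C ⧸ B.submoduleOf C :=
    Submodule.mapQ _ _ LinearMap.id fun _ hb => hAB hb
  refine (Module.length_eq_add_of_exact f g ?_ ?_ ?_).symm
  · refine LinearMap.ker_eq_bot.1 ((Submodule.ker_mapQ _ _ _ _).trans (eq_bot_iff.2 ?_))
    exact Submodule.map_le_iff_le_comap.2 fun b hb => (Submodule.Quotient.mk_eq_zero _).2 hb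
  · intro z
    obtain ⟨c, rfl⟩ := Submodule.mkQ_surjective _ z
    exact ⟨Submodule.Quotient.mk c, rfl⟩
  · intro z
    obtain ⟨z, rfl⟩ := Submodule.mkQ_surjective _ z
    refine (Submodule.Quotient.mk_eq_zero (B.submoduleOf C)).trans ⟨fun hz =>
      ⟨Submodule.Quotient.mk ⟨z, hz⟩, rfl⟩, ?_⟩
    rintro ⟨w, hw⟩
    obtain ⟨w, rfl⟩ := Submodule.mkQ_surjective _ w
    have h : (w : M) - z ∈ A := (Submodule.Quotient.eq (A.submoduleOf C)).1 hw
    have hz : (w : M) - (w - z) ∈ B := sub_mem w.2 (hAB h)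
    rwa [sub_sub_cancel] at hz

lemma relLength_smul_range {I : Ideal R} {j : R →ₗ[R] M} (hj : Function.Injective j) :
    relLength (I • LinearMap.range j) (LinearMap.range j) = Module.length R (R ⧸ I) := by
  have hI : I • LinearMap.range j = Submodule.map j I := by
    rw [← Submodule.map_top, ← Submodule.map_smul'', smul_eq_mul, Ideal.mul_top]
  have h := relLength_inf_comap j (Submodule.map j I) ⊤
  rwa [top_inf_eq, Submodule.comap_map_eq_of_injective hj, relLength_top,
    sup_eq_left.2 (Submodule.map_mono le_top), Submodule.map_top, ← hI, eq_comm] at h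

end RelLength

section RegularPair

open RingTheory.Sequence

variable {R S : Type*} [CommRing R] [AddCommGroup S] [Module R S] {x y : R}

lemma isWeaklyRegular_pair_iff : IsWeaklyRegular S [x, y] ↔
    IsSMulRegular S x ∧ ∀ s t : S, x • s = y • t → ∃ v, t = x • v := by
  rw [isWeaklyRegular_cons_iff, isWeaklyRegular_singleton_iff]
  refine and_congr_right fun _ => (isSMulRegular_quotient_iff_mem_of_smul_mem _ _).trans ?_
  simp only [Submodule.mem_smul_pointwise_iff_exists, Submodule.mem_top, true_and,
    forall_exists_index, eq_comm (a := x • _)]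
  exact forall_comm

lemma exists_eq_smul_of_smul_eq (h : IsWeaklyRegular S [x, y]) {s t : S} (hst : x • s = y • t) :
    ∃ v, s = y • v ∧ t = x • v := by
  obtain ⟨hx, hxy⟩ := isWeaklyRegular_pair_iff.1 h
  obtain ⟨v, rfl⟩ := hxy s t hst
  exact ⟨v, hx (hst.trans (smul_comm y x v)), rfl⟩

lemma isWeaklyRegular_pair_pow (h : IsWeaklyRegular S [x, y]) (m n : ℕ) :
    IsWeaklyRegular S [x ^ m, y ^ n] := by
  have hy : IsWeaklyRegular S [x, y ^ n] := by
    rw [isWeaklyRegular_cons_iff, isWeaklyRegular_singleton_iff] at h ⊢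
    exact ⟨h.1, h.2.pow n⟩
  have hx := (isWeaklyRegular_pair_iff.1 h).1
  refine isWeaklyRegular_pair_iff.2 ⟨hx.pow m, ?_⟩
  induction m with
  | zero => exact fun s t _ => ⟨t, by rw [pow_zero, one_smul]⟩
  | succ m ih =>
    intro s t hst
    rw [pow_succ', mul_smul] at hst
    obtain ⟨v, hv, rfl⟩ := exists_eq_smul_of_smul_eq hy hst
    obtain ⟨w, rfl⟩ := ih s v hv
    exact ⟨w, by rw [pow_succ', mul_smul]⟩

end RegularPair

section SpanPair

variable {R S : Type*} [CommRing R] [AddCommGroup S] [Module R S] {x y : R} {N : Submodule R S}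
  {n : ℕ} {s : S}

lemma mem_span_pair_smul :
    s ∈ Ideal.span {x, y} • N ↔ ∃ a ∈ N, ∃ b ∈ N, x • a + y • b = s := by
  simp only [Ideal.span_insert, Submodule.sup_smul, Submodule.mem_sup,
    Submodule.ideal_span_singleton_smul, Submodule.mem_smul_pointwise_iff_exists,
    exists_exists_and_eq_and]

lemma left_smul_mem (hs : s ∈ Ideal.span {x, y} ^ n • N) :
    x • s ∈ Ideal.span {x, y} ^ (n + 1) • N := by
  rw [pow_succ', mul_smul]
  exact Submodule.smul_mem_smul (Ideal.subset_span (Set.mem_insert x _)) hs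

lemma right_smul_mem (hs : s ∈ Ideal.span {x, y} ^ n • N) :
    y • s ∈ Ideal.span {x, y} ^ (n + 1) • N := by
  rw [pow_succ', mul_smul]
  exact Submodule.smul_mem_smul (Ideal.subset_span (Set.mem_insert_of_mem x rfl)) hs

lemma right_pow_smul_mem (n : ℕ) (hs : s ∈ N) : y ^ n • s ∈ Ideal.span {x, y} ^ n • N := by
  have hy : y ∈ Ideal.span {x, y} := Ideal.subset_span (Set.mem_insert_of_mem x rfl)
  exact Submodule.smul_mem_smul (Ideal.pow_mem_pow hy n) hs

lemma pow_succ_smul_le (I : Ideal R) (N : Submodule R S) (n : ℕ) : I ^ (n + 1) • N ≤ I ^ n • N :=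
  Submodule.smul_mono_left (Ideal.pow_le_pow_right n.le_succ)

lemma mem_span_pair_pow_succ_smul : s ∈ Ideal.span {x, y} ^ (n + 1) • N ↔
    ∃ a ∈ Ideal.span {x, y} ^ n • N, ∃ b ∈ N, x • a + y ^ (n + 1) • b = s := by
  refine ⟨?_, ?_⟩
  · induction n generalizing s with
    | zero => simp only [zero_add, pow_one, mem_span_pair_smul, pow_zero, one_smul, imp_self]
    | succ n ih =>
      rw [pow_succ', mul_smul, mem_span_pair_smul]
      rintro ⟨a, ha, b, hb, rfl⟩
      obtain ⟨c, hc, d, hd, rfl⟩ := ih hb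
      refine ⟨a + y • c, add_mem ha (right_smul_mem hc), d, hd, ?_⟩
      rw [smul_add, smul_add, smul_comm x y c, smul_smul y (y ^ _), ← pow_succ' y (n + 1),
        add_assoc]
  · rintro ⟨a, ha, b, hb, rfl⟩
    exact add_mem (left_smul_mem ha) (right_pow_smul_mem _ hb)

end SpanPair

section PowerFiltration

open RingTheory.Sequence

variable {R S : Type*} [CommRing R] [AddCommGroup S] [Module R S] {x y : R} {N : Submodule R S}
  {n : ℕ}

/-- The preimage `N :_S x`. -/
def colonLeft (x : R) (N : Submodule R S) : Submodule R S := N.comap (LinearMap.lsmul R S x)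

/-- The submodule `(N :_S x) ∩ (Qⁿ N :_S yⁿ⁺¹)` with `Q = (x, y)`. It measures the kernel of
multiplication by `x` between consecutive pieces `Qⁿ S / Qⁿ N`, see `relLength_mulKernel`. -/
def colonBoth (x y : R) (N : Submodule R S) (n : ℕ) : Submodule R S :=
  colonLeft x N ⊓ (Ideal.span {x, y} ^ n • N).comap (LinearMap.lsmul R S (y ^ (n + 1)))

/-- The submodule `Qⁿ S ∩ (Qⁿ⁺¹ N :_S x)` with `Q = (x, y)`: modulo `Qⁿ N`, it is the kernel of
multiplication by `x` from `Qⁿ S / Qⁿ N` to `Qⁿ⁺¹ S / Qⁿ⁺¹ N`. -/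
def mulKernel (x y : R) (N : Submodule R S) (n : ℕ) : Submodule R S :=
  Ideal.span {x, y} ^ n • ⊤ ⊓ (Ideal.span {x, y} ^ (n + 1) • N).comap (LinearMap.lsmul R S x)

lemma colonBoth_mono (x y : R) (N : Submodule R S) : Monotone (colonBoth x y N) := by
  refine monotone_nat_of_le_succ fun n => inf_le_inf_left _ fun v hv => ?_
  have hyv : y • y ^ (n + 1) • v ∈ Ideal.span {x, y} ^ (n + 1) • N := right_smul_mem hv
  rwa [smul_smul, ← pow_succ'] at hyv

lemma le_mulKernel : Ideal.span {x, y} ^ n • N ≤ mulKernel x y N n :=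
  le_inf (Submodule.smul_mono le_rfl le_top) fun _ hs => left_smul_mem hs

lemma map_pow_colonLeft_sup (h : IsWeaklyRegular S [x, y]) :
    (colonLeft x N).map (LinearMap.lsmul R S (y ^ (n + 1))) ⊔ Ideal.span {x, y} ^ n • N =
      mulKernel x y N n := by
  refine le_antisymm (sup_le ?_ le_mulKernel) ?_
  · rintro _ ⟨v, hv, rfl⟩
    refine ⟨pow_succ_smul_le _ _ _ (right_pow_smul_mem _ trivial), ?_⟩
    change x • y ^ (n + 1) • v ∈ Ideal.span {x, y} ^ (n + 1) • N
    exact smul_comm x (y ^ (n + 1)) v ▸ right_pow_smul_mem _ hv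
  · rintro s ⟨-, hs⟩
    obtain ⟨q, hq, m, hm, hqm⟩ := mem_span_pair_pow_succ_smul.1 hs
    have hxs : x • (s - q) = y ^ (n + 1) • m := by
      rw [smul_sub, sub_eq_iff_eq_add, add_comm]; exact hqm.symm
    obtain ⟨v, hv, rfl⟩ :=
      exists_eq_smul_of_smul_eq (pow_one x ▸ isWeaklyRegular_pair_pow h 1 (n + 1)) hxs
    exact Submodule.mem_sup.2 ⟨_, ⟨v, hm, hv.symm⟩, q, hq, sub_add_cancel s q⟩

lemma relLength_mulKernel (h : IsWeaklyRegular S [x, y]) :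
    relLength (Ideal.span {x, y} ^ n • N) (mulKernel x y N n) =
      relLength (colonBoth x y N n) (colonLeft x N) := by
  rw [← map_pow_colonLeft_sup h, colonBoth, relLength_inf_comap]

lemma map_pow_top_sup : (⊤ : Submodule R S).map (LinearMap.lsmul R S (y ^ (n + 1))) ⊔
    ((Ideal.span {x, y} ^ n • (⊤ : Submodule R S)).map (LinearMap.lsmul R S x) ⊔
      Ideal.span {x, y} ^ (n + 1) • N) =
      Ideal.span {x, y} ^ (n + 1) • ⊤ := by
  refine le_antisymm (sup_le ?_ (sup_le ?_ (Submodule.smul_mono le_rfl le_top))) fun s hs => ?_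
  · rintro _ ⟨b, -, rfl⟩
    exact right_pow_smul_mem _ trivial
  · rintro _ ⟨b, hb, rfl⟩
    exact left_smul_mem hb
  · obtain ⟨a, ha, b, -, rfl⟩ := mem_span_pair_pow_succ_smul.1 hs
    exact add_comm (x • a) _ ▸
      Submodule.add_mem_sup ⟨b, trivial, rfl⟩ (Submodule.mem_sup_left ⟨a, ha, rfl⟩)

lemma comap_pow_map_sup (h : IsWeaklyRegular S [x, y]) :
    ((Ideal.span {x, y} ^ n • (⊤ : Submodule R S)).map (LinearMap.lsmul R S x) ⊔
      Ideal.span {x, y} ^ (n + 1) • N).comap (LinearMap.lsmul R S (y ^ (n + 1))) =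
      N ⊔ (⊤ : Submodule R S).map (LinearMap.lsmul R S x) := by
  refine le_antisymm (fun s hs => ?_) (sup_le (fun m hm => ?_) ?_)
  · obtain ⟨_, ⟨a, -, rfl⟩, b, hb, hab⟩ := Submodule.mem_sup.1 hs
    obtain ⟨q, -, m, hm, rfl⟩ := mem_span_pair_pow_succ_smul.1 hb
    have hxs : x • (a + q) = y ^ (n + 1) • (s - m) := by
      rw [smul_sub, eq_sub_iff_add_eq, smul_add, add_assoc]; exact hab
    obtain ⟨v, -, hv⟩ :=
      exists_eq_smul_of_smul_eq (pow_one x ▸ isWeaklyRegular_pair_pow h 1 (n + 1)) hxs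
    exact Submodule.mem_sup.2 ⟨m, hm, _, ⟨v, trivial, hv.symm⟩, add_sub_cancel m s⟩
  · exact Submodule.mem_sup_right (right_pow_smul_mem _ hm)
  · rintro _ ⟨s, -, rfl⟩
    refine Submodule.mem_sup_left ⟨y ^ (n + 1) • s, ?_, smul_comm x _ s⟩
    exact pow_succ_smul_le _ _ _ (right_pow_smul_mem _ trivial)

lemma relLength_pow_succ (h : IsWeaklyRegular S [x, y]) (N : Submodule R S) (n : ℕ) :
    relLength (Ideal.span {x, y} ^ (n + 1) • N) (Ideal.span {x, y} ^ (n + 1) • ⊤) =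
      relLength (mulKernel x y N n) (Ideal.span {x, y} ^ n • ⊤) +
        relLength (N ⊔ (⊤ : Submodule R S).map (LinearMap.lsmul R S x)) ⊤ := by
  rw [mulKernel, relLength_inf_comap, ← comap_pow_map_sup (n := n) h, ← top_inf_eq
    (Submodule.comap _ _), relLength_inf_comap, map_pow_top_sup]
  refine (relLength_add le_sup_right (sup_le ?_ (Submodule.smul_mono le_rfl le_top))).symm
  rintro _ ⟨s, hs, rfl⟩
  exact left_smul_mem hs

lemma relLength_pow_of_smul_top_le (h : IsWeaklyRegular S [x, y])
    (hN : Ideal.span {x, y} • ⊤ ≤ N) (n : ℕ) :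
    relLength (Ideal.span {x, y} ^ n • N) (Ideal.span {x, y} ^ n • ⊤) =
      (n + 1 : ℕ) * relLength N ⊤ := by
  have hx (s : S) : x • s ∈ N :=
    hN (Submodule.smul_mem_smul (Ideal.subset_span (Set.mem_insert x _)) trivial)
  have hy (s : S) : y • s ∈ N :=
    hN (Submodule.smul_mem_smul (Ideal.subset_span (Set.mem_insert_of_mem x rfl)) trivial)
  induction n with
  | zero => simp
  | succ n ih =>
    have hsup : N ⊔ (⊤ : Submodule R S).map (LinearMap.lsmul R S x) = N :=
      sup_eq_left.2 (Submodule.map_le_iff_le_comap.2 fun s _ => hx s)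
    have hcolon : colonLeft x N ≤ colonBoth x y N n := fun s _ => ⟨hx s, by
      change y ^ (n + 1) • s ∈ Ideal.span {x, y} ^ n • N
      rw [pow_succ, mul_smul]
      exact right_pow_smul_mem n (hy s)⟩
    have hker : relLength (Ideal.span {x, y} ^ n • N) (mulKernel x y N n) = 0 := by
      rw [relLength_mulKernel h, le_antisymm hcolon inf_le_left, relLength_self]
    rw [relLength_pow_succ h, hsup, ← zero_add (relLength (mulKernel x y N n) _), ← hker,
      relLength_add le_mulKernel inf_le_left, ih]
    push_cast
    ring

lemma relLength_pow_smul_top (h : IsWeaklyRegular S [x, y]) (n : ℕ) :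
    relLength (Ideal.span {x, y} ^ n • (⊤ : Submodule R S)) ⊤ =
      ((n + 1).choose 2 : ℕ) * relLength (Ideal.span {x, y} • (⊤ : Submodule R S)) ⊤ := by
  induction n with
  | zero => simp [relLength_self]
  | succ n ih =>
    rw [← relLength_add (pow_succ_smul_le _ _ n) le_top, ih, pow_succ, mul_smul,
      relLength_pow_of_smul_top_le h le_rfl, ← add_mul, Nat.choose_succ_succ' (n + 1) 1,
      Nat.choose_one_right, add_comm]
    push_cast
    ring

lemma le_relLength_pow (h : IsWeaklyRegular S [x, y]) (N : Submodule R S) (n : ℕ) :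
    (n + 1 : ℕ) * relLength (N ⊔ Ideal.span {x, y} • ⊤) ⊤ ≤
      relLength (Ideal.span {x, y} ^ n • N) (Ideal.span {x, y} ^ n • ⊤) := by
  rw [← relLength_pow_of_smul_top_le h le_sup_right n, ← relLength_add
    (Submodule.smul_mono le_rfl (le_sup_left : N ≤ N ⊔ Ideal.span {x, y} • ⊤))
    (Submodule.smul_mono le_rfl le_top)]
  exact le_add_self

end PowerFiltration

section EventuallyLinear

lemma exists_eventually_eq_of_antitone {k : ℕ → ℕ} (hk : Antitone k) :
    ∃ c, ∀ᶠ n in Filter.atTop, k n = c := by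
  obtain ⟨n₀, hn₀⟩ := WellFoundedLT.antitone_chain_condition hk
  exact ⟨k n₀, Filter.eventually_atTop.2 ⟨n₀, fun n hn => (hn₀ n hn).symm⟩⟩

lemma exists_eventually_eq_mul_add {q : ℕ → ℕ} {b : ℤ}
    (hb : ∀ᶠ n in Filter.atTop, (q (n + 1) : ℤ) = q n + b) :
    ∃ c : ℤ, ∀ᶠ n in Filter.atTop, (q n : ℤ) = b * n + c := by
  obtain ⟨n₀, hn₀⟩ := Filter.eventually_atTop.1 hb
  refine ⟨q n₀ - b * n₀, Filter.eventually_atTop.2 ⟨n₀, fun n hn => ?_⟩⟩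
  induction n, hn using Nat.le_induction with
  | base => ring
  | succ n hn ih =>
    rw [hn₀ n hn, ih]
    push_cast
    ring

lemma le_of_eventually_mul_le {g c b : ℤ}
    (h : ∀ᶠ n : ℕ in Filter.atTop, g * n ≤ b * n + c) : g ≤ b := by
  obtain ⟨n₀, hn₀⟩ := Filter.eventually_atTop.1 h
  by_contra! hlt
  have hn := hn₀ (n₀ + c.toNat + 1) (by omega)
  have hc : c < (n₀ + c.toNat + 1 : ℕ) := by omega
  have hmul : (1 : ℤ) * (n₀ + c.toNat + 1 : ℕ) ≤ (g - b) * (n₀ + c.toNat + 1 : ℕ) :=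
    mul_le_mul_of_nonneg_right (by omega) (Int.natCast_nonneg _)
  linarith

end EventuallyLinear

section PowColength

open RingTheory.Sequence

variable {R S : Type*} [CommRing R] [AddCommGroup S] [Module R S] {x y : R} {N : Submodule R S}
  {b : ℤ}

lemma relLength_sup_ne_top (hN : relLength N ⊤ ≠ ⊤) (A : Submodule R S) :
    relLength (N ⊔ A) ⊤ ≠ ⊤ :=
  ne_top_of_le_ne_top hN (relLength_add (le_sup_left : N ≤ N ⊔ A) le_top ▸ le_add_self)

lemma relLength_pow_ne_top (h : IsWeaklyRegular S [x, y]) (hN : relLength N ⊤ ≠ ⊤) (n : ℕ) :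
    relLength (Ideal.span {x, y} ^ n • N) (Ideal.span {x, y} ^ n • ⊤) ≠ ⊤ := by
  induction n with
  | zero => simpa using hN
  | succ n ih =>
    rw [← relLength_add (le_mulKernel (n := n)) inf_le_left] at ih
    rw [relLength_pow_succ h]
    exact WithTop.add_ne_top.2 ⟨(WithTop.add_ne_top.1 ih).2, relLength_sup_ne_top hN _⟩

/-- The function `n ↦ ℓ(QⁿS / QⁿN)` with `Q = (x, y)`, for `N` of finite colength in `S`. It is
eventually linear, and its slope is `-e₁(Q)` when `N` is a copy of the ring. -/
def powColength (x y : R) (N : Submodule R S) (n : ℕ) : ℕ :=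
  (relLength (Ideal.span {x, y} ^ n • N) (Ideal.span {x, y} ^ n • ⊤)).toNat

lemma coe_powColength (h : IsWeaklyRegular S [x, y]) (hN : relLength N ⊤ ≠ ⊤) (n : ℕ) :
    (powColength x y N n : ℕ∞) =
      relLength (Ideal.span {x, y} ^ n • N) (Ideal.span {x, y} ^ n • ⊤) :=
  ENat.natCast_toNat (relLength_pow_ne_top h hN n)

lemma relLength_colonBoth_ne_top (h : IsWeaklyRegular S [x, y]) (hN : relLength N ⊤ ≠ ⊤)
    (n : ℕ) : relLength (colonBoth x y N n) (colonLeft x N) ≠ ⊤ := by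
  have hfin := relLength_pow_ne_top h hN n
  rw [← relLength_add le_mulKernel inf_le_left, relLength_mulKernel h] at hfin
  exact (WithTop.add_ne_top.1 hfin).1

lemma powColength_succ_add (h : IsWeaklyRegular S [x, y]) (hN : relLength N ⊤ ≠ ⊤) (n : ℕ) :
    powColength x y N (n + 1) + (relLength (colonBoth x y N n) (colonLeft x N)).toNat =
      powColength x y N n +
        (relLength (N ⊔ (⊤ : Submodule R S).map (LinearMap.lsmul R S x)) ⊤).toNat := by
  rw [← ENat.natCast_inj, Nat.cast_add, Nat.cast_add, coe_powColength h hN, coe_powColength h hN,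
    ENat.natCast_toNat (relLength_colonBoth_ne_top h hN n),
    ENat.natCast_toNat (relLength_sup_ne_top hN _), relLength_pow_succ h, ← relLength_mulKernel h,
    ← relLength_add (le_mulKernel (n := n) (N := N)) inf_le_left]
  ring

lemma exists_eventually_powColength_succ (h : IsWeaklyRegular S [x, y])
    (hN : relLength N ⊤ ≠ ⊤) : ∃ b : ℤ, ∀ᶠ n in Filter.atTop,
      (powColength x y N (n + 1) : ℤ) = powColength x y N n + b := by
  have hanti : Antitone fun n => (relLength (colonBoth x y N n) (colonLeft x N)).toNat := by
    refine antitone_nat_of_succ_le fun n => ?_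
    refine ENat.toNat_le_toNat ?_ (relLength_colonBoth_ne_top h hN n)
    rw [← relLength_add (colonBoth_mono x y N n.le_succ) inf_le_left]
    exact le_add_self
  obtain ⟨c, hc⟩ := exists_eventually_eq_of_antitone hanti
  refine ⟨(relLength (N ⊔ (⊤ : Submodule R S).map (LinearMap.lsmul R S x)) ⊤).toNat - c, ?_⟩
  filter_upwards [hc] with n hn
  have hadd := powColength_succ_add h hN n
  omega

lemma relLength_sup_le_of_powColength_succ (h : IsWeaklyRegular S [x, y])
    (hN : relLength N ⊤ ≠ ⊤) (hb : ∀ᶠ n in Filter.atTop,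
      (powColength x y N (n + 1) : ℤ) = powColength x y N n + b) :
    ((relLength (N ⊔ Ideal.span {x, y} • ⊤) ⊤).toNat : ℤ) ≤ b := by
  obtain ⟨c, hc⟩ := exists_eventually_eq_mul_add hb
  refine le_of_eventually_mul_le (c := c) ?_
  filter_upwards [hc] with n hn
  have hle := le_relLength_pow h N n
  rw [← coe_powColength h hN, ← ENat.natCast_toNat (relLength_sup_ne_top hN _), ← Nat.cast_mul,
    Nat.cast_le] at hle
  rw [← hn, mul_comm]
  exact_mod_cast (Nat.mul_le_mul_right _ n.le_succ).trans hle

lemma eq_relLength_of_mulKernel_le (h : IsWeaklyRegular S [x, y]) (hN : relLength N ⊤ ≠ ⊤)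
    (hb : ∀ᶠ n in Filter.atTop, (powColength x y N (n + 1) : ℤ) = powColength x y N n + b)
    (hle : ∀ᶠ n in Filter.atTop, mulKernel x y N n ≤ Ideal.span {x, y} ^ n • N) :
    b = (relLength (N ⊔ (⊤ : Submodule R S).map (LinearMap.lsmul R S x)) ⊤).toNat := by
  obtain ⟨n, hn, hker⟩ := (hb.and hle).exists
  have hadd := powColength_succ_add h hN n
  rw [← relLength_mulKernel h, le_antisymm hker le_mulKernel, relLength_self, ENat.toNat_zero]
    at hadd
  omega

lemma powColength_of_smul_top_le (h : IsWeaklyRegular S [x, y])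
    (hQN : Ideal.span {x, y} • ⊤ ≤ N) (n : ℕ) :
    powColength x y N n = (n + 1) * (relLength N ⊤).toNat := by
  rw [powColength, relLength_pow_of_smul_top_le h hQN, ENat.toNat_mul, ENat.toNat_natCast]

lemma eq_relLength_of_smul_top_le (h : IsWeaklyRegular S [x, y])
    (hb : ∀ᶠ n in Filter.atTop, (powColength x y N (n + 1) : ℤ) = powColength x y N n + b)
    (hQN : Ideal.span {x, y} • ⊤ ≤ N) : b = (relLength N ⊤).toNat := by
  obtain ⟨n, hn⟩ := hb.exists
  rw [powColength_of_smul_top_le h hQN, powColength_of_smul_top_le h hQN] at hn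
  push_cast at hn
  linarith

end PowColength

section HilbertCoefficients

open RingTheory.Sequence

variable {R : Type u} [CommRing R] {I : Ideal R} {e e' : ℕ → ℤ}

lemma hasHilbertCoeffs_two_iff : HasHilbertCoeffs I 2 e ↔ ∀ᶠ n : ℕ in Filter.atTop,
    IsFiniteLength R (R ⧸ I ^ (n + 1)) ∧ lengthInt R (R ⧸ I ^ (n + 1)) =
      e 0 * ((n + 2).choose 2 : ℕ) - e 1 * (n + 1 : ℕ) + e 2 := by
  refine Filter.eventually_congr (Filter.Eventually.of_forall fun n => and_congr_right fun _ => ?_)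
  simp only [Finset.sum_range_succ, Finset.range_zero, Finset.sum_empty, pow_zero, pow_one,
    Nat.sub_zero, Nat.add_sub_cancel, Nat.reduceSub, Nat.add_one_sub_one, Nat.choose_one_right,
    Nat.choose_zero_right, Nat.cast_one, zero_add, one_mul, mul_one, neg_one_sq,
    neg_mul, ← sub_eq_add_neg]

lemma hasHilbertCoeffs_two_unique (h : HasHilbertCoeffs I 2 e) (h' : HasHilbertCoeffs I 2 e') :
    e 0 = e' 0 ∧ e 1 = e' 1 := by
  obtain ⟨n₀, hn₀⟩ := Filter.eventually_atTop.1
    ((hasHilbertCoeffs_two_iff.1 h).and (hasHilbertCoeffs_two_iff.1 h'))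
  have hdiff (m : ℕ) (hm : n₀ ≤ m) :
      (e 0 - e' 0) * ((m + 2).choose 2 : ℕ) - (e 1 - e' 1) * (m + 1) + (e 2 - e' 2) = 0 := by
    obtain ⟨⟨-, h₁⟩, -, h₂⟩ := hn₀ m hm
    push_cast at h₁ h₂
    linear_combination h₂ - h₁
  have hchoose (m : ℕ) : (((m + 1) + 2).choose 2 : ℤ) = (m + 2).choose 2 + (m + 2) := by
    rw [Nat.choose_succ_succ' (m + 2) 1, Nat.choose_one_right]
    push_cast
    ring
  have h₀ := hdiff n₀ le_rfl
  have h₁ := hdiff (n₀ + 1) (by omega)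
  have h₂ := hdiff (n₀ + 1 + 1) (by omega)
  rw [hchoose] at h₁ h₂
  rw [hchoose] at h₂
  push_cast at h₀ h₁ h₂
  have h0 : e 0 - e' 0 = 0 := by linear_combination h₂ - 2 * h₁ + h₀
  rw [h0] at h₀ h₁
  exact ⟨sub_eq_zero.1 h0, sub_eq_zero.1 (by linear_combination h₀ - h₁)⟩

lemma hasHilbertCoeffs_hilbertCoeff (hdim : ringKrullDim R = 2) (h : HasHilbertCoeffs I 2 e) :
    HasHilbertCoeffs I 2 (hilbertCoeff I) := by
  have hd : dimNat R = 2 := by rw [dimNat, hdim]; rfl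
  have hex : ∃ e, HasHilbertCoeffs I (dimNat R) e := ⟨e, hd ▸ h⟩
  have heq : hilbertCoeff I = hex.choose := funext fun i => dif_pos hex
  have hspec := hex.choose_spec
  rwa [← heq, hd] at hspec

variable {S : Type*} [AddCommGroup S] [Module R S] {x y : R} {j : R →ₗ[R] S}

lemma length_quotient_pow_add (h : IsWeaklyRegular S [x, y]) (hj : Function.Injective j)
    (hN : relLength (LinearMap.range j) ⊤ ≠ ⊤) (n : ℕ) :
    Module.length R (R ⧸ Ideal.span {x, y} ^ n) + relLength (LinearMap.range j) ⊤ =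
      powColength x y (LinearMap.range j) n +
        ((n + 1).choose 2 : ℕ) * relLength (Ideal.span {x, y} • (⊤ : Submodule R S)) ⊤ := by
  rw [← relLength_smul_range hj, relLength_add Submodule.smul_le_right le_top,
    coe_powColength h hN, ← relLength_pow_smul_top h,
    relLength_add (Submodule.smul_mono le_rfl le_top) le_top]

lemma relLength_span_pair_smul_ne_top (h : IsWeaklyRegular S [x, y]) (hj : Function.Injective j)
    (hN : relLength (LinearMap.range j) ⊤ ≠ ⊤)
    (hQ : Module.length R (R ⧸ Ideal.span {x, y}) ≠ ⊤) :
    relLength (Ideal.span {x, y} • (⊤ : Submodule R S)) ⊤ ≠ ⊤ := by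
  have hadd := length_quotient_pow_add h hj hN 1
  rw [pow_one, one_add_one_eq_two, Nat.choose_self, Nat.cast_one, one_mul] at hadd
  exact (WithTop.add_ne_top.1 (hadd ▸ WithTop.add_ne_top.2 ⟨hQ, hN⟩)).2

lemma length_quotient_span_pair_pow_ne_top (h : IsWeaklyRegular S [x, y])
    (hj : Function.Injective j) (hN : relLength (LinearMap.range j) ⊤ ≠ ⊤)
    (hQ : Module.length R (R ⧸ Ideal.span {x, y}) ≠ ⊤) (n : ℕ) :
    Module.length R (R ⧸ Ideal.span {x, y} ^ n) ≠ ⊤ := by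
  refine (WithTop.add_ne_top.1 (length_quotient_pow_add h hj hN n ▸ WithTop.add_ne_top.2
    ⟨ENat.natCast_ne_top _, WithTop.mul_ne_top (ENat.natCast_ne_top _) ?_⟩)).1
  exact relLength_span_pair_smul_ne_top h hj hN hQ

lemma lengthInt_quotient_pow_add (h : IsWeaklyRegular S [x, y]) (hj : Function.Injective j)
    (hN : relLength (LinearMap.range j) ⊤ ≠ ⊤)
    (hQ : Module.length R (R ⧸ Ideal.span {x, y}) ≠ ⊤) (n : ℕ) :
    lengthInt R (R ⧸ Ideal.span {x, y} ^ n) + (relLength (LinearMap.range j) ⊤).toNat =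
      powColength x y (LinearMap.range j) n + ((n + 1).choose 2 : ℕ) *
        ((relLength (Ideal.span {x, y} • (⊤ : Submodule R S)) ⊤).toNat : ℤ) := by
  have hadd := length_quotient_pow_add h hj hN n
  rw [← ENat.natCast_toNat (length_quotient_span_pair_pow_ne_top h hj hN hQ n),
    ← ENat.natCast_toNat hN,
    ← ENat.natCast_toNat (relLength_span_pair_smul_ne_top h hj hN hQ)] at hadd
  rw [lengthInt]
  exact_mod_cast hadd

theorem hilbertCoeff_span_pair (hdim : ringKrullDim R = 2) (h : IsWeaklyRegular S [x, y])
    (hj : Function.Injective j) (hN : relLength (LinearMap.range j) ⊤ ≠ ⊤)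
    (hQ : Module.length R (R ⧸ Ideal.span {x, y}) ≠ ⊤) :
    HasHilbertCoeffs (Ideal.span {x, y}) 2 (hilbertCoeff (Ideal.span {x, y})) ∧
      hilbertCoeff (Ideal.span {x, y}) 0 =
        (relLength (Ideal.span {x, y} • (⊤ : Submodule R S)) ⊤).toNat ∧
      ∀ᶠ n in Filter.atTop, (powColength x y (LinearMap.range j) (n + 1) : ℤ) =
        powColength x y (LinearMap.range j) n + -hilbertCoeff (Ideal.span {x, y}) 1 := by
  obtain ⟨b, hb⟩ := exists_eventually_powColength_succ h hN
  obtain ⟨c, hc⟩ := exists_eventually_eq_mul_add hb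
  let e : ℕ → ℤ := fun i => if i = 0 then
    ((relLength (Ideal.span {x, y} • (⊤ : Submodule R S)) ⊤).toNat : ℤ) else if i = 1 then -b else
      c - (relLength (LinearMap.range j) ⊤).toNat
  have he : HasHilbertCoeffs (Ideal.span {x, y}) 2 e := by
    refine hasHilbertCoeffs_two_iff.2 ?_
    filter_upwards [(Filter.tendsto_add_atTop_nat 1).eventually hc] with n hn
    refine ⟨Module.length_ne_top_iff.1 (length_quotient_span_pair_pow_ne_top h hj hN hQ _), ?_⟩
    have hadd := lengthInt_quotient_pow_add h hj hN hQ (n + 1)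
    simp only [e, if_true, one_ne_zero, OfNat.ofNat_ne_zero, OfNat.ofNat_ne_one, if_false]
    linear_combination hadd + hn
  obtain ⟨h0, h1⟩ := hasHilbertCoeffs_two_unique he (hasHilbertCoeffs_hilbertCoeff hdim he)
  refine ⟨hasHilbertCoeffs_hilbertCoeff hdim he, h0.symm, ?_⟩
  rw [← h1]
  exact (neg_neg b).symm ▸ hb

lemma lengthInt_quotient_sub_hilbertCoeff_zero (hdim : ringKrullDim R = 2)
    (h : IsWeaklyRegular S [x, y]) (hj : Function.Injective j)
    (hN : relLength (LinearMap.range j) ⊤ ≠ ⊤)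
    (hQ : Module.length R (R ⧸ Ideal.span {x, y}) ≠ ⊤)
    (hQN : Ideal.span {x, y} • ⊤ ≤ LinearMap.range j) :
    lengthInt R (R ⧸ Ideal.span {x, y}) - hilbertCoeff (Ideal.span {x, y}) 0 =
      (relLength (LinearMap.range j) ⊤).toNat := by
  have hadd := lengthInt_quotient_pow_add h hj hN hQ 1
  rw [(hilbertCoeff_span_pair hdim h hj hN hQ).2.1]
  rw [powColength_of_smul_top_le h hQN, pow_one, one_add_one_eq_two, Nat.choose_self] at hadd
  push_cast at hadd
  linear_combination hadd

end HilbertCoefficients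

/-! ### The ring inside its ideal transform -/

section LimitClosure

open RingTheory.Sequence

variable {R : Type u} [CommRing R] {x y a : R}

lemma isWeaklyRegular_idealTransform (hx : x ∈ nonZeroDivisors R) :
    IsWeaklyRegular (idealTransform (Ideal.span {x, y})) [x, y] := by
  have hbij := bijective_lsmul_fractionRing hx
  refine isWeaklyRegular_pair_iff.2 ⟨fun s t hst => Subtype.ext (hbij.1 (congrArg Subtype.val hst)),
    fun s t hst => ?_⟩
  obtain ⟨v, hv : x • v = t⟩ := hbij.2 t
  have hyv : y • v = s := hbij.1 <| by
    change x • y • v = x • (s : FractionRing R)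
    rw [smul_comm, hv]
    exact (congrArg Subtype.val hst).symm
  obtain ⟨n, hn, -⟩ := mem_idealTransform_span_pair.1 t.2
  obtain ⟨m, -, hm⟩ := mem_idealTransform_span_pair.1 s.2
  refine ⟨⟨v, mem_idealTransform_span_pair.2 ⟨m + n + 1, ?_, ?_⟩⟩, Subtype.ext hv.symm⟩
  · rw [pow_succ, mul_smul, hv, pow_add, mul_smul]
    exact Submodule.smul_mem _ _ hn
  · rw [pow_succ, mul_smul, hyv, add_comm, pow_add, mul_smul]
    exact Submodule.smul_mem _ _ hm

lemma range_pair {α : Type*} (a b : α) : Set.range ![a, b] = {a, b} := by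
  rw [Matrix.range_cons, Matrix.range_cons, Matrix.range_empty, Set.union_empty]
  rfl

lemma range_pair_pow (x y : R) (n : ℕ) : (Set.range fun i => ![x, y] i ^ n) = {x ^ n, y ^ n} := by
  rw [← range_pair]
  exact congrArg Set.range (funext (Fin.forall_fin_two.2 ⟨rfl, rfl⟩))

lemma mem_limitClosure_pair : a ∈ limitClosure ![x, y] ↔
    ∃ n : ℕ, ∃ b c : R, b * x ^ (n + 1) + c * y ^ (n + 1) = a * (x * y) ^ n := by
  change (∃ n : ℕ, a * (∏ i, ![x, y] i) ^ n ∈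
    Ideal.span (Set.range fun i => ![x, y] i ^ (n + 1))) ↔ _
  simp only [range_pair_pow, Ideal.mem_span_pair, Fin.prod_univ_two]
  rfl

lemma map_mem_span_pair_smul_of_mem_limitClosure {S : Type*} [AddCommGroup S] [Module R S]
    (h : IsWeaklyRegular S [x, y]) (j : R →ₗ[R] S) (ha : a ∈ limitClosure ![x, y]) :
    j a ∈ Ideal.span {x, y} • (⊤ : Submodule R S) := by
  obtain ⟨n, b, c, hbc⟩ := mem_limitClosure_pair.1 ha
  have hj : x ^ n • (y ^ n • j a - x • j b) = y ^ (n + 1) • j c := by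
    rw [← map_smul, ← map_smul, ← map_sub, ← map_smul, ← map_smul]
    simp only [smul_eq_mul]
    congr 1
    linear_combination -hbc
  obtain ⟨v, hv, -⟩ := exists_eq_smul_of_smul_eq (isWeaklyRegular_pair_pow h n (n + 1)) hj
  have hxb : x • j b = y ^ n • (j a - y • v) := by
    rw [smul_sub, smul_smul, ← pow_succ, ← hv, sub_sub_cancel]
  obtain ⟨w, -, hw⟩ :=
    exists_eq_smul_of_smul_eq (pow_one x ▸ isWeaklyRegular_pair_pow h 1 n) hxb
  exact mem_span_pair_smul.2 ⟨w, trivial, v, trivial, by rw [← hw, sub_add_cancel]⟩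

lemma mem_limitClosure_of_toTransform_mem
    (ha : toTransform (Ideal.span {x, y}) a ∈ Ideal.span {x, y} • (⊤ : Submodule R _)) :
    a ∈ limitClosure ![x, y] := by
  obtain ⟨s, -, t, -, hst⟩ := mem_span_pair_smul.1 ha
  obtain ⟨n, -, hn⟩ := mem_idealTransform_span_pair.1 s.2
  obtain ⟨m, hm, -⟩ := mem_idealTransform_span_pair.1 t.2
  obtain ⟨b, hb⟩ :=
    (mem_range_toTransform (I := Ideal.span {x, y}) (s := y ^ n • s)).2 hn
  obtain ⟨c, hc⟩ :=
    (mem_range_toTransform (I := Ideal.span {x, y}) (s := x ^ m • t)).2 hm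
  refine mem_limitClosure_pair.2 ⟨n + m, b * y ^ m, c * x ^ n,
    toTransform_injective (Ideal.span {x, y}) ?_⟩
  have hl : toTransform (Ideal.span {x, y})
      (b * y ^ m * x ^ (n + m + 1) + c * x ^ n * y ^ (n + m + 1)) =
      (y ^ m * x ^ (n + m + 1)) • y ^ n • s + (x ^ n * y ^ (n + m + 1)) • x ^ m • t := by
    rw [← hb, ← hc, ← map_smul, ← map_smul, ← map_add]
    congr 1
    simp only [smul_eq_mul]
    ring
  have hr : toTransform (Ideal.span {x, y}) (a * (x * y) ^ (n + m)) =
      (x * y) ^ (n + m) • (x • s + y • t) := by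
    rw [hst, ← map_smul, smul_eq_mul, mul_comm]
  rw [hl, hr, smul_add, smul_smul, smul_smul, smul_smul, smul_smul]
  congr 2 <;> ring

lemma limitClosure_eq_comap (hx : x ∈ nonZeroDivisors R) : limitClosure ![x, y] =
    (Ideal.span {x, y} • (⊤ : Submodule R (idealTransform (Ideal.span {x, y})))).comap
      (toTransform (Ideal.span {x, y})) :=
  le_antisymm
    (fun _ => map_mem_span_pair_smul_of_mem_limitClosure (isWeaklyRegular_idealTransform hx) _)
    fun _ => mem_limitClosure_of_toTransform_mem

end LimitClosure

section Quotients

variable {R M H : Type*} [CommRing R] [AddCommGroup M] [Module R M] [AddCommGroup H] [Module R H]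
  {f : M →ₗ[R] H}

lemma length_quotient_comap (j : R →ₗ[R] M) (A : Submodule R M) :
    Module.length R (R ⧸ (A.comap j : Ideal R)) = relLength A (LinearMap.range j ⊔ A) := by
  rw [← relLength_top, ← top_inf_eq (Submodule.comap j A), relLength_inf_comap, Submodule.map_top]

lemma length_quotient_smul_top (hf : Function.Surjective f) (I : Ideal R) :
    Module.length R (H ⧸ (I • ⊤ : Submodule R H)) = relLength (LinearMap.ker f ⊔ I • ⊤) ⊤ := by
  have hmap : (I • ⊤ : Submodule R M).map f = I • ⊤ := by
    rw [Submodule.map_smul'', Submodule.map_top, LinearMap.range_eq_top.2 hf]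
  rw [← relLength_top, sup_comm, ← Submodule.comap_map_eq, hmap, ← top_inf_eq
    (Submodule.comap f _), relLength_inf_comap, Submodule.map_top, LinearMap.range_eq_top.2 hf,
    top_sup_eq]

lemma relLength_ker_top (hf : Function.Surjective f) :
    relLength (LinearMap.ker f) ⊤ = Module.length R H := by
  rw [relLength_top, (LinearMap.quotKerEquivOfSurjective f hf).length_eq]

lemma smul_top_le_ker {I : Ideal R} (hI : I • (⊤ : Submodule R H) = ⊥) :
    I • ⊤ ≤ LinearMap.ker f := by
  rw [LinearMap.le_ker_iff_map, Submodule.map_smul'']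
  exact eq_bot_iff.2 (hI ▸ Submodule.smul_mono le_rfl le_top)

lemma IsSuperficial.eventually_mulKernel_le {x y : R} {j : R →ₗ[R] M} {t : ℕ}
    (hx : IsSuperficial (Ideal.span {x, y}) x) (hj : Function.Injective j)
    (ht : Ideal.span {x, y} ^ t • ⊤ ≤ LinearMap.range j) :
    ∀ᶠ n in Filter.atTop, mulKernel x y (LinearMap.range j) n ≤
      Ideal.span {x, y} ^ n • LinearMap.range j := by
  obtain ⟨-, c, hc⟩ := hx
  have hmem (m : ℕ) (r : R) : j r ∈ Ideal.span {x, y} ^ m • LinearMap.range j ↔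
      r ∈ Ideal.span {x, y} ^ m := by
    rw [← Submodule.map_top, ← Submodule.map_smul'', smul_eq_mul, Ideal.mul_top]
    exact ⟨fun ⟨r', hr', h⟩ => hj h ▸ hr', fun h => ⟨r, h, rfl⟩⟩
  filter_upwards [Filter.eventually_ge_atTop (c + t)] with n hn s ⟨hs, hxs⟩
  have hsc : s ∈ Ideal.span {x, y} ^ c • LinearMap.range j := by
    refine Submodule.smul_mono le_rfl ht ?_
    rw [← mul_smul, ← pow_add]
    exact Submodule.smul_mono_left (Ideal.pow_le_pow_right hn) hs
  obtain ⟨r, rfl⟩ := Submodule.smul_le_right hsc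
  rw [hmem] at hsc ⊢
  rw [← hc n (by omega)]
  refine ⟨Submodule.mem_colon_singleton.2 ((hmem _ _).1 ?_), hsc⟩
  rw [smul_eq_mul, mul_comm, ← smul_eq_mul, map_smul]
  exact hxs

variable [IsLocalRing R]

lemma maximalIdeal_mem_minimalPrimes_of_radical_eq {I : Ideal R}
    (hI : I.radical = maximalIdeal R) : maximalIdeal R ∈ I.minimalPrimes :=
  ⟨⟨inferInstance, hI ▸ Ideal.le_radical⟩, fun _ hP _ => hI ▸ hP.1.radical_le_iff.2 hP.2⟩

lemma isArtinianRing_quotient_of_radical_eq [IsNoetherianRing R] {I : Ideal R}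
    (hI : I.radical = maximalIdeal R) : IsArtinianRing (R ⧸ I) :=
  IsLocalRing.quotient_artinian_of_mem_minimalPrimes_of_isLocalRing I
    (maximalIdeal_mem_minimalPrimes_of_radical_eq hI)

lemma length_quotient_ne_top_of_radical_eq [IsNoetherianRing R] {I : Ideal R}
    (hI : I.radical = maximalIdeal R) : Module.length R (R ⧸ I) ≠ ⊤ := by
  have hart := isArtinianRing_quotient_of_radical_eq hI
  rw [Module.length_eq_of_surjective (R := R ⧸ I) (S := R) Ideal.Quotient.mk_surjective]
  exact Module.length_ne_top

lemma exists_pow_maximalIdeal_smul_top_eq_bot (hH : IsFiniteLength R H) :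
    ∃ t : ℕ, maximalIdeal R ^ t • (⊤ : Submodule R H) = ⊥ := by
  obtain ⟨hnoeth, hart⟩ := isFiniteLength_iff_isNoetherian_isArtinian.1 hH
  have hanti : Antitone fun t => maximalIdeal R ^ t • (⊤ : Submodule R H) :=
    fun _ _ hle => Submodule.smul_mono_left (Ideal.pow_le_pow_right hle)
  obtain ⟨t, ht⟩ := WellFoundedLT.antitone_chain_condition hanti
  refine ⟨t, Submodule.eq_bot_of_le_smul_of_le_jacobson_bot (maximalIdeal R) _
    (IsNoetherian.noetherian _) ?_ (maximalIdeal_le_jacobson _)⟩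
  rw [← mul_smul, ← pow_succ']
  exact (ht (t + 1) t.le_succ).le

end Quotients

section LocalCohomology

variable {R : Type u} [CommRing R] {x : R}

lemma exists_surjective_idealTransform [IsNoetherianRing R] [IsLocalRing R] {I : Ideal R}
    (hI : I.radical = maximalIdeal R) (hx : x ∈ nonZeroDivisors R) (hxI : x ∈ I) :
    ∃ f : idealTransform I →ₗ[R] H1m R,
      Function.Surjective f ∧ LinearMap.ker f = LinearMap.range (toTransform I) := by
  obtain ⟨e⟩ := nonempty_localCohomology_one_equiv hx hxI
  have hrad : I.radical = (maximalIdeal R).radical := by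
    rw [hI, (maximalIdeal.isMaximal R).isPrime.radical]
  let e' := ((localCohomology.isoOfSameRadical hrad 1).app (ModuleCat.of R R)).toLinearEquiv
  refine ⟨(e.symm ≪≫ₗ e').toLinearMap ∘ₗ Submodule.mkQ _,
    (e.symm ≪≫ₗ e').surjective.comp (Submodule.mkQ_surjective _), ?_⟩
  rw [LinearEquiv.ker_comp, Submodule.ker_mkQ]

lemma span_pair_pow_le (x y : R) {n : ℕ} (hn : n ≠ 0) :
    Ideal.span {x ^ n, y ^ n} ≤ Ideal.span {x, y} := by
  rw [Ideal.span_le, Set.pair_subset_iff]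
  have hx : x ∈ Ideal.span {x, y} := Ideal.subset_span (Set.mem_insert x _)
  have hy : y ∈ Ideal.span {x, y} := Ideal.subset_span (Set.mem_insert_of_mem x rfl)
  exact ⟨Ideal.pow_mem_of_mem _ hx n (Nat.pos_of_ne_zero hn),
    Ideal.pow_mem_of_mem _ hy n (Nat.pos_of_ne_zero hn)⟩

lemma radical_span_pair_pow (x y : R) {n : ℕ} (hn : n ≠ 0) :
    (Ideal.span {x ^ n, y ^ n}).radical = (Ideal.span {x, y}).radical := by
  have hx : x ∈ (Ideal.span {x ^ n, y ^ n}).radical :=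
    ⟨n, Ideal.subset_span (Set.mem_insert _ _)⟩
  have hy : y ∈ (Ideal.span {x ^ n, y ^ n}).radical :=
    ⟨n, Ideal.subset_span (Set.mem_insert_of_mem _ rfl)⟩
  exact le_antisymm (Ideal.radical_mono (span_pair_pow_le x y hn))
    (Ideal.radical_le_radical_iff.2 (Ideal.span_le.2 (Set.pair_subset hx hy)))

end LocalCohomology

/-! ### Reducedness of completions of excellent domains -/

section RegularLocalRing

lemma isLocalRing_quotient {R : Type*} [CommRing R] [IsLocalRing R] {I : Ideal R} (hI : I ≠ ⊤) :
    IsLocalRing (R ⧸ I) := by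
  have := Ideal.Quotient.nontrivial_iff.2 hI
  exact .of_surjective' (Ideal.Quotient.mk I) Ideal.Quotient.mk_surjective

variable {R : Type u} [CommRing R] [IsLocalRing R] [IsNoetherianRing R] {x : R}

lemma exists_span_insert_eq_maximalIdeal (hx : x ∈ maximalIdeal R)
    (hx2 : x ∉ maximalIdeal R ^ 2) :
    ∃ s : Set R, s.Finite ∧ s.ncard + 1 ≤ (maximalIdeal R).spanFinrank ∧
      Ideal.span (insert x s) = maximalIdeal R := by
  let v : CotangentSpace R := (maximalIdeal R).toCotangent ⟨x, hx⟩
  have hv : v ≠ 0 := fun h => hx2 ((Ideal.toCotangent_eq_zero _ _).1 h)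
  have hind : LinearIndepOn (ResidueField R) id {v} := LinearIndepOn.singleton hv
  let b := Module.Basis.extend hind
  let t : Set (CotangentSpace R) := hind.extend (Set.subset_univ _)
  have hvt : v ∈ t := Module.Basis.subset_extend hind rfl
  have hfin : t.Finite := Set.toFinite _
  have hcard : t.ncard = (maximalIdeal R).spanFinrank := by
    rw [spanFinrank_maximalIdeal_eq_finrank_cotangentSpace, Module.finrank_eq_nat_card_basis b]
    rfl
  obtain ⟨g, hg⟩ := (Ideal.toCotangent_surjective (maximalIdeal R)).hasRightInverse
  have hspan : Submodule.span R (insert ⟨x, hx⟩ (g '' (t \ {v}))) = ⊤ := by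
    rw [← CotangentSpace.span_image_eq_top_iff, Set.image_insert_eq, hg.image_image,
      Set.insert_sdiff_singleton, Set.insert_eq_of_mem hvt, ← b.span_eq, Module.Basis.range_extend]
  refine ⟨Subtype.val '' (g '' (t \ {v})), (hfin.sdiff.image _).image _, ?_, ?_⟩
  · rw [← hcard, ← Set.ncard_sdiff_singleton_add_one hvt hfin]
    exact Nat.succ_le_succ ((Set.ncard_image_le (hfin.sdiff.image _)).trans
      (Set.ncard_image_le hfin.sdiff))
  · have hmap := congrArg (Submodule.map (maximalIdeal R).subtype) hspan
    rwa [Submodule.map_top, Submodule.range_subtype, Submodule.map_span,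
      Set.image_insert_eq] at hmap

lemma spanFinrank_maximalIdeal_quotient_lt [IsLocalRing (R ⧸ Ideal.span {x})]
    (hx : x ∈ maximalIdeal R) (hx2 : x ∉ maximalIdeal R ^ 2) :
    (maximalIdeal (R ⧸ Ideal.span {x})).spanFinrank < (maximalIdeal R).spanFinrank := by
  obtain ⟨s, hfin, hcard, hs⟩ := exists_span_insert_eq_maximalIdeal hx hx2
  have hmap : maximalIdeal (R ⧸ Ideal.span {x}) =
      Ideal.span (Ideal.Quotient.mk (Ideal.span {x}) '' s) := by
    rw [← map_maximalIdeal_of_surjective (Ideal.Quotient.mk (Ideal.span {x}))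
      Ideal.Quotient.mk_surjective, ← hs, Ideal.span_insert, Ideal.map_sup,
      Ideal.map_quotient_self, bot_sup_eq, Ideal.map_span]
  rw [hmap]
  exact (Submodule.spanFinrank_span_le_ncard_of_finite (hfin.image _)).trans_lt
    ((Set.ncard_image_le hfin).trans_lt hcard)

lemma exists_mem_maximalIdeal_notMem_minimalPrimes (hdim : ringKrullDim R ≠ 0) :
    ∃ x ∈ maximalIdeal R, x ∉ maximalIdeal R ^ 2 ∧ ∀ P ∈ minimalPrimes R, x ∉ P := by
  classical
  by_contra! hcon
  have hheight : (maximalIdeal R).height ≠ 0 := fun h => hdim <| by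
    rw [← maximalIdeal_height_eq_ringKrullDim, h]
    rfl
  have hfin : (minimalPrimes R).Finite := minimalPrimes.finite_of_isNoetherianRing R
  have hsub : (maximalIdeal R : Set R) ⊆
      ⋃ I ∈ (↑(insert (maximalIdeal R ^ 2) hfin.toFinset) : Set (Ideal R)), (id I : Ideal R) := by
    intro a ha
    by_cases ha2 : a ∈ maximalIdeal R ^ 2
    · exact Set.mem_biUnion (Finset.mem_coe.2 (Finset.mem_insert_self _ _)) ha2
    · obtain ⟨P, hP, haP⟩ := hcon a ha ha2
      exact Set.mem_biUnion
        (Finset.mem_coe.2 (Finset.mem_insert_of_mem (hfin.mem_toFinset.2 hP))) haP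
  obtain ⟨I, hI, hmI⟩ := (Ideal.subset_union_prime (maximalIdeal R ^ 2) (maximalIdeal R ^ 2)
    fun P hP hne _ => (hfin.mem_toFinset.1 (Finset.mem_of_mem_insert_of_ne hP hne)).1.1).1 hsub
  rcases Finset.mem_insert.1 hI with rfl | hI
  · have hbot : maximalIdeal R = ⊥ := Submodule.eq_bot_of_le_smul_of_le_jacobson_bot _ _
      (IsNoetherian.noetherian _) (hmI.trans_eq (sq _)) (maximalIdeal_le_jacobson _)
    exact hheight (hbot ▸ Ideal.height_bot)
  · have hmin := hfin.mem_toFinset.1 hI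
    have hIm : I = maximalIdeal R := le_antisymm (le_maximalIdeal hmin.1.1.ne_top) hmI
    exact hheight (Ideal.height_eq_zero_iff.2 (hIm ▸ hmin))

lemma isDomain_of_isPrime_span_singleton (hx : x ∈ maximalIdeal R)
    (hxP : ∀ P ∈ minimalPrimes R, x ∉ P) (hprime : (Ideal.span {x}).IsPrime) : IsDomain R := by
  obtain ⟨P, hP, hPx⟩ := Ideal.exists_minimalPrimes_le (bot_le (a := Ideal.span {x}))
  have hPp : P.IsPrime := hP.1.1
  have hPb : P = ⊥ := by
    refine Submodule.eq_bot_of_le_smul_of_le_jacobson_bot (maximalIdeal R) _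
      (IsNoetherian.noetherian _) (fun a ha => ?_) (maximalIdeal_le_jacobson _)
    obtain ⟨r, rfl⟩ := Ideal.mem_span_singleton.1 (hPx ha)
    exact Submodule.smul_mem_smul hx ((hPp.mem_or_mem ha).resolve_left (hxP P hP))
  subst hPb
  exact IsDomain.of_bot_isPrime R

lemma isRegularLocalRing_quotient_span_singleton {n : ℕ} {R : Type u} [CommRing R]
    [IsRegularLocalRing R] {x : R} (hdim : ringKrullDim R = n + 1) (hx : x ∈ maximalIdeal R)
    (hx2 : x ∉ maximalIdeal R ^ 2) :
    IsRegularLocalRing (R ⧸ Ideal.span {x}) ∧ ringKrullDim (R ⧸ Ideal.span {x}) = n := by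
  have hle : Ideal.span {x} ≤ maximalIdeal R := (Ideal.span_singleton_le_iff_mem _).2 hx
  have := isLocalRing_quotient (ne_top_of_le_ne_top (maximalIdeal.isMaximal R).ne_top hle)
  have hrank : (maximalIdeal R).spanFinrank = n + 1 := by
    exact_mod_cast (IsRegularLocalRing.spanFinrank_maximalIdeal (R := R)).trans hdim
  have hrank' : ((maximalIdeal (R ⧸ Ideal.span {x})).spanFinrank : WithBot ℕ∞) ≤ n := by
    exact_mod_cast Nat.le_of_lt_succ (hrank ▸ spanFinrank_maximalIdeal_quotient_lt hx hx2)
  have hge : (n : WithBot ℕ∞) ≤ ringKrullDim (R ⧸ Ideal.span {x}) := by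
    have hcard := ringKrullDim_le_ringKrullDim_quotient_add_card {x}
      (by simpa [IsLocalRing.ringJacobson_eq_maximalIdeal] using hx)
    rw [hdim, Finset.card_singleton, Nat.cast_one, Finset.coe_singleton] at hcard
    exact ENat.WithBot.add_le_add_one_right_iff.1 hcard
  exact ⟨.of_spanFinrank_maximalIdeal_le _ (hrank'.trans hge),
    le_antisymm ((ringKrullDim_le_spanFinrank_maximalIdeal _).trans hrank') hge⟩

lemma isDomain_of_ringKrullDim_eq {n : ℕ} {R : Type u} [CommRing R] [IsRegularLocalRing R]
    (hdim : ringKrullDim R = n) : IsDomain R := by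
  induction n generalizing R with
  | zero =>
    have hrank : (maximalIdeal R).spanFinrank = 0 := by
      exact_mod_cast IsRegularLocalRing.spanFinrank_maximalIdeal.trans hdim
    rw [spanFinrank_maximalIdeal_eq_finrank_cotangentSpace,
      finrank_cotangentSpace_eq_zero_iff] at hrank
    exact hrank.isDomain
  | succ n ih =>
    obtain ⟨x, hx, hx2, hxP⟩ := exists_mem_maximalIdeal_notMem_minimalPrimes (R := R) <| by
      rw [hdim]
      exact_mod_cast n.succ_ne_zero
    obtain ⟨hreg, hdim'⟩ := isRegularLocalRing_quotient_span_singleton hdim hx hx2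
    exact isDomain_of_isPrime_span_singleton hx hxP
      ((Ideal.Quotient.isDomain_iff_prime _).1 (ih hdim'))

theorem isDomain_of_isRegularLocalRing (R : Type u) [CommRing R] [h : IsRegularLocalRing R] :
    IsDomain R :=
  isDomain_of_ringKrullDim_eq h.spanFinrank_maximalIdeal.symm

lemma isReduced_of_isRegularRing (R : Type u) [CommRing R] [IsRegularRing R] : IsReduced R := by
  refine isReduced_ofLocalizationMaximal R fun P hP => ?_
  have := isDomain_of_isRegularLocalRing (Localization.AtPrime P)
  infer_instance

end RegularLocalRing

section Fiber

open TensorProduct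

variable {R : Type u} [CommRing R]

lemma tmul_one_eq_zero_iff_forall_mem_sup_pow [IsNoetherianRing R] {m p : Ideal R}
    {z : AdicCompletion m R} {w : ℕ → R}
    (hz : ∀ n, AdicCompletion.evalₐ m n z = Ideal.Quotient.mk (m ^ n) (w n)) :
    z ⊗ₜ[R] (1 : R ⧸ p) = 0 ↔ ∀ n, w n ∈ p ⊔ m ^ n := by
  have hone : AdicCompletion.ofTensorProductEquivOfFiniteNoetherian m (R ⧸ p) (z ⊗ₜ 1) =
      z • AdicCompletion.of m (R ⧸ p) 1 := rfl
  rw [← (AdicCompletion.ofTensorProductEquivOfFiniteNoetherian m (R ⧸ p)).map_eq_zero_iff, hone,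
    AdicCompletion.ext_iff]
  refine forall_congr' fun n => ?_
  have heval : (z • AdicCompletion.of m (R ⧸ p) 1).val n =
      Submodule.Quotient.mk (p := (m ^ n • ⊤ : Submodule R (R ⧸ p)))
        (Ideal.Quotient.mk p (w n)) := by
    rw [AdicCompletion.smul_eval, AdicCompletion.val_smul_eq_evalₐ_smul, hz]
    change w n • Submodule.Quotient.mk (p := (m ^ n • ⊤ : Submodule R (R ⧸ p))) 1 = _
    rw [← Submodule.Quotient.mk_smul, Algebra.smul_def, mul_one]
    rfl
  have hmap : (m ^ n • ⊤ : Submodule R (R ⧸ p)) = Submodule.map (Submodule.mkQ p) (m ^ n) := by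
    rw [← Submodule.range_mkQ p, LinearMap.range_eq_map, ← Submodule.map_smul'', smul_eq_mul,
      Ideal.mul_top]
  rw [heval, AdicCompletion.val_zero_apply, Submodule.Quotient.mk_eq_zero, hmap,
    ← Submodule.comap_map_mkQ p]
  rfl

lemma tmul_one_eq_zero_iff_one_tmul_fiber_eq_zero {p : Ideal R} [p.IsPrime] {S : Type u}
    [CommRing S] [Algebra R S] [Module.Flat R S] {z : S} :
    z ⊗ₜ[R] (1 : R ⧸ p) = 0 ↔ ((1 : p.ResidueField) ⊗ₜ[R] z : p.Fiber S) = 0 := by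
  let ι : R ⧸ p →ₗ[R] p.ResidueField :=
    (IsScalarTower.toAlgHom R (R ⧸ p) p.ResidueField).toLinearMap
  have hinj : Function.Injective (ι.lTensor S) :=
    Module.Flat.lTensor_preserves_injective_linearMap ι
      (Ideal.injective_algebraMap_quotient_residueField p)
  rw [← map_eq_zero_iff _ hinj, ← map_eq_zero_iff _ (TensorProduct.comm R _ _).injective]
  simp [ι]

lemma IsRegularAlgebra.isReduced_fiber {S : Type u} [CommRing S] [Algebra R S]
    (h : IsRegularAlgebra R S) (p : Ideal R) [p.IsPrime] : IsReduced (p.Fiber S) := by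
  have := h.fiber_regular p p.ResidueField
  have := IsRegularRing.of_ringEquiv
    (R := p.ResidueField ⊗[p.ResidueField] p.Fiber S) (R' := p.Fiber S)
    (Algebra.TensorProduct.lid p.ResidueField (p.Fiber S)).toRingEquiv
  exact isReduced_of_isRegularRing _

lemma IsRegularAlgebra.mem_sup_pow_of_sq_mem [IsNoetherianRing R] {m : Ideal R}
    (hreg : IsRegularAlgebra R (AdicCompletion m R)) (p : Ideal R) [p.IsPrime]
    (w : ℕ → R) (hw : ∀ n, w (n + 1) - w n ∈ m ^ n)
    (hsq : ∀ n, w n ^ 2 ∈ p ⊔ m ^ n) (n : ℕ) : w n ∈ p ⊔ m ^ n := by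
  let f : AdicCompletion.AdicCauchySequence m R := AdicCompletion.AdicCauchySequence.mk m R w
    fun n => by simpa [SModEq.sub_mem, ← neg_mem_iff (x := w n - _)] using hw n
  let z : AdicCompletion m R := AdicCompletion.mkₐ m f
  have hz : ∀ n, AdicCompletion.evalₐ m n z = Ideal.Quotient.mk _ (w n) := fun n =>
    AdicCompletion.evalₐ_mkₐ m n f
  have := hreg.flat
  have := hreg.isReduced_fiber p
  have hfiber : ((1 : p.ResidueField) ⊗ₜ[R] z : p.Fiber (AdicCompletion m R)) ^ 2 = 0 := by
    rw [Algebra.TensorProduct.tmul_pow, one_pow, ← tmul_one_eq_zero_iff_one_tmul_fiber_eq_zero,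
      tmul_one_eq_zero_iff_forall_mem_sup_pow (w := fun n => w n ^ 2)]
    · exact hsq
    · intro n
      rw [map_pow, hz, map_pow]
  exact (tmul_one_eq_zero_iff_forall_mem_sup_pow hz).1
    (tmul_one_eq_zero_iff_one_tmul_fiber_eq_zero.2 ((pow_eq_zero_iff two_ne_zero).1 hfiber)) n

end Fiber

/-! ### Integral elements of the fraction field -/

section CatenaryRing

lemma covBy_of_krullDim_le_three {α : Type*} [PartialOrder α] (h : Order.krullDim α ≤ 3)
    {a b c d : α} (hab : a < b) (hbc : b < c) (hcd : c < d) : a ⋖ b ∧ b ⋖ c ∧ c ⋖ d := by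
  have no_chain (p : Fin 5 → α) (hp : ∀ i : Fin 4, p i.castSucc < p i.succ) : False := by
    have hlen := (Order.LTSeries.length_le_krullDim (⟨4, p, hp⟩ : LTSeries α)).trans h
    have : (4 : WithBot ℕ∞) ≤ 3 := hlen
    norm_cast at this
  refine ⟨⟨hab, fun z haz hzb => no_chain ![a, z, b, c, d] ?_⟩,
    ⟨hbc, fun z hbz hzc => no_chain ![a, b, z, c, d] ?_⟩,
    ⟨hcd, fun z hcz hzd => no_chain ![a, b, c, z, d] ?_⟩⟩ <;>
  · intro i
    fin_cases i <;> assumption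

lemma IsCatenaryRing.false_of_covBy_of_lt {B : Type u} [CommRing B] (hcat : IsCatenaryRing B)
    (hdim : ringKrullDim B ≤ 3) {a b c d p : PrimeSpectrum B} (hap : a ⋖ p) (hpd : p ⋖ d)
    (hab : a < b) (hbc : b < c) (hcd : c < d) : False := by
  obtain ⟨hab', hbc', hcd'⟩ := covBy_of_krullDim_le_three hdim hab hbc hcd
  have hlen := hcat ⟨2, ![a, p, d], fun i => by fin_cases i <;> assumption⟩
    ⟨3, ![a, b, c, d], fun i => by fin_cases i <;> assumption⟩ rfl rfl
  simp at hlen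

lemma covBy_of_forall_le_of_mem {B : Type*} [CommRing B] [IsNoetherianRing B]
    {p q : PrimeSpectrum B} {x : B} (hpq : p < q) (hxq : x ∈ q.asIdeal)
    (hmin : ∀ r : PrimeSpectrum B, p ≤ r → x ∈ r.asIdeal → q ≤ r) : p ⋖ q := by
  refine ⟨hpq, fun r hpr hrq => ?_⟩
  let π := Ideal.Quotient.mk p.asIdeal
  have hqπ : (q.asIdeal.map π).comap π = q.asIdeal := Ideal.comap_map_mk hpq.le
  have hrπ : (r.asIdeal.map π).comap π = r.asIdeal := Ideal.comap_map_mk hpr.le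
  have : (q.asIdeal.map π).IsPrime := Ideal.isPrime_map_quotientMk_of_isPrime hpq.le
  have : (r.asIdeal.map π).IsPrime := Ideal.isPrime_map_quotientMk_of_isPrime hpr.le
  have hminimal : q.asIdeal.map π ∈ (Ideal.span {π x}).minimalPrimes := by
    refine ⟨⟨inferInstance, ?_⟩, ?_⟩
    · rw [Ideal.span_singleton_le_iff_mem]
      exact Ideal.mem_map_of_mem _ hxq
    · rintro t ⟨ht, hxt⟩ -
      rw [Ideal.span_singleton_le_iff_mem] at hxt
      refine Ideal.map_le_iff_le_comap.2 (hmin ⟨t.comap π, Ideal.comap_isPrime _ _⟩ ?_ hxt)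
      intro k hk
      rw [Ideal.mem_comap, Ideal.Quotient.eq_zero_iff_mem.2 hk]
      exact zero_mem _
  have hlt : r.asIdeal.map π < q.asIdeal.map π := by
    refine lt_of_le_of_ne (Ideal.map_mono hrq.le) fun h => hrq.ne (PrimeSpectrum.ext ?_)
    rw [← hrπ, h, hqπ]
  have hheight := (Ideal.height_le_iff (n := 1)).1
    (Ideal.height_le_one_of_isPrincipal_of_mem_minimalPrimes _ _ hminimal) _ inferInstance hlt
  rw [Nat.cast_one, Order.lt_one_iff, Ideal.height_eq_zero_iff,
    IsDomain.minimalPrimes_eq_singleton_bot, Set.mem_singleton_iff,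
    Ideal.map_eq_bot_iff_le_ker, Ideal.mk_ker] at hheight
  exact hpr.not_ge hheight

lemma exists_isPrime_between_bot_maximalIdeal {A : Type*} [CommRing A] [IsLocalRing A]
    (hdim : ringKrullDim A = 2) : ∃ p : Ideal A, p.IsPrime ∧ ⊥ < p ∧ p < maximalIdeal A := by
  obtain ⟨⟨_, l, hstep⟩, rfl⟩ := Order.le_krullDim_iff.1 (hdim.ge : ((2 : ℕ) : WithBot ℕ∞) ≤ _)
  have h01 : l 0 < l 1 := hstep 0
  have h12 : l 1 < l 2 := hstep 1
  exact ⟨(l 1).asIdeal, (l 1).2, bot_le.trans_lt (show (l 0).asIdeal < _ from h01),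
    lt_of_lt_of_le (show _ < (l 2).asIdeal from h12) (le_maximalIdeal (l 2).2.ne_top)⟩

end CatenaryRing

section IntegralFraction

open Polynomial

lemma map_C_lt_map_C {A : Type*} [CommRing A] {I J : Ideal A} (h : I < J) :
    I.map (C : A →+* A[X]) < J.map C := by
  refine lt_of_le_of_ne (Ideal.map_mono h.le) fun heq => h.not_ge fun z hz => ?_
  have hC : C z ∈ I.map (C : A →+* A[X]) := heq ▸ Ideal.mem_map_of_mem _ hz
  simpa using Ideal.mem_map_C_iff.1 hC 0

lemma map_C_lt_comap_constantCoeff {A : Type*} [CommRing A] {I : Ideal A} (hI : I ≠ ⊤) :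
    I.map (C : A →+* A[X]) < I.comap constantCoeff := by
  refine lt_of_le_of_ne (Ideal.map_le_iff_le_comap.2 fun z hz => by simpa using hz) fun h => ?_
  have hX : (X : A[X]) ∈ I.map C := by simp [h]
  refine hI ((Ideal.eq_top_iff_one I).2 ?_)
  simpa using Ideal.mem_map_C_iff.1 hX 1

lemma comap_constantCoeff_le {A : Type*} [CommRing A] {I : Ideal A} {P : Ideal A[X]}
    (hI : I ≤ P.comap C) (hX : X ∈ P) : I.comap constantCoeff ≤ P := fun f hf => by
  rw [← divX_mul_X_add f]
  exact add_mem (P.mul_mem_left _ hX) (hI hf)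

lemma C_mul_X_sub_C_ne_zero {A : Type*} [CommRing A] {d : A} (hd : d ≠ 0) (e : A) :
    C d * X - C e ≠ 0 := fun h => by
  simpa [hd] using congrArg (coeff · 1) h

variable {A : Type u} [CommRing A] {K : Type v} [Field K] [Algebra A K]

lemma isIntegral_of_aeval_inv_eq {s : K} {g : A[X]} (h : aeval s⁻¹ g = s) : IsIntegral A s := by
  by_cases hs : s = 0
  · rw [hs]
    exact isIntegral_zero
  have hdeg : g.reverse.degree < ((g.natDegree + 1 : ℕ) : WithBot ℕ) :=
    (natDegree_le_iff_degree_le.1 (reverse_natDegree_le g)).trans_lt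
      (by exact_mod_cast Nat.lt_succ_self _)
  refine ⟨X ^ (g.natDegree + 1) - g.reverse, monic_X_pow_sub hdeg, ?_⟩
  let : Invertible s⁻¹ := invertibleOfNonzero (inv_ne_zero hs)
  have hrev := eval₂_reverse_mul_pow (algebraMap A K) s⁻¹ g
  rw [invOf_eq_inv, inv_inv, ← aeval_def s⁻¹ g, h] at hrev
  rw [eval₂_sub, eval₂_X_pow, pow_succ, sub_eq_zero]
  nth_rw 2 [← hrev]
  rw [mul_left_comm, ← mul_pow, mul_inv_cancel₀ hs, one_pow, mul_one]

lemma ker_aeval_inv_sup_span_X_ne_top {s : K} (hs : ¬ IsIntegral A s) :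
    RingHom.ker (aeval (R := A) s⁻¹) ⊔ Ideal.span {X} ≠ ⊤ := by
  have hs0 : s ≠ 0 := by
    rintro rfl
    exact hs isIntegral_zero
  intro h
  obtain ⟨k, hk, z, hz, hkz⟩ := Submodule.mem_sup.1 ((Ideal.eq_top_iff_one _).1 h)
  obtain ⟨g, rfl⟩ := Ideal.mem_span_singleton.1 hz
  have heval := congrArg (aeval s⁻¹) hkz
  rw [map_add, (RingHom.mem_ker.1 hk : aeval s⁻¹ k = 0), map_mul, aeval_X, map_one,
    zero_add] at heval
  exact hs (isIntegral_of_aeval_inv_eq ((inv_mul_eq_one₀ hs0).1 heval).symm)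

lemma C_pow_mem_ker_aeval_inv_sup_span_X {s : K} (hs : s ≠ 0) {n : ℕ} {z a : A}
    (ha : algebraMap A K a = algebraMap A K z ^ n * s) :
    C z ^ n ∈ RingHom.ker (aeval (R := A) s⁻¹) ⊔ Ideal.span {X} := by
  have hker : C z ^ n - C a * X ∈ RingHom.ker (aeval (R := A) s⁻¹) := by
    rw [RingHom.mem_ker]
    simp [ha, hs]
  simpa using add_mem (Ideal.mem_sup_left (T := Ideal.span {(X : A[X])}) hker)
    (Ideal.mem_sup_right (Ideal.mul_mem_left _ (C a) (Ideal.mem_span_singleton_self _)))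

variable [IsFractionRing A K]

lemma C_notMem_of_le_ker_aeval {t : K} {P : Ideal A[X]}
    (hle : P ≤ RingHom.ker (aeval (R := A) t)) {r : A} (hr : r ≠ 0) : C r ∉ P := fun h => by
  have hker := hle h
  rw [RingHom.mem_ker, aeval_C] at hker
  exact hr ((map_eq_zero_iff _ (IsFractionRing.injective A K)).1 hker)

variable [IsDomain A]

lemma ker_aeval_ne_bot (t : K) : RingHom.ker (aeval (R := A) t) ≠ ⊥ := by
  obtain ⟨e, d, hd, hed⟩ := IsFractionRing.div_surjective (A := A) t
  have hdK : algebraMap A K d ≠ 0 := IsFractionRing.to_map_ne_zero_of_mem_nonZeroDivisors hd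
  refine (Submodule.ne_bot_iff _).2
    ⟨C d * X - C e, ?_, C_mul_X_sub_C_ne_zero (nonZeroDivisors.ne_zero hd) e⟩
  simp only [RingHom.mem_ker, map_sub, map_mul, aeval_C, aeval_X, ← hed]
  rw [mul_div_cancel₀ _ hdK, sub_self]

lemma exists_C_mul_eq_of_aeval_eq_zero {t : K} {d e : A} (hd : d ≠ 0)
    (ht : algebraMap A K d * t = algebraMap A K e) {f : A[X]} (hf : aeval t f = 0) :
    ∃ r ≠ 0, ∃ g : A[X], C r * f = (C d * X - C e) * g := by
  have hroot : (f.map (algebraMap A K)).IsRoot t := by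
    rw [IsRoot.def, eval_map_algebraMap, hf]
  obtain ⟨g, hg⟩ := dvd_iff_isRoot.2 hroot
  obtain ⟨b, hb, hbg⟩ := IsLocalization.integerNormalization_spec (nonZeroDivisors A) g
  refine ⟨b * d, mul_ne_zero (nonZeroDivisors.ne_zero hb) hd,
    IsLocalization.integerNormalization (nonZeroDivisors A) g,
    map_injective _ (IsFractionRing.injective A K) ?_⟩
  rw [Polynomial.map_mul, Polynomial.map_mul, hbg, hg, algebra_compatible_smul K b g, smul_eq_C_mul]
  simp only [Polynomial.map_sub, Polynomial.map_mul, map_C, map_X, ← ht, map_mul]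
  ring

lemma C_mul_X_sub_C_mem_of_le_ker_aeval {t : K} {d e : A} (hd : d ≠ 0)
    (ht : algebraMap A K d * t = algebraMap A K e) {P : Ideal A[X]} [P.IsPrime] (hP : P ≠ ⊥)
    (hle : P ≤ RingHom.ker (aeval (R := A) t)) : C d * X - C e ∈ P := by
  obtain ⟨f, hf, hf0⟩ := Submodule.exists_mem_ne_zero_of_ne_bot hP
  induction hn : f.natDegree using Nat.strong_induction_on generalizing f with
  | _ n ih =>
    obtain ⟨r, hr, g, hg⟩ := exists_C_mul_eq_of_aeval_eq_zero hd ht (hle hf)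
    have hmem : (C d * X - C e) * g ∈ P := hg ▸ P.mul_mem_left _ hf
    refine (Ideal.IsPrime.mem_or_mem ‹_› hmem).elim id fun hgP => ?_
    have hg0 : g ≠ 0 := by
      rintro rfl
      rw [mul_zero, mul_eq_zero, C_eq_zero] at hg
      tauto
    have hlin : (C d * X - C e).natDegree = 1 := by
      rw [sub_eq_add_neg, ← C_neg, natDegree_linear hd]
    have hdeg := congrArg natDegree hg
    rw [natDegree_C_mul hr, natDegree_mul (C_mul_X_sub_C_ne_zero hd e) hg0, hlin] at hdeg
    exact ih _ (by omega) g hgP hg0 rfl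

lemma eq_ker_aeval_of_le {t : K} {P : Ideal A[X]} [P.IsPrime] (hP : P ≠ ⊥)
    (hle : P ≤ RingHom.ker (aeval (R := A) t)) : P = RingHom.ker (aeval (R := A) t) := by
  obtain ⟨e, d, hd, hed⟩ := IsFractionRing.div_surjective (A := A) t
  have ht : algebraMap A K d * t = algebraMap A K e := by
    rw [← hed, mul_div_cancel₀ _ (IsFractionRing.to_map_ne_zero_of_mem_nonZeroDivisors hd)]
  have hd0 : d ≠ 0 := nonZeroDivisors.ne_zero hd
  refine le_antisymm hle fun h hh => ?_
  obtain ⟨r, hr, g, hg⟩ := exists_C_mul_eq_of_aeval_eq_zero hd0 ht hh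
  have hmem : C r * h ∈ P :=
    hg ▸ P.mul_mem_right g (C_mul_X_sub_C_mem_of_le_ker_aeval hd0 ht hP hle)
  exact (Ideal.IsPrime.mem_or_mem ‹_› hmem).resolve_left (C_notMem_of_le_ker_aeval hle hr)

lemma bot_covBy_ker_aeval (t : K) :
    (⊥ : PrimeSpectrum A[X]) ⋖ ⟨RingHom.ker (aeval (R := A) t), RingHom.ker_isPrime _⟩ := by
  refine ⟨show ⊥ < RingHom.ker _ from bot_lt_iff_ne_bot.2 (ker_aeval_ne_bot t),
    fun P hP hPt => hPt.ne (PrimeSpectrum.ext ?_)⟩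
  exact eq_ker_aeval_of_le (bot_lt_iff_ne_bot.1 (show ⊥ < P.asIdeal from hP)) hPt.le

/- If `s` were not integral, `0 ⋖ ker (X ↦ s⁻¹) ⋖ (𝔪, X)` would be a saturated chain of length two
in the catenary three-dimensional domain `A[X]`, next to `0 < p < 𝔪 < (𝔪, X)`. -/
lemma isIntegral_of_pow_smul_mem [IsLocalRing A] [IsNoetherianRing A]
    (hdim : ringKrullDim A = 2) (hcat : IsCatenaryRing A[X]) {x y : A}
    (hrad : (Ideal.span {x, y}).radical = maximalIdeal A) {s : K} {n : ℕ} {a b : A}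
    (ha : algebraMap A K a = algebraMap A K x ^ n * s)
    (hb : algebraMap A K b = algebraMap A K y ^ n * s) : IsIntegral A s := by
  by_contra hs
  have hs0 : s ≠ 0 := by
    rintro rfl
    exact hs isIntegral_zero
  have hNmax : ((maximalIdeal A).comap (constantCoeff (R := A))).IsMaximal :=
    Ideal.comap_isMaximal_of_surjective _ fun a => ⟨C a, by simp⟩
  let κ : PrimeSpectrum A[X] := ⟨RingHom.ker (aeval (R := A) s⁻¹), RingHom.ker_isPrime _⟩
  let N : PrimeSpectrum A[X] := ⟨_, hNmax.isPrime⟩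
  have hNle (P : Ideal A[X]) [P.IsPrime] (hP : κ.asIdeal ⊔ Ideal.span {X} ≤ P) :
      N.asIdeal ≤ P := by
    refine comap_constantCoeff_le ?_ (hP (Ideal.mem_sup_right (Ideal.mem_span_singleton_self _)))
    rw [← hrad, Ideal.IsPrime.radical_le_iff inferInstance, Ideal.span_le, Set.pair_subset_iff]
    exact ⟨‹P.IsPrime›.mem_of_pow_mem n (hP (C_pow_mem_ker_aeval_inv_sup_span_X hs0 ha)),
      ‹P.IsPrime›.mem_of_pow_mem n (hP (C_pow_mem_ker_aeval_inv_sup_span_X hs0 hb))⟩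
  have hleN : κ.asIdeal ⊔ Ideal.span {X} ≤ N.asIdeal := by
    obtain ⟨M, hM, hJM⟩ := Ideal.exists_le_maximal _ (ker_aeval_inv_sup_span_X_ne_top hs)
    exact hJM.trans (hNmax.eq_of_le hM.ne_top (hNle M hJM)).ge
  have hXN : X ∈ N.asIdeal := hleN (Ideal.mem_sup_right (Ideal.mem_span_singleton_self _))
  have hκN : κ < N := lt_of_le_of_ne (le_sup_left.trans hleN) fun h => by
    rw [← h, RingHom.mem_ker, aeval_X] at hXN
    exact inv_ne_zero hs0 hXN
  have hcov : κ ⋖ N := covBy_of_forall_le_of_mem hκN hXN fun P hκP hXP =>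
    hNle P.asIdeal (sup_le hκP ((Ideal.span_singleton_le_iff_mem _).2 hXP))
  obtain ⟨p, hp, hbot, hlt⟩ := exists_isPrime_between_bot_maximalIdeal hdim
  have hbotp : (⊥ : Ideal A[X]) < p.map C := by simpa using map_C_lt_map_C hbot
  have hdim3 : ringKrullDim A[X] ≤ 3 := by
    rw [Polynomial.ringKrullDim_of_isNoetherianRing, hdim]
    rfl
  exact hcat.false_of_covBy_of_lt hdim3 (bot_covBy_ker_aeval s⁻¹) hcov
    (b := ⟨p.map C, Ideal.isPrime_map_C_of_isPrime⟩)
    (c := ⟨(maximalIdeal A).map C, Ideal.isPrime_map_C_of_isPrime⟩)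
    hbotp (map_C_lt_map_C hlt) (map_C_lt_comap_constantCoeff Ideal.IsPrime.ne_top')

end IntegralFraction

section PowerSeries

open PowerSeries

section Trunc

variable {A : Type*} [CommRing A]

lemma eval_trunc_succ (x : A) (n : ℕ) (f : A⟦X⟧) :
    (trunc (n + 1) f).eval x = (trunc n f).eval x + coeff n f * x ^ n := by
  rw [trunc_succ, Polynomial.eval_add, Polynomial.eval_monomial]

lemma pow_dvd_eval_trunc_add_sub (x : A) (n k : ℕ) (f : A⟦X⟧) :
    x ^ n ∣ (trunc (n + k) f).eval x - (trunc n f).eval x := by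
  induction k with
  | zero => simp
  | succ k ih =>
    rw [← add_assoc, eval_trunc_succ, add_sub_right_comm]
    exact dvd_add ih (Dvd.dvd.mul_left (pow_dvd_pow _ (by omega)) _)

lemma sub_C_eval_trunc_mem (x : A) (n : ℕ) (f : A⟦X⟧) :
    f - C ((trunc n f).eval x) ∈ Ideal.span {X - C x} ⊔ Ideal.span {(X : A⟦X⟧) ^ n} := by
  have htrunc : f - (trunc n f : A⟦X⟧) ∈ Ideal.span {(X : A⟦X⟧) ^ n} := by
    rw [Ideal.mem_span_singleton, X_pow_dvd_iff]
    intro m hm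
    rw [map_sub, Polynomial.coeff_coe, coeff_trunc, if_pos hm, sub_self]
  have heval : (trunc n f : A⟦X⟧) - C ((trunc n f).eval x) ∈ Ideal.span {X - C x} := by
    obtain ⟨g, hg⟩ := Polynomial.X_sub_C_dvd_sub_C_eval (p := trunc n f) (a := x)
    rw [Ideal.mem_span_singleton]
    refine ⟨(g : A⟦X⟧), ?_⟩
    simpa using congrArg (fun q : Polynomial A => (q : A⟦X⟧)) hg
  simpa using add_mem (Ideal.mem_sup_left (T := Ideal.span {(X : A⟦X⟧) ^ n}) heval)
    (Ideal.mem_sup_right (S := Ideal.span {X - C x}) htrunc)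

lemma pow_dvd_of_C_mem {x a : A} {n : ℕ}
    (h : (C a : A⟦X⟧) ∈ Ideal.span {X - C x} ⊔ Ideal.span {(X : A⟦X⟧) ^ n}) : x ^ n ∣ a := by
  obtain ⟨u, hu, v, hv, huv⟩ := Submodule.mem_sup.1 h
  obtain ⟨g, rfl⟩ := Ideal.mem_span_singleton.1 hu
  obtain ⟨k, rfl⟩ := Ideal.mem_span_singleton.1 hv
  cases n with
  | zero => simp
  | succ n =>
    have hX : ∀ m < n + 1, coeff m ((X : A⟦X⟧) ^ (n + 1) * k) = 0 :=
      X_pow_dvd_iff.1 (Dvd.intro _ rfl)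
    have hconst : a = -(x * coeff 0 g) := by
      have := congrArg (coeff 0) huv
      rw [map_add, hX 0 (by omega)] at this
      simpa [sub_mul] using this.symm
    have hsucc : ∀ m < n, coeff m g = x * coeff (m + 1) g := by
      intro m hm
      have := congrArg (coeff (m + 1)) huv
      rw [map_add, hX (m + 1) (by omega)] at this
      simpa [sub_mul, coeff_C, coeff_succ_X_mul, sub_eq_zero] using this
    have hpow : ∀ m ≤ n, coeff 0 g = x ^ m * coeff m g := by
      intro m
      induction m with
      | zero => simp
      | succ m ih =>
        intro hm
        rw [ih (by omega), hsucc m (by omega), pow_succ, mul_assoc]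
    exact ⟨-coeff n g, by rw [hconst, hpow n le_rfl]; ring⟩

lemma pow_dvd_mul_eval_trunc {x : A} {f g : A⟦X⟧} (h : g * f ∈ Ideal.span {X - C x}) {b : A}
    {n : ℕ} (hb : g - C b ∈ Ideal.span {X - C x} ⊔ Ideal.span {(X : A⟦X⟧) ^ n}) :
    x ^ n ∣ b * (trunc n f).eval x := by
  refine pow_dvd_of_C_mem ?_
  have hmem := sub_mem (sub_mem (Ideal.mem_sup_left (T := Ideal.span {(X : A⟦X⟧) ^ n}) h)
    (Ideal.mul_mem_left _ g (sub_C_eval_trunc_mem x n f)))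
    (Ideal.mul_mem_right (C ((trunc n f).eval x)) _ hb)
  rw [map_mul]
  convert hmem using 1
  ring

lemma mem_span_X_sub_C_iff [IsDomain A] {x : A} (hx : x ≠ 0) {f : A⟦X⟧} :
    f ∈ Ideal.span {X - C x} ↔ ∀ n, x ^ n ∣ (trunc n f).eval x := by
  constructor
  · intro h n
    simpa using pow_dvd_mul_eval_trunc (x := x) (f := f) (g := 1) (b := 1) (n := n)
      (by rwa [one_mul]) (by simp)
  · intro h
    choose q hq using fun n => h (n + 1)
    rw [Ideal.mem_span_singleton]
    refine ⟨PowerSeries.mk fun n => -q n, ?_⟩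
    ext n
    cases n with
    | zero =>
      have hq0 := hq 0
      rw [eval_trunc_succ] at hq0
      simpa [sub_mul] using hq0
    | succ n =>
      have hqn := hq (n + 1)
      rw [eval_trunc_succ, hq n] at hqn
      have hcancel : x ^ (n + 1) * (q n + coeff (n + 1) f) = x ^ (n + 1) * (x * q (n + 1)) := by
        linear_combination hqn
      rw [sub_mul, map_sub, coeff_succ_X_mul, coeff_C_mul, coeff_mk, coeff_mk]
      linear_combination mul_left_cancel₀ (pow_ne_zero _ hx) hcancel

lemma mem_span_X_sub_C_of_C_mul_mem [IsDomain A] {x : A} (hx : x ≠ 0) {f : A⟦X⟧}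
    (h : C x * f ∈ Ideal.span {X - C x}) : f ∈ Ideal.span {X - C x} := by
  rw [mem_span_X_sub_C_iff hx]
  intro n
  have hdvd := pow_dvd_mul_eval_trunc (b := x) (n := n + 1) h (by simp)
  rw [pow_succ', mul_dvd_mul_iff_left hx, eval_trunc_succ] at hdvd
  exact (dvd_add_left (Dvd.intro_left _ rfl)).1 hdvd

lemma not_isUnit_mk_C {x : A} {P : Ideal A⟦X⟧} (hP : P ≠ ⊤) (hX : X - C x ∈ P) :
    ¬ IsUnit (Ideal.Quotient.mk P (C x)) := fun h => by
  obtain ⟨g, hg⟩ := h.exists_right_inv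
  obtain ⟨g, rfl⟩ := Ideal.Quotient.mk_surjective g
  have hmem : (1 : A⟦X⟧) - X * g ∈ P := by
    rw [← Ideal.Quotient.eq_zero_iff_mem, map_sub, map_mul, sub_eq_zero, map_one,
      Ideal.Quotient.mk_eq_mk_iff_sub_mem _ _ |>.2 hX, hg]
  refine hP (Ideal.eq_top_of_isUnit_mem _ hmem ?_)
  rw [isUnit_iff_constantCoeff]
  simp

end Trunc

variable {A : Type*} [CommRing A] [IsLocalRing A] [IsNoetherianRing A]

lemma dvd_of_forall_dvd_sub_of_mem_pow {a : A} {n : ℕ} {w : ℕ → A}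
    (hw : ∀ k, a ∣ w (n + k) - w n) (hmem : ∀ k, w k ∈ maximalIdeal A ^ k) : a ∣ w n := by
  have hH : IsHausdorff (maximalIdeal A) (A ⧸ Ideal.span {a}) := inferInstance
  rw [← Ideal.mem_span_singleton, ← Ideal.Quotient.eq_zero_iff_mem]
  refine hH.haus _ fun k => SModEq.zero.2 ?_
  have heq : Ideal.Quotient.mk (Ideal.span {a}) (w n) = w (n + k) • 1 := by
    rw [Algebra.smul_def, mul_one, eq_comm]
    exact Ideal.Quotient.eq.2 (Ideal.mem_span_singleton.2 (hw k))
  rw [heq]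
  exact Submodule.smul_mem_smul (Ideal.pow_le_pow_right (by omega) (hmem (n + k))) trivial

lemma isRadical_span_X_sub_C [IsDomain A] {x : A} (hx : x ≠ 0) (hxm : x ∈ maximalIdeal A)
    (hred : ∀ w : ℕ → A, (∀ n, w (n + 1) - w n ∈ maximalIdeal A ^ n) →
      (∀ n, w n ^ 2 ∈ maximalIdeal A ^ n) → ∀ n, w n ∈ maximalIdeal A ^ n) :
    (Ideal.span {(X : A⟦X⟧) - C x}).IsRadical := by
  rw [Ideal.isRadical_iff_pow_one_lt 2 one_lt_two]
  intro f hf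
  rw [mem_span_X_sub_C_iff hx]
  rw [sq] at hf
  have hsq (n : ℕ) : x ^ n ∣ (trunc n f).eval x ^ 2 := by
    rw [sq]
    exact pow_dvd_mul_eval_trunc hf (sub_C_eval_trunc_mem x n f)
  have hmem := hred (fun n => (trunc n f).eval x)
    (fun n => Ideal.mem_of_dvd _ (pow_dvd_eval_trunc_add_sub x n 1 f) (Ideal.pow_mem_pow hxm n))
    (fun n => Ideal.mem_of_dvd _ (hsq n) (Ideal.pow_mem_pow hxm n))
  exact fun n => dvd_of_forall_dvd_sub_of_mem_pow
    (fun k => pow_dvd_eval_trunc_add_sub x n k f) hmem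

end PowerSeries

section IntegralClosure

open Polynomial (scaleRoots_eval₂_mul eval₂_at_apply)

lemma isIntegral_map_div {A B : Type*} [CommRing A] [CommRing B] {K L : Type*} [Field K] [Field L]
    [Algebra A K] [FaithfulSMul A K] [Algebra B L] (φ : A →+* B) {a b : A}
    (hb : algebraMap B L (φ b) ≠ 0) (h : IsIntegral A (algebraMap A K a / algebraMap A K b)) :
    IsIntegral B (algebraMap B L (φ a) / algebraMap B L (φ b)) := by
  have hbK : algebraMap A K b ≠ 0 := fun h0 => hb (by
    rw [(FaithfulSMul.algebraMap_eq_zero_iff A K).1 h0, map_zero, map_zero])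
  obtain ⟨p, hp, hp0⟩ := h
  have hK := scaleRoots_eval₂_mul (p := p) (algebraMap A K)
    (algebraMap A K a / algebraMap A K b) b
  rw [hp0, mul_zero, mul_div_cancel₀ _ hbK, eval₂_at_apply,
    FaithfulSMul.algebraMap_eq_zero_iff] at hK
  have hL := scaleRoots_eval₂_mul (p := p) ((algebraMap B L).comp φ)
    (algebraMap B L (φ a) / algebraMap B L (φ b)) b
  rw [RingHom.comp_apply, mul_div_cancel₀ _ hb, ← RingHom.comp_apply, eval₂_at_apply, hK,
    map_zero] at hL
  exact ⟨p.map φ, hp.map _, (Polynomial.eval₂_map _ _ _).trans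
    ((mul_eq_zero.1 hL.symm).resolve_left (pow_ne_zero _ hb))⟩

variable {D : Type*} [CommRing D]

lemma exists_dvd_pow_of_isIntegral_div {L : Type*} [Field L] [Algebra D L] [FaithfulSMul D L]
    {t x : D} (hx : x ≠ 0) (h : IsIntegral D (algebraMap D L t / algebraMap D L x)) :
    ∃ n, x ∣ t ^ n := by
  obtain ⟨p, hp, hp0⟩ := h
  have hL := scaleRoots_eval₂_mul (p := p) (algebraMap D L)
    (algebraMap D L t / algebraMap D L x) x
  rw [hp0, mul_zero, mul_div_cancel₀ _ ((FaithfulSMul.algebraMap_eq_zero_iff D L).not.2 hx),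
    eval₂_at_apply, FaithfulSMul.algebraMap_eq_zero_iff, Polynomial.eval_eq_sum_range,
    Polynomial.natDegree_scaleRoots, Finset.sum_range_succ,
    Polynomial.coeff_scaleRoots_natDegree, hp.leadingCoeff, one_mul] at hL
  refine ⟨p.natDegree, (dvd_add_right (Finset.dvd_sum fun i hi => ?_)).1 (hL ▸ dvd_zero x)⟩
  rw [Polynomial.coeff_scaleRoots]
  have hpos : p.natDegree - i ≠ 0 := Nat.sub_ne_zero_of_lt (Finset.mem_range.1 hi)
  exact Dvd.dvd.mul_right (Dvd.dvd.mul_left (dvd_pow_self x hpos) _) _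

variable [IsDomain D] [IsNoetherianRing D]

lemma exists_dvd_mul_pow_of_mem_minimalPrimes {x c : D} (hc : c ≠ 0) {q : Ideal D}
    (hq : q ∈ (Ideal.span {x}).minimalPrimes) : ∃ t ∉ q, ∃ n, c ∣ t * x ^ n := by
  have hqp : q.IsPrime := hq.1.1
  by_contra! hcon
  have hdis : Disjoint (Ideal.span {c} : Set D)
      (q.primeCompl ⊔ Submonoid.powers x : Submonoid D) := by
    rw [Set.disjoint_left]
    intro z hz hz2
    obtain ⟨t, ht, _, ⟨n, rfl⟩, rfl⟩ := Submonoid.mem_sup.1 hz2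
    exact hcon t ht n (Ideal.mem_span_singleton.1 hz)
  obtain ⟨P, hP, hcP, hPd⟩ := Ideal.exists_le_prime_disjoint _ _ hdis
  rw [Set.disjoint_left] at hPd
  have hPq : P < q := by
    refine lt_of_le_of_ne (fun z hz => ?_) ?_
    · by_contra hzq
      exact hPd hz (Submonoid.mem_sup_left (show z ∈ q.primeCompl from hzq))
    · rintro rfl
      exact hPd (hq.1.2 (Ideal.mem_span_singleton_self x))
        (Submonoid.mem_sup_right (Submonoid.mem_powers x))
  have hP0 := (Ideal.height_le_iff (n := 1)).1
    (Ideal.height_le_one_of_isPrincipal_of_mem_minimalPrimes _ _ hq) P hP hPq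
  rw [Nat.cast_one, Order.lt_one_iff, Ideal.height_eq_zero_iff,
    IsDomain.minimalPrimes_eq_singleton_bot, Set.mem_singleton_iff] at hP0
  subst hP0
  exact hc (by simpa using hcP)

lemma eq_zero_of_forall_isIntegral_div_pow {L : Type*} [Field L] [Algebra D L] [FaithfulSMul D L]
    {c x : D} (hx : ¬ IsUnit x) (hx0 : x ≠ 0)
    (h : ∀ n, IsIntegral D (algebraMap D L c / algebraMap D L x ^ n)) : c = 0 := by
  by_contra hc
  have hxL : algebraMap D L x ≠ 0 := (FaithfulSMul.algebraMap_eq_zero_iff D L).not.2 hx0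
  obtain ⟨M, hM, hxM⟩ := Ideal.exists_le_maximal _ (Ideal.span_singleton_ne_top hx)
  have := hM.isPrime
  obtain ⟨q, hq, -⟩ := Ideal.exists_minimalPrimes_le hxM
  obtain ⟨t, ht, n, e, hte⟩ := exists_dvd_mul_pow_of_mem_minimalPrimes hc hq
  have htx : algebraMap D L t / algebraMap D L x =
      algebraMap D L e * (algebraMap D L c / algebraMap D L x ^ (n + 1)) := by
    have hteL := congrArg (algebraMap D L) hte
    simp only [map_mul, map_pow] at hteL
    field_simp
    linear_combination algebraMap D L x * hteL
  obtain ⟨k, hk⟩ := exists_dvd_pow_of_isIntegral_div hx0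
    (htx ▸ isIntegral_algebraMap.mul (h (n + 1)))
  exact ht (hq.1.1.mem_of_pow_mem k (hq.1.2 (Ideal.mem_span_singleton.2 hk)))

end IntegralClosure

section AnalyticallyUnramified

open PowerSeries

lemma exists_isPrime_le_notMem {A : Type*} [CommRing A] {I : Ideal A} (hI : I.IsRadical) {f : A}
    (hf : f ∉ I) : ∃ P : Ideal A, P.IsPrime ∧ I ≤ P ∧ f ∉ P := by
  rw [← hI.radical, Ideal.radical_eq_sInf, Submodule.mem_sInf] at hf
  push Not at hf
  obtain ⟨P, ⟨hIP, hP⟩, hfP⟩ := hf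
  exact ⟨P, hP, hIP, hfP⟩

lemma isIntegral_div_pow_of_isIntegral_eval_trunc {A B : Type*} [CommRing A] [CommRing B]
    {K L : Type*} [Field K] [Field L] [Algebra A K] [FaithfulSMul A K] [Algebra B L]
    (π : A⟦X⟧ →+* B) {x : A} (hX : π X = π (C x)) (hx : algebraMap B L (π (C x)) ≠ 0) {f : A⟦X⟧}
    {n : ℕ} (h : IsIntegral A
      (algebraMap A K ((trunc n f).eval x) / algebraMap A K (x ^ n))) :
    IsIntegral B (algebraMap B L (π f) / algebraMap B L (π (C x)) ^ n) := by
  obtain ⟨u, hu, v, hv, huv⟩ := Submodule.mem_sup.1 (sub_C_eval_trunc_mem x n f)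
  obtain ⟨c, rfl⟩ := Ideal.mem_span_singleton.1 hu
  obtain ⟨d, rfl⟩ := Ideal.mem_span_singleton.1 hv
  have hπ : π f = π (C ((trunc n f).eval x)) + π (C x) ^ n * π d := by
    have hsub := congrArg π huv
    rw [map_add, map_mul, map_sub, hX, sub_self, zero_mul, zero_add, map_mul, map_pow, hX,
      map_sub] at hsub
    rw [hsub, add_sub_cancel]
  have hsplit : algebraMap B L (π f) / algebraMap B L (π (C x)) ^ n =
      algebraMap B L (π (C ((trunc n f).eval x))) / algebraMap B L (π (C (x ^ n))) +
        algebraMap B L (π d) := by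
    rw [hπ, map_add, map_mul, map_pow, map_pow, map_pow, map_pow, add_div,
      mul_div_cancel_left₀ _ (pow_ne_zero n hx)]
  rw [hsplit]
  refine (isIntegral_map_div (π.comp C) ?_ h).add isIntegral_algebraMap
  simpa using pow_ne_zero n hx

lemma eq_zero_of_forall_isIntegral_eval_trunc {A B : Type*} [CommRing A] [CommRing B] [IsDomain B]
    [IsNoetherianRing B] {K : Type*} [Field K] [Algebra A K] [FaithfulSMul A K] (π : A⟦X⟧ →+* B)
    {x : A} (hX : π X = π (C x)) (hunit : ¬ IsUnit (π (C x))) (hx : π (C x) ≠ 0) {f : A⟦X⟧}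
    (h : ∀ n, IsIntegral A
      (algebraMap A K ((trunc (n + 1) f).eval x) / algebraMap A K (x ^ (n + 1)))) :
    π f = 0 := by
  refine eq_zero_of_forall_isIntegral_div_pow (L := FractionRing B) hunit hx fun n => ?_
  cases n with
  | zero => simpa using isIntegral_algebraMap
  | succ n =>
    exact isIntegral_div_pow_of_isIntegral_eval_trunc π hX
      ((FaithfulSMul.algebraMap_eq_zero_iff _ _).not.2 hx) (h n)

lemma exists_isPrime_C_mul_notMem {A : Type*} [CommRing A] [IsDomain A] {x : A} (hx : x ≠ 0)
    (hrad : (Ideal.span {(X : A⟦X⟧) - C x}).IsRadical) {f : A⟦X⟧}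
    (hf : f ∉ Ideal.span {X - C x}) :
    ∃ P : Ideal A⟦X⟧, P.IsPrime ∧ X - C x ∈ P ∧ C x * f ∉ P := by
  obtain ⟨P, hP, hIP, hfP⟩ := exists_isPrime_le_notMem hrad
    fun h => hf (mem_span_X_sub_C_of_C_mul_mem hx h)
  exact ⟨P, hP, hIP (Ideal.mem_span_singleton_self _), hfP⟩

lemma exists_eval_trunc_eq {A : Type*} [CommRing A] {x : A} {a r : ℕ → A}
    (ha : ∀ n, a (n + 1) = a n + x ^ (n + 1) * r n) :
    ∃ f : A⟦X⟧, ∀ n, (trunc (n + 1) f).eval x = a n := by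
  refine ⟨PowerSeries.mk fun n => Nat.casesOn n (a 0) r, fun n => ?_⟩
  induction n with
  | zero => simp
  | succ n ih => rw [eval_trunc_succ, ih, ha, coeff_mk, mul_comm]

/-- The `x`-adic limit `f` of the `aₙ` is taken in `A⟦X⟧ ⧸ (X - x)`, which is reduced by `hred`.
Modulo a prime of `A⟦X⟧` containing `X - x` but not `x f`, every `f / xⁿ` is integral. -/
lemma dvd_of_isIntegral_div {A : Type*} [CommRing A] [IsDomain A] [IsLocalRing A]
    [IsNoetherianRing A]
    (hred : ∀ w : ℕ → A, (∀ n, w (n + 1) - w n ∈ maximalIdeal A ^ n) →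
      (∀ n, w n ^ 2 ∈ maximalIdeal A ^ n) → ∀ n, w n ∈ maximalIdeal A ^ n)
    {K : Type*} [Field K] [Algebra A K] [FaithfulSMul A K] {x : A} (hx : x ≠ 0)
    (hxm : x ∈ maximalIdeal A) (a r : ℕ → A) (ha : ∀ n, a (n + 1) = a n + x ^ (n + 1) * r n)
    (hint : ∀ n, IsIntegral A (algebraMap A K (a n) / algebraMap A K (x ^ (n + 1)))) :
    x ∣ a 0 := by
  by_contra hdvd
  obtain ⟨f, hfa⟩ := exists_eval_trunc_eq ha
  have hf : f ∉ Ideal.span {X - C x} := fun h => hdvd <| by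
    have hdvd1 := (mem_span_X_sub_C_iff hx).1 h 1
    rwa [pow_one, ← zero_add 1, hfa] at hdvd1
  have hrad := isRadical_span_X_sub_C hx hxm hred
  obtain ⟨P, hP, hXP, hxfP⟩ := exists_isPrime_C_mul_notMem hx hrad hf
  have hx0 : Ideal.Quotient.mk P (C x) ≠ 0 := fun h =>
    hxfP (P.mul_mem_right _ (Ideal.Quotient.eq_zero_iff_mem.1 h))
  have hzero := eq_zero_of_forall_isIntegral_eval_trunc (K := K) _ (Ideal.Quotient.eq.2 hXP)
    (not_isUnit_mk_C hP.ne_top hXP) hx0 fun n => by rw [hfa]; exact hint n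
  exact hxfP (P.mul_mem_left _ (Ideal.Quotient.eq_zero_iff_mem.1 hzero))

end AnalyticallyUnramified

/-! ### Finite length of the first local cohomology module -/

section Divisible

variable {R H : Type*} [CommRing R] [AddCommGroup H] [Module R H] {x : R} {h : H}

/-- The submodule of elements divisible by every power of `x`. Over it, multiplication by `x` is
surjective under the Mittag-Leffler condition. -/
def powDivisible (x : R) (H : Type*) [AddCommGroup H] [Module R H] : Submodule R H :=
  ⨅ n, LinearMap.range (LinearMap.lsmul R H (x ^ n))

lemma mem_powDivisible : h ∈ powDivisible x H ↔ ∀ n, ∃ g, x ^ n • g = h :=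
  Submodule.mem_iInf _

lemma exists_mem_powDivisible_of_smul_eq_zero
    [IsArtinian R (LinearMap.ker (LinearMap.lsmul R H x))] :
    ∃ n, ∀ g : H, x • x ^ n • g = 0 → x ^ n • g ∈ powDivisible x H := by
  let E := LinearMap.ker (LinearMap.lsmul R H x)
  let D (n : ℕ) : Submodule R H := LinearMap.range (LinearMap.lsmul R H (x ^ n))
  have hD : Antitone D := antitone_nat_of_succ_le fun n => by
    rintro _ ⟨g, rfl⟩
    exact ⟨x • g, by simp only [LinearMap.lsmul_apply, smul_smul, pow_succ]⟩
  have hanti : Antitone fun n => (D n).comap E.subtype :=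
    fun _ _ hle => Submodule.comap_mono (hD hle)
  obtain ⟨n, hn⟩ := WellFoundedLT.antitone_chain_condition hanti
  refine ⟨n, fun g hg => mem_powDivisible.2 fun k => ?_⟩
  have hmem : (⟨x ^ n • g, hg⟩ : E) ∈ (D n).comap E.subtype := ⟨g, rfl⟩
  rcases le_total n k with hnk | hkn
  · exact (hn k hnk).le hmem
  · exact hD hkn hmem

lemma exists_mem_powDivisible_ne_zero [IsArtinian R (LinearMap.ker (LinearMap.lsmul R H x))]
    (htors : ∀ h : H, ∃ n, x ^ n • h = 0) (hne : ∀ n, ∃ h : H, x ^ n • h ≠ 0) :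
    ∃ h ∈ powDivisible x H, h ≠ 0 ∧ x • h = 0 := by
  classical
  obtain ⟨n, hn⟩ := exists_mem_powDivisible_of_smul_eq_zero (R := R) (H := H) (x := x)
  obtain ⟨h, hh⟩ := hne n
  have hex : ∃ k, x ^ k • x ^ n • h = 0 := htors _
  obtain ⟨k, hk⟩ : ∃ k, Nat.find hex = k + 1 := Nat.exists_eq_succ_of_ne_zero fun h0 => hh <| by
    simpa [h0] using Nat.find_spec hex
  have hx : x • x ^ k • x ^ n • h = 0 := by
    rw [smul_smul, ← pow_succ', ← hk]
    exact Nat.find_spec hex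
  refine ⟨x ^ k • x ^ n • h, ?_, Nat.find_min hex (hk ▸ k.lt_succ_self), hx⟩
  rw [smul_comm (x ^ k)] at hx ⊢
  exact hn _ hx

lemma exists_smul_eq_of_mem_powDivisible [IsArtinian R (LinearMap.ker (LinearMap.lsmul R H x))]
    (hh : h ∈ powDivisible x H) : ∃ g ∈ powDivisible x H, x • g = h := by
  obtain ⟨n, hn⟩ := exists_mem_powDivisible_of_smul_eq_zero (R := R) (H := H) (x := x)
  rw [mem_powDivisible] at hh
  obtain ⟨g, hg⟩ := hh (n + 1)
  rw [pow_succ', mul_smul] at hg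
  refine ⟨x ^ n • g, mem_powDivisible.2 fun k => ?_, hg⟩
  obtain ⟨f, hf⟩ := hh (n + k + 1)
  rw [pow_succ', mul_smul, pow_add, mul_smul] at hf
  have hdiff : x ^ n • (g - x ^ k • f) ∈ powDivisible x H :=
    hn _ (by rw [smul_sub, smul_sub, hg, hf, sub_self])
  obtain ⟨e, he⟩ := mem_powDivisible.1 hdiff k
  refine ⟨e + x ^ n • f, ?_⟩
  rw [smul_add, he, smul_comm, ← smul_add, sub_add_cancel]

lemma exists_divisible_chain [IsArtinian R (LinearMap.ker (LinearMap.lsmul R H x))]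
    (htors : ∀ h : H, ∃ n, x ^ n • h = 0) (hne : ∀ n, ∃ h : H, x ^ n • h ≠ 0) :
    ∃ g : ℕ → H, g 0 ≠ 0 ∧ x • g 0 = 0 ∧ ∀ i, x • g (i + 1) = g i := by
  obtain ⟨h, hh, hh0, hxh⟩ := exists_mem_powDivisible_ne_zero htors hne
  choose next hnext hsmul using fun g : powDivisible x H => exists_smul_eq_of_mem_powDivisible g.2
  let chain (n : ℕ) : powDivisible x H := n.rec ⟨h, hh⟩ fun _ g => ⟨next g, hnext g⟩
  exact ⟨fun n => (chain n).1, hh0, hxh, fun n => hsmul (chain n)⟩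

end Divisible

section FiniteLength

variable {R M : Type*} [CommRing R] [AddCommGroup M] [Module R M] {x y : R}

lemma exists_uniform_pow_smul_eq_zero (x : R) (M : Type*) [AddCommGroup M] [Module R M]
    [IsNoetherian R M] : ∃ k, ∀ (m : M) (n : ℕ), x ^ n • m = 0 → x ^ k • m = 0 := by
  obtain ⟨k, hk⟩ := (algebraMap R (Module.End R M) x).eventually_iSup_ker_pow_eq.exists
  have hker (n : ℕ) (m : M) :
      m ∈ LinearMap.ker (algebraMap R (Module.End R M) x ^ n) ↔ x ^ n • m = 0 := by
    rw [LinearMap.mem_ker, ← map_pow, Module.algebraMap_end_apply]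
  refine ⟨k, fun m n hn => (hker k m).1 ?_⟩
  rw [← hk]
  exact Submodule.mem_iSup_of_mem n ((hker n m).2 hn)

lemma isNoetherian_ker_lsmul_quotient {N : Submodule R M} [IsNoetherian R N]
    (hx : Function.Injective (LinearMap.lsmul R M x)) :
    IsNoetherian R (LinearMap.ker (LinearMap.lsmul R (M ⧸ N) x)) := by
  let T : Submodule R M := N.comap (LinearMap.lsmul R M x)
  have hT : IsNoetherian R T := isNoetherian_of_injective
    (LinearMap.restrict (p := T) (q := N) (LinearMap.lsmul R M x) fun _ ht => ht)
    fun s t h => Subtype.ext (hx (congrArg Subtype.val h))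
  refine isNoetherian_of_surjective (LinearMap.restrict (p := T) N.mkQ fun t ht =>
    (Submodule.Quotient.mk_eq_zero N).2 ht) (LinearMap.range_eq_top.2 ?_)
  rintro ⟨h, hh⟩
  obtain ⟨t, rfl⟩ := N.mkQ_surjective h
  exact ⟨⟨t, (Submodule.Quotient.mk_eq_zero N).1 hh⟩, rfl⟩

variable [IsLocalRing R] [IsNoetherianRing R] [Module.Finite R M]

lemma isFiniteLength_of_smul_eq_zero {I : Ideal R} (hI : I.radical = maximalIdeal R)
    (hM : ∀ a ∈ I, ∀ m : M, a • m = 0) : IsFiniteLength R M := by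
  have hart := isArtinianRing_quotient_of_radical_eq hI
  have htors : Module.IsTorsionBySet R M I := fun m a => hM a a.2 m
  let _ := htors.module
  have := htors.isScalarTower (S := R)
  have := Module.Finite.of_restrictScalars_finite R (R ⧸ I) M
  rw [← Module.length_ne_top_iff,
    Module.length_eq_of_surjective (R := R ⧸ I) (S := R) Ideal.Quotient.mk_surjective]
  exact Module.length_ne_top

lemma isFiniteLength_of_exists_pow_smul_eq_zero
    (hrad : (Ideal.span {x, y}).radical = maximalIdeal R)
    (hx : ∀ m : M, ∃ k, x ^ k • m = 0) (hy : ∀ m : M, ∃ k, y ^ k • m = 0) :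
    IsFiniteLength R M := by
  obtain ⟨k, hk⟩ := exists_uniform_pow_smul_eq_zero x M
  obtain ⟨l, hl⟩ := exists_uniform_pow_smul_eq_zero y M
  have hrad' := (radical_span_pair_pow x y (k + l).succ_ne_zero).trans hrad
  refine isFiniteLength_of_smul_eq_zero hrad' fun a ha m => ?_
  obtain ⟨b, c, rfl⟩ := Ideal.mem_span_pair.1 ha
  have hxm : x ^ (k + l + 1) • m = 0 := by
    obtain ⟨n, hn⟩ := hx m
    rw [add_assoc, add_comm, pow_add, mul_smul, hk m n hn, smul_zero]
  have hym : y ^ (k + l + 1) • m = 0 := by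
    obtain ⟨n, hn⟩ := hy m
    rw [add_right_comm, pow_add, mul_smul, hl m n hn, smul_zero]
  rw [add_smul, mul_smul, mul_smul, hxm, hym, smul_zero, smul_zero, add_zero]

end FiniteLength

section Transform

lemma exists_pow_smul_transform_quotient_eq_zero {R : Type u} [CommRing R] {I : Ideal R} {a : R}
    (ha : a ∈ I) (h : idealTransform I ⧸ LinearMap.range (toTransform I)) :
    ∃ n, a ^ n • h = 0 := by
  obtain ⟨s, rfl⟩ := Submodule.mkQ_surjective _ h
  obtain ⟨n, hn⟩ := s.2
  exact ⟨n, (Submodule.Quotient.mk_eq_zero _).2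
    (mem_range_toTransform.2 (hn _ (Ideal.pow_mem_pow ha n)))⟩

lemma isArtinian_ker_lsmul_transform_quotient {R : Type u} [CommRing R] [IsLocalRing R]
    [IsNoetherianRing R] {x y : R} (hx : x ∈ nonZeroDivisors R)
    (hrad : (Ideal.span {x, y}).radical = maximalIdeal R) :
    IsArtinian R (LinearMap.ker (LinearMap.lsmul R (idealTransform (Ideal.span {x, y}) ⧸
      LinearMap.range (toTransform (Ideal.span {x, y}))) x)) := by
  have hinj : Function.Injective (LinearMap.lsmul R (idealTransform (Ideal.span {x, y})) x) :=
    fun s t h => Subtype.ext ((bijective_lsmul_fractionRing hx).1 (congrArg Subtype.val h))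
  have hnoeth := isNoetherian_ker_lsmul_quotient
    (N := LinearMap.range (toTransform (Ideal.span {x, y}))) hinj
  refine (isFiniteLength_iff_isNoetherian_isArtinian.1
    (isFiniteLength_of_exists_pow_smul_eq_zero hrad (fun m => ?_) fun m => ?_)).2
  · exact ⟨1, Subtype.ext (by rw [pow_one]; exact m.2)⟩
  · have hy : y ∈ Ideal.span {x, y} := Ideal.subset_span (Set.mem_insert_of_mem x rfl)
    obtain ⟨k, hk⟩ := exists_pow_smul_transform_quotient_eq_zero hy m.1
    exact ⟨k, Subtype.ext hk⟩

lemma exists_transform_chain {R : Type*} [CommRing R] {I : Ideal R} {x : R} (hx : x ∈ I)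
    [IsArtinian R (LinearMap.ker
      (LinearMap.lsmul R (idealTransform I ⧸ LinearMap.range (toTransform I)) x))]
    (hunbdd : ∀ k, ∃ s : idealTransform I, x ^ k • s ∉ LinearMap.range (toTransform I)) :
    ∃ s : ℕ → idealTransform I, s 0 ∉ LinearMap.range (toTransform I) ∧
      x • s 0 ∈ LinearMap.range (toTransform I) ∧
      ∀ i, x • s (i + 1) - s i ∈ LinearMap.range (toTransform I) := by
  obtain ⟨g, hg0, hxg0, hg⟩ := exists_divisible_chain
    (exists_pow_smul_transform_quotient_eq_zero hx) fun n => by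
      obtain ⟨s, hs⟩ := hunbdd n
      exact ⟨Submodule.Quotient.mk s, fun h => hs ((Submodule.Quotient.mk_eq_zero _).1 h)⟩
  choose s hs using fun i => Submodule.mkQ_surjective _ (g i)
  simp only [← hs, ← map_smul] at hg0 hxg0 hg
  exact ⟨s, fun h => hg0 ((Submodule.Quotient.mk_eq_zero _).2 h),
    (Submodule.Quotient.mk_eq_zero _).1 hxg0, fun i => (Submodule.Quotient.eq _).1 (hg i)⟩

lemma exists_compatible_numerators {A K : Type*} [CommRing A] [Field K] [Algebra A K]
    [FaithfulSMul A K] {x : A} {s : ℕ → K} (h0 : x • s 0 ∈ (1 : Submodule A K))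
    (hs : ∀ i, x • s (i + 1) - s i ∈ (1 : Submodule A K)) :
    ∃ a r : ℕ → A, (∀ n, a (n + 1) = a n + x ^ (n + 1) * r n) ∧
      ∀ n, algebraMap A K (a n) = algebraMap A K x ^ (n + 1) * s n := by
  obtain ⟨a₀, ha₀⟩ := Submodule.mem_one.1 h0
  choose r hr using fun i => Submodule.mem_one.1 (hs i)
  let a (n : ℕ) : A := n.rec a₀ fun n b => b + x ^ (n + 1) * r n
  refine ⟨a, r, fun _ => rfl, fun n => ?_⟩
  induction n with
  | zero => rw [zero_add, pow_one, ← Algebra.smul_def, ← ha₀]; rfl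
  | succ n ih =>
    change algebraMap A K (a n + x ^ (n + 1) * r n) = _
    rw [map_add, map_mul, map_pow, ih, hr, Algebra.smul_def]
    ring

lemma isIntegral_of_mem_idealTransform {A : Type*} [CommRing A] [IsDomain A] [IsLocalRing A]
    [IsNoetherianRing A] (hdim : ringKrullDim A = 2) (hcat : IsCatenaryRing (Polynomial A))
    {x y : A} (hrad : (Ideal.span {x, y}).radical = maximalIdeal A) {s : FractionRing A}
    (hs : s ∈ idealTransform (Ideal.span {x, y})) : IsIntegral A s := by
  obtain ⟨n, hxs, hys⟩ := mem_idealTransform_span_pair.1 hs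
  obtain ⟨b, hb⟩ := Submodule.mem_one.1 hxs
  obtain ⟨c, hc⟩ := Submodule.mem_one.1 hys
  rw [Algebra.smul_def, map_pow] at hb hc
  exact isIntegral_of_pow_smul_mem hdim hcat hrad hb hc

/- A counterexample would yield a Mittag-Leffler chain `sₙ = aₙ / xⁿ⁺¹` of elements of the transform
with `s₀ ∉ A`, all of them integral over `A`. -/
lemma exists_pow_smul_idealTransform_mem_range {A : Type*} [CommRing A] [IsDomain A]
    [IsLocalRing A] [IsNoetherianRing A] (hdim : ringKrullDim A = 2)
    (hcat : IsCatenaryRing (Polynomial A))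
    (hred : ∀ w : ℕ → A, (∀ n, w (n + 1) - w n ∈ maximalIdeal A ^ n) →
      (∀ n, w n ^ 2 ∈ maximalIdeal A ^ n) → ∀ n, w n ∈ maximalIdeal A ^ n)
    {x y : A} (hrad : (Ideal.span {x, y}).radical = maximalIdeal A) (hx : x ≠ 0) :
    ∃ k, ∀ s : idealTransform (Ideal.span {x, y}), x ^ k • s ∈ LinearMap.range (toTransform _) := by
  by_contra! hcon
  have hxI : x ∈ Ideal.span {x, y} := Ideal.subset_span (Set.mem_insert x _)
  have hart := isArtinian_ker_lsmul_transform_quotient (mem_nonZeroDivisors_of_ne_zero hx) hrad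
  obtain ⟨s, hs0, hxs0, hs⟩ := exists_transform_chain hxI hcon
  obtain ⟨a, r, ha, has⟩ := exists_compatible_numerators (s := fun i => (s i).1)
    (mem_range_toTransform.1 hxs0) fun i => mem_range_toTransform.1 (hs i)
  have hxK : algebraMap A (FractionRing A) x ≠ 0 :=
    (FaithfulSMul.algebraMap_eq_zero_iff _ _).not.2 hx
  obtain ⟨b, hb⟩ := dvd_of_isIntegral_div hred (K := FractionRing A) hx
    (hrad ▸ Ideal.le_radical hxI) a r ha fun n => by
      rw [has, map_pow, mul_div_cancel_left₀ _ (pow_ne_zero _ hxK)]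
      exact isIntegral_of_mem_idealTransform hdim hcat hrad (s n).2
  refine hs0 (mem_range_toTransform.2 (Submodule.mem_one.2 ⟨b, mul_left_cancel₀ hxK ?_⟩))
  rw [← map_mul, ← hb, has, zero_add, pow_one]

end Transform

/-- The `y`-power torsion of `M / xⁿM` is killed by a power of `x` which does not depend on `n`.
For `M = R` and `x` regular this says that `S / R` is killed by a power of `x`, where `S` is the
ideal transform of `R` at `(x, y)`. -/
def SaturationBounded {R : Type*} [CommRing R] (x y : R) (M : Type*) [AddCommGroup M]
    [Module R M] : Prop :=
  ∃ N : ℕ, ∀ (n k : ℕ) (m m' : M), y ^ k • m = x ^ n • m' → ∃ m'', x ^ N • m = x ^ n • m''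

section Saturation

variable {R M M' : Type*} [CommRing R] {x y : R} [AddCommGroup M] [Module R M] [AddCommGroup M']
  [Module R M']

lemma SaturationBounded.of_linearEquiv (e : M ≃ₗ[R] M') (h : SaturationBounded x y M) :
    SaturationBounded x y M' := by
  obtain ⟨N, hN⟩ := h
  refine ⟨N, fun n k m m' hm => ?_⟩
  obtain ⟨m'', hm''⟩ := hN n k (e.symm m) (e.symm m') (by rw [← map_smul, hm, map_smul])
  exact ⟨e m'', by rw [← map_smul, ← hm'', map_smul, e.apply_symm_apply]⟩

lemma SaturationBounded.of_injective [IsNoetherian R M'] {f : M →ₗ[R] M'}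
    (hf : Function.Injective f) (h : SaturationBounded x y M') : SaturationBounded x y M := by
  obtain ⟨N, hN⟩ := h
  obtain ⟨N', hN'⟩ := exists_uniform_pow_smul_eq_zero x (M' ⧸ LinearMap.range f)
  refine ⟨N' + N, fun n k m m' hm => ?_⟩
  obtain ⟨u, hu⟩ := hN n k (f m) (f m') (by rw [← map_smul, hm, map_smul])
  have hxu : x ^ n • (LinearMap.range f).mkQ u = 0 := by
    rw [← map_smul, ← hu, ← map_smul]
    exact (Submodule.Quotient.mk_eq_zero _).2 ⟨_, rfl⟩
  obtain ⟨m'', hm''⟩ := (Submodule.Quotient.mk_eq_zero _).1 (hN' _ n hxu)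
  refine ⟨m'', hf ?_⟩
  rw [map_smul, map_smul, hm'', pow_add, mul_smul, hu, smul_comm]

lemma SaturationBounded.of_submodule_quotient (T : Submodule R M)
    (hx : IsSMulRegular (M ⧸ T) x) (hT : SaturationBounded x y T)
    (hMT : SaturationBounded x y (M ⧸ T)) : SaturationBounded x y M := by
  obtain ⟨N, hN⟩ := hT
  obtain ⟨N', hN'⟩ := hMT
  refine ⟨N + N', fun n k m m' hm => ?_⟩
  obtain ⟨u, hu⟩ := hN' n k (T.mkQ m) (T.mkQ m') (by rw [← map_smul, hm, map_smul])
  obtain ⟨u, rfl⟩ := T.mkQ_surjective u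
  have hmu : x ^ N' • m - x ^ n • u ∈ T := (Submodule.Quotient.eq T).1 hu
  have heq : y ^ k • (x ^ N' • m - x ^ n • u) = x ^ n • (x ^ N' • m' - y ^ k • u) := by
    rw [smul_sub, smul_sub, smul_comm (y ^ k), hm, smul_comm (x ^ N') (x ^ n),
      smul_comm (y ^ k) (x ^ n)]
  have hmu' : x ^ N' • m' - y ^ k • u ∈ T :=
    mem_of_isSMulRegular_quotient_of_smul_mem (hx.pow n) (heq ▸ T.smul_mem _ hmu)
  obtain ⟨w, hw⟩ := hN n k ⟨_, hmu⟩ ⟨_, hmu'⟩ (Subtype.ext heq)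
  have hw' : x ^ N • (x ^ N' • m - x ^ n • u) = x ^ n • w.1 := congrArg Subtype.val hw
  refine ⟨w + x ^ N • u, ?_⟩
  rw [smul_add, ← hw', smul_sub, pow_add, mul_smul, smul_comm (x ^ N) (x ^ n), sub_add_cancel]

lemma saturationBounded_algebraMap_iff {A : Type*} [CommRing A] [Algebra R A] [Module A M]
    [IsScalarTower R A M] :
    SaturationBounded (algebraMap R A x) (algebraMap R A y) M ↔ SaturationBounded x y M := by
  simp only [SaturationBounded, ← map_pow, algebraMap_smul]

lemma exists_pow_smul_eq_of_mem_idealTransform {s : FractionRing R}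
    (hs : s ∈ idealTransform (Ideal.span {x, y})) :
    ∃ (n : ℕ) (a b : R), x ^ n • s = algebraMap R _ a ∧ y ^ n • a = x ^ n • b := by
  obtain ⟨n, hxs, hys⟩ := mem_idealTransform_span_pair.1 hs
  obtain ⟨a, ha⟩ := Submodule.mem_one.1 hxs
  obtain ⟨b, hb⟩ := Submodule.mem_one.1 hys
  refine ⟨n, a, b, ha.symm, IsFractionRing.injective R (FractionRing R) ?_⟩
  rw [smul_eq_mul, smul_eq_mul, map_mul, map_mul, ha, hb, ← Algebra.smul_def, ← Algebra.smul_def,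
    smul_comm]

lemma exists_mem_idealTransform_of_pow_smul_eq (hx : x ∈ nonZeroDivisors R) {n k : ℕ} {a b : R}
    (hab : y ^ k • a = x ^ n • b) :
    ∃ s ∈ idealTransform (Ideal.span {x, y}), x ^ n • s = algebraMap R _ a := by
  have hbij := bijective_lsmul_fractionRing (pow_mem hx n)
  obtain ⟨s, hs⟩ := hbij.2 (algebraMap R (FractionRing R) a)
  rw [LinearMap.lsmul_apply] at hs
  have hys : y ^ k • s = algebraMap R (FractionRing R) b := hbij.1 <| by
    rw [LinearMap.lsmul_apply, LinearMap.lsmul_apply, smul_comm, hs, Algebra.smul_def,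
      Algebra.smul_def, ← map_mul, ← map_mul]
    exact congrArg _ hab
  refine ⟨s, mem_idealTransform_span_pair.2 ⟨n + k, ?_, ?_⟩, hs⟩
  · rw [add_comm, pow_add, mul_smul, hs]
    exact Submodule.smul_mem _ _ (Submodule.algebraMap_mem a)
  · rw [pow_add, mul_smul, hys]
    exact Submodule.smul_mem _ _ (Submodule.algebraMap_mem b)

lemma saturationBounded_self_iff (hx : x ∈ nonZeroDivisors R) : SaturationBounded x y R ↔
    ∃ N, ∀ s : idealTransform (Ideal.span {x, y}), x ^ N • s ∈ LinearMap.range (toTransform _) := by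
  refine exists_congr fun N => ⟨fun hN s => ?_, fun hN n k a b hab => ?_⟩
  · obtain ⟨n, a, b, hs, hab⟩ := exists_pow_smul_eq_of_mem_idealTransform s.2
    obtain ⟨c, hc⟩ := hN n n a b hab
    refine mem_range_toTransform.2 (Submodule.mem_one.2 ⟨c, ?_⟩)
    refine (bijective_lsmul_fractionRing (pow_mem hx n)).1 ?_
    rw [LinearMap.lsmul_apply, LinearMap.lsmul_apply, Submodule.coe_smul, smul_comm, hs,
      Algebra.smul_def, Algebra.smul_def, ← map_mul, ← map_mul]
    exact congrArg _ hc.symm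
  · obtain ⟨s, hs, hsa⟩ := exists_mem_idealTransform_of_pow_smul_eq hx hab
    obtain ⟨c, hc⟩ := hN ⟨s, hs⟩
    have hcs : algebraMap R (FractionRing R) c = x ^ N • s := congrArg Subtype.val hc
    refine ⟨c, IsFractionRing.injective R (FractionRing R) ?_⟩
    rw [smul_eq_mul, smul_eq_mul, map_mul, map_mul, hcs, ← hsa, ← Algebra.smul_def,
      ← Algebra.smul_def, smul_comm]

end Saturation

section RankOne

variable (R : Type*) {M : Type*} [CommRing R] [AddCommGroup M] [Module R M]

/-- For an element `m` with prime annihilator `p`, the elements killed by `p` that are torsion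
modulo `R m` over `R / p`. It is the largest submodule containing `m` that is a module of rank one
over `R / p`, up to torsion. -/
def rankOneSubmodule (m : M) [hp : (Ideal.torsionOf R M m).IsPrime] : Submodule R M where
  carrier := {t | (∀ a ∈ Ideal.torsionOf R M m, a • t = 0) ∧
    ∃ a ∉ Ideal.torsionOf R M m, a • t ∈ Submodule.span R {m}}
  add_mem' := by
    rintro s t ⟨hs, a, ha, has⟩ ⟨ht, b, hb, hbt⟩
    refine ⟨fun c hc => by rw [smul_add, hs c hc, ht c hc, add_zero], a * b,
      fun h => (hp.mem_or_mem h).elim ha hb, ?_⟩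
    rw [smul_add, mul_smul a b t, mul_comm, mul_smul]
    exact add_mem (Submodule.smul_mem _ _ has) (Submodule.smul_mem _ _ hbt)
  zero_mem' := ⟨fun _ _ => smul_zero _, 1, hp.one_notMem, by rw [smul_zero]; exact zero_mem _⟩
  smul_mem' := by
    rintro r t ⟨ht, a, ha, hat⟩
    refine ⟨fun c hc => by rw [smul_comm, ht c hc, smul_zero], a, ha, ?_⟩
    rw [smul_comm]
    exact Submodule.smul_mem _ _ hat

variable (m : M) [hp : (Ideal.torsionOf R M m).IsPrime]

lemma self_mem_rankOneSubmodule : m ∈ rankOneSubmodule R m :=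
  ⟨fun _ ha => ha, 1, hp.one_notMem, by rw [one_smul]; exact Submodule.mem_span_singleton_self m⟩

variable {R m}

lemma exists_smul_rankOneSubmodule_mem_span [IsNoetherian R M] :
    ∃ c ∉ Ideal.torsionOf R M m, ∀ t ∈ rankOneSubmodule R m,
      c • t ∈ Submodule.span R {m} := by
  obtain ⟨G, hG⟩ := IsNoetherian.noetherian (rankOneSubmodule R m)
  choose c hc hcm using fun g : G => (hG ▸ Submodule.subset_span g.2 :
    (g : M) ∈ rankOneSubmodule R m).2
  refine ⟨∏ g, c g, fun h => ?_, fun t ht => ?_⟩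
  · obtain ⟨g, -, hg⟩ := hp.prod_mem_iff.1 h
    exact hc g hg
  · suffices rankOneSubmodule R m ≤
      (Submodule.span R {m}).comap (LinearMap.lsmul R M (∏ g, c g)) from this ht
    rw [← hG, Submodule.span_le]
    intro g hg
    obtain ⟨d, hd⟩ := Finset.dvd_prod_of_mem c (Finset.mem_univ (⟨g, hg⟩ : G))
    rw [SetLike.mem_coe, Submodule.mem_comap, LinearMap.lsmul_apply, hd, mul_comm, mul_smul]
    exact Submodule.smul_mem _ _ (hcm ⟨g, hg⟩)

lemma exists_injective_rankOneSubmodule [IsNoetherian R M]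
    (htf : ∀ t ∈ rankOneSubmodule R m, ∀ a ∉ Ideal.torsionOf R M m, a • t = 0 → t = 0) :
    ∃ f : rankOneSubmodule R m →ₗ[R] R ⧸ Ideal.torsionOf R M m, Function.Injective f := by
  obtain ⟨c, hc, hcm⟩ := exists_smul_rankOneSubmodule_mem_span (R := R) (m := m)
  let e := (Ideal.quotTorsionOfEquivSpanSingleton R M m).symm
  let f : rankOneSubmodule R m →ₗ[R] Submodule.span R {m} :=
    (LinearMap.lsmul R M c).restrict hcm
  have hf : Function.Injective f := (injective_iff_map_eq_zero _).2 fun t ht =>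
    Subtype.ext (htf _ t.2 _ hc (congrArg Subtype.val ht))
  exact ⟨e.toLinearMap ∘ₗ f, e.injective.comp hf⟩

lemma mem_associatedPrimes_of_annihilator_eq [IsNoetherianRing R] {N : Submodule R M} (hN : N.FG)
    {q : Ideal R} [q.IsPrime] (hq : N.annihilator = q) : q ∈ associatedPrimes R M := by
  have := Module.Finite.iff_fg.2 hN
  refine associatedPrimes.subset_of_injective N.injective_subtype
    (Module.associatedPrimes.minimalPrimes_annihilator_subset_associatedPrimes R N ?_)
  rw [show Module.annihilator R N = q from hq, Ideal.minimalPrimes_eq_subsingleton_self]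
  rfl

lemma eq_torsionOf_of_smul_eq_zero {q : Ideal R} [hq : q.IsPrime] {v : M}
    (hqv : ∀ r, r ∈ q ↔ r • v ∈ rankOneSubmodule R m)
    (hv : ∀ a ∈ Ideal.torsionOf R M m, a • v = 0) : q = Ideal.torsionOf R M m := by
  refine le_antisymm (fun s hs => ?_) fun a ha => (hqv a).2 (hv a ha ▸ zero_mem _)
  by_contra hsp
  obtain ⟨-, b, hb, hbs⟩ := (hqv s).1 hs
  refine hq.one_notMem ((hqv 1).2 ?_)
  rw [one_smul]
  exact ⟨hv, b * s, fun h => (hp.mem_or_mem h).elim hb hsp, by rwa [mul_smul]⟩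

lemma mem_associatedPrimes_quotient_rankOneSubmodule [IsNoetherianRing R] {q : Ideal R}
    (hq : q ∈ associatedPrimes R (M ⧸ rankOneSubmodule R m)) :
    q = Ideal.torsionOf R M m ∨ q ∈ associatedPrimes R M := by
  obtain ⟨hqp, v, hv⟩ := isAssociatedPrime_iff.1 hq
  obtain ⟨v, rfl⟩ := Submodule.mkQ_surjective _ v
  have hmem (r : R) : r ∈ q ↔ r • v ∈ rankOneSubmodule R m := by
    rw [hv, Submodule.mem_colon_singleton, Submodule.mem_bot, ← map_smul]
    exact Submodule.Quotient.mk_eq_zero _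
  by_cases h : ∃ r ∉ q, ∀ a ∈ Ideal.torsionOf R M m, a • r • v = 0
  · obtain ⟨r, hr, hrv⟩ := h
    refine .inl (eq_torsionOf_of_smul_eq_zero (fun s => ?_) hrv)
    rw [← mul_smul, ← hmem, hqp.mul_mem_iff_mem_or_mem, or_iff_left hr]
  · push Not at h
    refine .inr (mem_associatedPrimes_of_annihilator_eq
      (N := Submodule.map (LinearMap.toSpanSingleton R M v) (Ideal.torsionOf R M m))
      (Submodule.FG.map _ (IsNoetherian.noetherian _)) ?_)
    ext r
    rw [Submodule.mem_annihilator]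
    refine ⟨fun hr => ?_, ?_⟩
    · by_contra hrq
      obtain ⟨a, ha, hav⟩ := h r hrq
      exact hav (by rw [smul_comm]; exact hr _ ⟨a, ha, rfl⟩)
    · rintro hr _ ⟨a, ha, rfl⟩
      rw [LinearMap.toSpanSingleton_apply, smul_comm]
      exact ((hmem r).1 hr).1 a ha

end RankOne

section DimensionTwo

variable {R : Type*} [CommRing R]

lemma eq_of_le_of_ringKrullDim_quotient_eq {n : ℕ} {p q : Ideal R} [p.IsPrime] (hpq : p ≤ q)
    (hp : ringKrullDim (R ⧸ p) = n) (hq : ringKrullDim (R ⧸ q) = n) : p = q := by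
  refine le_antisymm hpq fun r hr => ?_
  by_contra hrp
  have hreg : Ideal.Quotient.mk p r ∈ nonZeroDivisors (R ⧸ p) :=
    mem_nonZeroDivisors_of_ne_zero fun h => hrp (Ideal.Quotient.eq_zero_iff_mem.1 h)
  have hsucc := ringKrullDim_succ_le_of_surjective (Ideal.Quotient.factor hpq)
    (Ideal.Quotient.factor_surjective hpq) hreg
    (by rw [Ideal.Quotient.factor_mk, Ideal.Quotient.eq_zero_iff_mem.2 hr])
  rw [hp, hq] at hsucc
  exact n.not_succ_le_self (by exact_mod_cast hsucc)

lemma exists_submodule_injective_quotient_prime {M : Type*} [AddCommGroup M] [Module R M]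
    [IsNoetherianRing R] [IsNoetherian R M] [Nontrivial M] {n : ℕ}
    (hM : ∀ q ∈ associatedPrimes R M, ringKrullDim (R ⧸ q) = n) :
    ∃ p ∈ associatedPrimes R M, ∃ T : Submodule R M, T ≠ ⊥ ∧
      (∃ f : T →ₗ[R] R ⧸ p, Function.Injective f) ∧
      ∀ q ∈ associatedPrimes R (M ⧸ T), ringKrullDim (R ⧸ q) = n := by
  obtain ⟨p, hpM⟩ := associatedPrimes.nonempty R M
  obtain ⟨hp, m, hm⟩ := isAssociatedPrime_iff.1 hpM
  obtain rfl : p = Ideal.torsionOf R M m := by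
    ext r
    rw [hm, Submodule.mem_colon_singleton, Submodule.mem_bot, Ideal.mem_torsionOf_iff]
  have hpdim := hM _ hpM
  refine ⟨_, hpM, rankOneSubmodule R m, fun hbot => hp.ne_top ?_,
    exists_injective_rankOneSubmodule fun t ht a ha hat => ?_, fun q hq => ?_⟩
  · rw [Ideal.torsionOf_eq_top_iff, ← Submodule.mem_bot R, ← hbot]
    exact self_mem_rankOneSubmodule R m
  · by_contra ht0
    obtain ⟨q, hq, htq⟩ := exists_le_isAssociatedPrime_of_isNoetherianRing R t ht0
    have hle (r : R) (hr : r • t = 0) : r ∈ q := htq (Submodule.mem_colon_singleton.2 hr)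
    have hpq := eq_of_le_of_ringKrullDim_quotient_eq (fun r hr => hle r (ht.1 r hr)) hpdim (hM q hq)
    exact ha (hpq ▸ hle a hat)
  · rcases mem_associatedPrimes_quotient_rankOneSubmodule hq with rfl | hq
    · exact hpdim
    · exact hM q hq

variable [IsLocalRing R]

lemma radical_map_eq_maximalIdeal {S : Type*} [CommRing S] [IsLocalRing S] {f : R →+* S}
    (hf : Function.Surjective f) {I : Ideal R} (hI : I.radical = maximalIdeal R) :
    (I.map f).radical = maximalIdeal S := by
  rw [← map_maximalIdeal_of_surjective f hf, ← hI]
  refine le_antisymm ?_ (Ideal.map_radical_le f)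
  rw [hI, map_maximalIdeal_of_surjective f hf, Ideal.IsPrime.radical_le_iff inferInstance,
    ← map_maximalIdeal_of_surjective f hf, ← hI]
  exact Ideal.map_mono Ideal.le_radical

variable {x y : R}

lemma radical_span_pair_mk_eq {I : Ideal R} [IsLocalRing (R ⧸ I)]
    (hrad : (Ideal.span {x, y}).radical = maximalIdeal R) :
    (Ideal.span {Ideal.Quotient.mk I x, Ideal.Quotient.mk I y}).radical =
      maximalIdeal (R ⧸ I) := by
  rw [← Set.image_pair, ← Ideal.map_span]
  exact radical_map_eq_maximalIdeal Ideal.Quotient.mk_surjective hrad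

variable [IsNoetherianRing R]

lemma ringKrullDim_le_one_of_radical_span_singleton_eq
    (hy : (Ideal.span {y}).radical = maximalIdeal R) : ringKrullDim R ≤ 1 := by
  rw [← maximalIdeal_height_eq_ringKrullDim]
  exact_mod_cast Ideal.height_le_one_of_isPrincipal_of_mem_minimalPrimes _ _
    (maximalIdeal_mem_minimalPrimes_of_radical_eq hy)

lemma notMem_of_ringKrullDim_quotient_eq_two
    (hrad : (Ideal.span {x, y}).radical = maximalIdeal R) {I : Ideal R}
    (hdim : ringKrullDim (R ⧸ I) = 2) : x ∉ I := by
  intro hx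
  have hI : I ≠ ⊤ := by
    rintro rfl
    rw [ringKrullDim_eq_bot_of_subsingleton] at hdim
    exact WithBot.bot_ne_coe hdim
  have := isLocalRing_quotient hI
  have hy := radical_span_pair_mk_eq (I := I) hrad
  rw [Ideal.Quotient.eq_zero_iff_mem.2 hx, Ideal.span_insert_zero] at hy
  have hle := ringKrullDim_le_one_of_radical_span_singleton_eq hy
  rw [hdim] at hle
  exact absurd hle (by norm_num)

lemma isSMulRegular_of_associatedPrimes {M : Type*} [AddCommGroup M] [Module R M]
    (hrad : (Ideal.span {x, y}).radical = maximalIdeal R)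
    (hM : ∀ q ∈ associatedPrimes R M, ringKrullDim (R ⧸ q) = 2) : IsSMulRegular M x := by
  by_contra hx
  have hmem : x ∈ ⋃ p ∈ associatedPrimes R M, (p : Set R) := by
    rw [biUnion_associatedPrimes_eq_compl_regular]
    exact hx
  obtain ⟨p, hp, hxp⟩ := Set.mem_iUnion₂.1 hmem
  exact notMem_of_ringKrullDim_quotient_eq_two hrad (hM p hp) hxp

end DimensionTwo

section Excellent

lemma exists_lift_of_sub_mem_map_pow {R S : Type*} [CommRing R] [CommRing S] {f : R →+* S}
    (hf : Function.Surjective f) {I : Ideal R} (w : ℕ → S)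
    (hw : ∀ n, w (n + 1) - w n ∈ I.map f ^ n) :
    ∃ v : ℕ → R, (∀ n, v (n + 1) - v n ∈ I ^ n) ∧ ∀ n, f (v n) = w n := by
  simp only [← Ideal.map_pow, Ideal.mem_map_iff_of_surjective f hf] at hw
  choose d hd hdw using hw
  obtain ⟨v₀, hv₀⟩ := hf (w 0)
  refine ⟨fun n => v₀ + ∑ i ∈ Finset.range n, d i, fun n => ?_, fun n => ?_⟩
  · beta_reduce
    rw [Finset.sum_range_succ, add_sub_add_left_eq_sub, add_sub_cancel_left]
    exact hd n
  · simp only [map_add, map_sum, hdw, hv₀, Finset.sum_range_sub, add_sub_cancel]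

variable {R : Type u} [CommRing R] [IsLocalRing R]

lemma IsExcellentRing.mem_sup_pow_of_sq_mem (hR : IsExcellentRing R) (p : Ideal R) [p.IsPrime]
    (w : ℕ → R) (hw : ∀ n, w (n + 1) - w n ∈ maximalIdeal R ^ n)
    (hsq : ∀ n, w n ^ 2 ∈ p ⊔ maximalIdeal R ^ n) (n : ℕ) : w n ∈ p ⊔ maximalIdeal R ^ n := by
  have := hR.noetherian
  let e : R ≃+* Localization.AtPrime (maximalIdeal R) :=
    (IsLocalization.atUnits R (maximalIdeal R).primeCompl
      fun _ hx => notMem_maximalIdeal.1 hx).toRingEquiv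
  have hmem (r : R) (n : ℕ) : e r ∈ p.map e ⊔
      maximalIdeal (Localization.AtPrime (maximalIdeal R)) ^ n ↔ r ∈ p ⊔ maximalIdeal R ^ n := by
    rw [← map_ringEquiv_maximalIdeal e, ← Ideal.map_pow, ← Ideal.map_sup]
    refine ⟨fun h => ?_, Ideal.mem_map_of_mem _⟩
    obtain ⟨s, hs, hse⟩ := (Ideal.mem_map_of_equiv e _).1 h
    rwa [← e.injective hse]
  have := Ideal.map_isPrime_of_equiv e (I := p)
  refine (hmem _ n).1 ((hR.gRing (maximalIdeal R)).mem_sup_pow_of_sq_mem (p.map e)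
    (fun n => e (w n)) (fun n => ?_) (fun n => ?_) n)
  · rw [← map_sub, ← map_ringEquiv_maximalIdeal e, ← Ideal.map_pow]
    exact Ideal.mem_map_of_mem _ (hw n)
  · rw [← map_pow, hmem]
    exact hsq n

lemma IsExcellentRing.mem_maximalIdeal_quotient_pow_of_sq_mem (hR : IsExcellentRing R)
    (p : Ideal R) [p.IsPrime] [IsLocalRing (R ⧸ p)] (w : ℕ → R ⧸ p)
    (hw : ∀ n, w (n + 1) - w n ∈ maximalIdeal (R ⧸ p) ^ n)
    (hsq : ∀ n, w n ^ 2 ∈ maximalIdeal (R ⧸ p) ^ n) (n : ℕ) :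
    w n ∈ maximalIdeal (R ⧸ p) ^ n := by
  have hsurj := Ideal.Quotient.mk_surjective (I := p)
  have hmem (r : R) (n : ℕ) : Ideal.Quotient.mk p r ∈ maximalIdeal (R ⧸ p) ^ n ↔
      r ∈ p ⊔ maximalIdeal R ^ n := by
    rw [← map_maximalIdeal_of_surjective _ hsurj, ← Ideal.map_pow, Ideal.mem_quotient_iff_mem_sup,
      sup_comm]
  obtain ⟨v, hv, hvw⟩ := exists_lift_of_sub_mem_map_pow hsurj (I := maximalIdeal R) w
    (by rwa [map_maximalIdeal_of_surjective _ hsurj])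
  simp only [← hvw, ← map_pow, hmem] at hsq ⊢
  exact hR.mem_sup_pow_of_sq_mem p v hv hsq n

variable {x y : R}

lemma IsExcellentRing.saturationBounded_quotient_prime (hR : IsExcellentRing R)
    (hrad : (Ideal.span {x, y}).radical = maximalIdeal R) (p : Ideal R) [p.IsPrime]
    (hdim : ringKrullDim (R ⧸ p) = 2) : SaturationBounded x y (R ⧸ p) := by
  have := hR.noetherian
  have := isLocalRing_quotient (Ideal.IsPrime.ne_top ‹p.IsPrime›)
  have hx : Ideal.Quotient.mk p x ≠ 0 := fun h =>
    notMem_of_ringKrullDim_quotient_eq_two hrad hdim (Ideal.Quotient.eq_zero_iff_mem.1 h)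
  refine saturationBounded_algebraMap_iff.1
    ((saturationBounded_self_iff (mem_nonZeroDivisors_of_ne_zero hx)).2 ?_)
  exact exists_pow_smul_idealTransform_mem_range hdim
    (hR.universallyCatenary (Polynomial (R ⧸ p)))
    (hR.mem_maximalIdeal_quotient_pow_of_sq_mem p) (radical_span_pair_mk_eq hrad) hx

lemma IsExcellentRing.saturationBounded {M : Type*} [AddCommGroup M] [Module R M]
    [Module.Finite R M] (hR : IsExcellentRing R)
    (hrad : (Ideal.span {x, y}).radical = maximalIdeal R)
    (hM : ∀ q ∈ associatedPrimes R M, ringKrullDim (R ⧸ q) = 2) : SaturationBounded x y M := by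
  have := hR.noetherian
  suffices ∀ N : Submodule R M, (∀ q ∈ associatedPrimes R (M ⧸ N), ringKrullDim (R ⧸ q) = 2) →
      SaturationBounded x y (M ⧸ N) by
    let e := Submodule.quotEquivOfEqBot (⊥ : Submodule R M) rfl
    exact (this ⊥ (LinearEquiv.AssociatedPrimes.eq e ▸ hM)).of_linearEquiv e
  intro N hN
  induction N using WellFoundedGT.induction with
  | _ N ih =>
    rcases subsingleton_or_nontrivial (M ⧸ N) with _ | _
    · exact ⟨0, fun _ _ _ _ _ => ⟨0, Subsingleton.elim _ _⟩⟩
    obtain ⟨p, hp, T, hT, ⟨f, hf⟩, hMT⟩ := exists_submodule_injective_quotient_prime hN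
    have := hp.isPrime
    let g : M →ₗ[R] (M ⧸ N) ⧸ T := T.mkQ ∘ₗ N.mkQ
    let e := g.quotKerEquivOfSurjective (T.mkQ_surjective.comp N.mkQ_surjective)
    have hker : N < LinearMap.ker g := by
      rw [LinearMap.ker_comp, Submodule.ker_mkQ]
      conv_lhs => rw [← N.ker_mkQ, ← Submodule.comap_bot]
      exact Submodule.comap_strictMono_of_surjective N.mkQ_surjective hT.bot_lt
    exact .of_submodule_quotient T (isSMulRegular_of_associatedPrimes hrad hMT)
      ((hR.saturationBounded_quotient_prime hrad p (hN p hp)).of_injective hf)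
      ((ih _ hker (LinearEquiv.AssociatedPrimes.eq e ▸ hMT)).of_linearEquiv e)

lemma isFiniteLength_H1m_of_pow_smul_mem_range [IsNoetherianRing R] (hx : x ∈ nonZeroDivisors R)
    (hrad : (Ideal.span {x, y}).radical = maximalIdeal R) {k : ℕ}
    (hk : ∀ s : idealTransform (Ideal.span {x, y}), x ^ k • s ∈ LinearMap.range (toTransform _)) :
    IsFiniteLength R (H1m R) := by
  have hxI : x ∈ Ideal.span {x, y} := Ideal.subset_span (Set.mem_insert x _)
  have hyI : y ∈ Ideal.span {x, y} := Ideal.subset_span (Set.mem_insert_of_mem x rfl)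
  have hfin : IsNoetherian R (idealTransform (Ideal.span {x, y})) :=
    isNoetherian_of_injective ((LinearMap.lsmul R _ (x ^ k)).codRestrict _ hk) fun s t h =>
      Subtype.ext ((bijective_lsmul_fractionRing (pow_mem hx k)).1
        (congrArg (fun z => z.1.1) h))
  obtain ⟨f, hf, hker⟩ := exists_surjective_idealTransform hrad hx hxI
  have e := Submodule.quotEquivOfEq _ _ hker.symm ≪≫ₗ f.quotKerEquivOfSurjective hf
  exact e.isFiniteLength (isFiniteLength_of_exists_pow_smul_eq_zero hrad
    (exists_pow_smul_transform_quotient_eq_zero hxI)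
    (exists_pow_smul_transform_quotient_eq_zero hyI))

lemma IsUnmixedRing.mem_nonZeroDivisors [IsNoetherianRing R] (hR : IsUnmixedRing R)
    (hxy : IsSystemOfParameters ![x, y]) : x ∈ nonZeroDivisors R :=
  mem_nonZeroDivisors_iff_left.2 <| isSMulRegular_iff_right_eq_zero_of_smul.1 <|
    isSMulRegular_of_associatedPrimes (range_pair x y ▸ hxy.2) fun q hq => (hR q hq).trans hxy.1

lemma IsExcellentRing.isFiniteLength_H1m (hR : IsExcellentRing R) (hunm : IsUnmixedRing R)
    (hxy : IsSystemOfParameters ![x, y]) : IsFiniteLength R (H1m R) := by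
  have := hR.noetherian
  have hrad : (Ideal.span {x, y}).radical = maximalIdeal R := range_pair x y ▸ hxy.2
  have hx := hunm.mem_nonZeroDivisors hxy
  obtain ⟨k, hk⟩ := (saturationBounded_self_iff hx).1
    (hR.saturationBounded hrad fun q hq => (hunm q hq).trans hxy.1)
  exact isFiniteLength_H1m_of_pow_smul_mem_range hx hrad hk

end Excellent

/-! ### The formulas for the Hilbert coefficients -/

section ParameterPair

open RingTheory.Sequence

variable {R : Type u} [CommRing R] {x y : R}

lemma relLength_span_pair_smul (hx : x ∈ nonZeroDivisors R) {H : Type v} [AddCommGroup H]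
    [Module R H] {f : idealTransform (Ideal.span {x, y}) →ₗ[R] H} (hf : Function.Surjective f)
    (hker : LinearMap.ker f = LinearMap.range (toTransform (Ideal.span {x, y}))) :
    relLength (Ideal.span {x, y} • (⊤ : Submodule R (idealTransform (Ideal.span {x, y})))) ⊤ =
      Module.length R (R ⧸ limitClosure ![x, y]) +
        Module.length R (H ⧸ (Ideal.span {x, y} • ⊤ : Submodule R H)) := by
  rw [length_quotient_smul_top hf, hker, limitClosure_eq_comap hx, length_quotient_comap,
    relLength_add le_sup_right le_top]

lemma isStandardParameters_pair [IsNoetherianRing R] [IsLocalRing R] (hdim : ringKrullDim R = 2)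
    {S : Type*} [AddCommGroup S] [Module R S] {j : R →ₗ[R] S} (h : IsWeaklyRegular S [x, y])
    (hj : Function.Injective j) (hN : relLength (LinearMap.range j) ⊤ ≠ ⊤)
    (hQ : (Ideal.span {x, y}).radical = maximalIdeal R)
    (hQN : Ideal.span {x, y} • ⊤ ≤ LinearMap.range j) : IsStandardParameters ![x, y] := by
  rw [IsStandardParameters, range_pair, range_pair_pow,
    lengthInt_quotient_sub_hilbertCoeff_zero hdim h hj hN
      (length_quotient_ne_top_of_radical_eq hQ) hQN,
    lengthInt_quotient_sub_hilbertCoeff_zero hdim (isWeaklyRegular_pair_pow h 2 2) hj hN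
      (length_quotient_ne_top_of_radical_eq ((radical_span_pair_pow x y two_ne_zero).trans hQ))
      ((Submodule.smul_mono_left (span_pair_pow_le x y two_ne_zero)).trans hQN)]

variable {S : Type*} {H : Type v} [AddCommGroup S] [Module R S] [AddCommGroup H] [Module R H]
  {f : S →ₗ[R] H} {N : Submodule R S} {b : ℤ}

lemma lengthInt_quotient_smul_le_of_powColength_succ (h : IsWeaklyRegular S [x, y])
    (hf : Function.Surjective f) (hker : LinearMap.ker f = N) (hN : relLength N ⊤ ≠ ⊤)
    (hb : ∀ᶠ n in Filter.atTop, (powColength x y N (n + 1) : ℤ) = powColength x y N n + b) :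
    lengthInt R (H ⧸ (Ideal.span {x, y} • ⊤ : Submodule R H)) ≤ b := by
  rw [lengthInt, length_quotient_smul_top hf, hker]
  exact relLength_sup_le_of_powColength_succ h hN hb

lemma eq_lengthInt_of_smul_top_eq_bot (h : IsWeaklyRegular S [x, y])
    (hf : Function.Surjective f) (hker : LinearMap.ker f = N)
    (hb : ∀ᶠ n in Filter.atTop, (powColength x y N (n + 1) : ℤ) = powColength x y N n + b)
    (hQH : Ideal.span {x, y} • (⊤ : Submodule R H) = ⊥) :
    b = lengthInt R (H ⧸ (Ideal.span {x, y} • ⊤ : Submodule R H)) := by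
  have hQN := hker ▸ smul_top_le_ker (f := f) hQH
  rw [lengthInt, length_quotient_smul_top hf, hker, sup_eq_left.2 hQN]
  exact eq_relLength_of_smul_top_le h hb hQN

lemma IsSuperficial.eq_lengthInt [IsLocalRing R] {j : R →ₗ[R] S}
    (hx : IsSuperficial (Ideal.span {x, y}) x) (hrad : (Ideal.span {x, y}).radical = maximalIdeal R)
    (h : IsWeaklyRegular S [x, y]) (hj : Function.Injective j) (hf : Function.Surjective f)
    (hker : LinearMap.ker f = LinearMap.range j) (hH : IsFiniteLength R H)
    (hb : ∀ᶠ n in Filter.atTop, (powColength x y (LinearMap.range j) (n + 1) : ℤ) =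
      powColength x y (LinearMap.range j) n + b) :
    b = lengthInt R (H ⧸ (Ideal.span {x} • ⊤ : Submodule R H)) := by
  obtain ⟨t, ht⟩ := exists_pow_maximalIdeal_smul_top_eq_bot hH
  have hQt : Ideal.span {x, y} ^ t • ⊤ ≤ LinearMap.range j :=
    (Submodule.smul_mono_left (Ideal.pow_right_mono (hrad ▸ Ideal.le_radical) t)).trans
      (hker ▸ smul_top_le_ker ht)
  have hN : relLength (LinearMap.range j) ⊤ ≠ ⊤ := by
    rw [← hker, relLength_ker_top hf]
    exact Module.length_ne_top_iff.2 hH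
  rw [lengthInt, length_quotient_smul_top hf, hker, Submodule.ideal_span_singleton_smul]
  exact eq_relLength_of_mulKernel_le h hN hb (hx.eventually_mulKernel_le hj hQt)

theorem proposition3p5_general [IsNoetherianRing R] [IsLocalRing R]
    (hfin : IsFiniteLength R (H1m R)) (hx : x ∈ nonZeroDivisors R)
    (hxy : IsSystemOfParameters ![x, y]) {Q : Ideal R} (hQ : Q = Ideal.span {x, y}) :
    HasHilbertCoeffs Q 2 (hilbertCoeff Q) ∧
    IsFiniteLength R (R ⧸ limitClosure ![x, y]) ∧
    IsFiniteLength R (H1mQuot R Q) ∧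
    hilbertCoeff Q 0 - lengthInt R (R ⧸ limitClosure ![x, y]) = lengthInt R (H1mQuot R Q) ∧
    (IsSuperficial Q x →
      IsFiniteLength R (H1mQuot R (Ideal.span {x})) ∧
      hilbertCoeff Q 0 - lengthInt R (R ⧸ limitClosure ![x, y]) + hilbertCoeff Q 1 =
        lengthInt R (H1mQuot R Q) - lengthInt R (H1mQuot R (Ideal.span {x}))) ∧
    hilbertCoeff Q 0 - lengthInt R (R ⧸ limitClosure ![x, y]) + hilbertCoeff Q 1 ≤ 0 ∧
    (Q • (⊤ : Submodule R (H1m R)) = ⊥ →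
      IsStandardParameters ![x, y] ∧
      hilbertCoeff Q 0 - lengthInt R (R ⧸ limitClosure ![x, y]) + hilbertCoeff Q 1 = 0) := by
  subst hQ
  have hdim : ringKrullDim R = 2 := hxy.1
  have hrad : (Ideal.span {x, y}).radical = maximalIdeal R := range_pair x y ▸ hxy.2
  have hRQ := length_quotient_ne_top_of_radical_eq hrad
  obtain ⟨f, hf, hker⟩ := exists_surjective_idealTransform hrad hx
    (Ideal.subset_span (Set.mem_insert x _))
  have hS := isWeaklyRegular_idealTransform (y := y) hx
  have hj := toTransform_injective (Ideal.span {x, y})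
  have hN : relLength (LinearMap.range (toTransform (Ideal.span {x, y}))) ⊤ ≠ ⊤ := by
    rw [← hker, relLength_ker_top hf]
    exact Module.length_ne_top_iff.2 hfin
  have hHI (I : Ideal R) : Module.length R (H1mQuot R I) ≠ ⊤ := by
    rw [length_quotient_smul_top hf, hker]
    exact relLength_sup_ne_top hN _
  obtain ⟨hH, he₀, hb⟩ := hilbertCoeff_span_pair hdim hS hj hN hRQ
  have hQS := relLength_span_pair_smul_ne_top hS hj hN hRQ
  rw [relLength_span_pair_smul hx hf hker] at he₀ hQS
  have h₁ : hilbertCoeff (Ideal.span {x, y}) 0 - lengthInt R (R ⧸ limitClosure ![x, y]) =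
      lengthInt R (H1mQuot R (Ideal.span {x, y})) := by
    rw [he₀, ENat.toNat_add (WithTop.add_ne_top.1 hQS).1 (hHI _), Nat.cast_add]
    exact add_sub_cancel_left _ _
  refine ⟨hH, Module.length_ne_top_iff.1 (WithTop.add_ne_top.1 hQS).1,
    Module.length_ne_top_iff.1 (hHI _), h₁, fun hsup => ⟨Module.length_ne_top_iff.1 (hHI _), ?_⟩,
    ?_, fun hQH => ⟨isStandardParameters_pair hdim hS hj hN hrad (hker ▸ smul_top_le_ker hQH), ?_⟩⟩
  · rw [h₁, ← hsup.eq_lengthInt hrad hS hj hf hker hfin hb, sub_neg_eq_add]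
  · have hle := lengthInt_quotient_smul_le_of_powColength_succ hS hf hker hN hb
    rw [h₁]
    linarith
  · rw [h₁, ← eq_lengthInt_of_smul_top_eq_bot hS hf hker hb hQH, neg_add_cancel]

end ParameterPair

end

theorem proposition3p5 {R : Type*} [CommRing R] [IsLocalRing R]
    (hexc : IsExcellentRing R) (hunm : IsUnmixedRing R) (hdim : ringKrullDim R = 2)
    (x y : R) (hxy : IsSystemOfParameters ![x, y])
    (Q : Ideal R) (hQ : Q = Ideal.span {x, y}) :
    -- the Hilbert coefficients exist and all lengths involved are finite
    HasHilbertCoeffs Q 2 (hilbertCoeff Q) ∧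
    IsFiniteLength R (R ⧸ limitClosure ![x, y]) ∧
    IsFiniteLength R (H1mQuot R Q) ∧
    -- (1)
    hilbertCoeff Q 0 - lengthInt R (R ⧸ limitClosure ![x, y]) = lengthInt R (H1mQuot R Q) ∧
    -- (2)
    (IsSuperficial Q x →
      IsFiniteLength R (H1mQuot R (Ideal.span {x})) ∧
      hilbertCoeff Q 0 - lengthInt R (R ⧸ limitClosure ![x, y]) + hilbertCoeff Q 1 =
        lengthInt R (H1mQuot R Q) - lengthInt R (H1mQuot R (Ideal.span {x}))) ∧
    hilbertCoeff Q 0 - lengthInt R (R ⧸ limitClosure ![x, y]) + hilbertCoeff Q 1 ≤ 0 ∧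
    (Q • (⊤ : Submodule R (H1m R)) = ⊥ →
      IsStandardParameters ![x, y] ∧
      hilbertCoeff Q 0 - lengthInt R (R ⧸ limitClosure ![x, y]) + hilbertCoeff Q 1 = 0) := by
  have := hexc.noetherian
  exact proposition3p5_general (hexc.isFiniteLength_H1m hunm hxy) (hunm.mem_nonZeroDivisors hxy)
    hxy hQ
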